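/- Let $R$ and $S$ be (not necessarily commutative) rings, $M$ an $R$-$R$-bimodule and $N$ an $S$-$S$-bimodule. Let $\mathrm{Mod}^c_{R,S}$ be the category of $R$-$S$-bimodules that are finitely generated and projective as right $S$-modules. Assume that $M\otimes_R-$ and $-\otimes_S N$ send $\mathrm{Mod}^c_{R,S}$ to itself, and that $M\cong R$ or $N\cong S$ as bimodules. **Notation.** For an $R$-$R$-bimodule $M$ and an $S$-$S$-bimodule $N$, $\mathrm{End}(R,S;M,N)$ is the category of bimodule homomorphisms $f\colon M\otimes_R P\to P\otimes_S N$ with $P\in\mathrm{Mod}^c_{R,S}$; a morphism $f\to g$ is a bimodule map $\phi\colon P\to Q$ with $g(\mathrm{id}\otimes\phi)=(\phi\otimes\mathrm{id})f$. $K_0$ of such a category is the abelian group generated by its objects with one relation $[B]=[A]+[C]$ for every sequence $A\to B\to C$ whose underlying sequence(s) of bimodules are short exact, and $\widetilde K_0(R,S;M,N)$ is the cokernel of $K_0(\mathrm{Mod}^c_{R,S})\to K_0(\mathrm{End}(R,S;M,N))$, $[P]\mapsto[0\colon M\otimes P\to P\otimes N]$. For $n\ge1$ let $\widetilde K_0(R,S;M,N)_n$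 be the group defined in the same way from the category of cyclic tuples $(f_j\colon M\otimes_R c_{j+1}\to c_j\otimes_S N)_{j\in\mathbb Z/n}$, $c_j\in\mathrm{Mod}^c_{R,S}$, modulo tuples of zero maps. Composition $$\Gamma(f_0,\dots,f_{n-1})\colon M^{\otimes n}\otimes c_0\to M^{\otimes (n-1)}\otimes c_{n-1}\otimes N\to\cdots\to c_0\otimes N^{\otimes n}$$ induces $\Gamma\colon \widetilde K_0(R,S;M,N)_n\to\widetilde K_0(R,S;M^{\otimes n},N^{\otimes n})$; put $F^n[f]=[\Gamma(f,\dots,f)]$. The cyclic summing functor sends $(f_j)$ to the map $M\otimes\bigoplus_j c_j\to\bigl(\bigoplus_j c_j\bigr)\otimes N$ that is $f_j$ from the summand $c_{j+1}$ to the summand $c_j$, and induces $\sigma\colon\widetilde K_0(R,S;M,N)_n\to\widetilde K_0(R,S;M,N)$. For an $R$-$R$-bimodule $X$ let $\langle\langle X\rangle\rangle=X/\langle rx-xr\rangle$. The trace of $f\colon M\otimes P\to P\otimes N$ is $\mathrm{tr}(f)\colon\langle\langle M\rangle\rangle\to\langle\langle N\rangle\rangle$, $[m]\mapsto\sum_i[(\varphi_i\otimes1)f(m\otimes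 e_i)]$ for any finite dual basis $(e_i,\varphi_i)$ of the right $S$-module $P$; it induces a homomorphism on $\widetilde K_0(R,S;M,N)$. The iterated trace $\mathrm{tr}_\bullet$ has components $\mathrm{tr}_j=\mathrm{tr}\circ F^j\colon\widetilde K_0(R,S;M,N)\to\mathrm{Map}(\langle\langle M^{\otimes j}\rangle\rangle,\langle\langle N^{\otimes j}\rangle\rangle)$, $j\ge1$. Let $\varsigma$ denote the rotation $[x_0\otimes x_1\otimes\cdots\otimes x_{j-1}]\mapsto[x_1\otimes\cdots\otimes x_{j-1}\otimes x_0]$; $\mathbb Z/j$ acts on these maps by $h\mapsto\varsigma h\varsigma^{-1}$. For $n,k\ge1$ and $h\colon\langle\langle (M^{\otimes n})^{\otimes k}\rangle\rangle\to\langle\langle (N^{\otimes n})^{\otimes k}\rangle\rangle$, the transfer along $\mathbb Z/k\subseteq\mathbb Z/nk$ is $$\tau(h)=\sum_{i=0}^{n-1}\varsigma^{i}\,h\,\varsigma^{-i}\colon \langle\langle M^{\otimes nk}\rangle\rangle\to\langle\langle N^{\otimes nk}\rangle\rangle .$$ **Theorem.** For all $n,m\ge1$ the maps $\Gamma\colon\widetilde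 K_0(R,S;M,N)_n\to\widetilde K_0(R,S;M^{\otimes n},N^{\otimes n})$ and $\Gamma\colon\widetilde K_0(R,S;M^{\otimes n},N^{\otimes n})_m\to\widetilde K_0(R,S;(M^{\otimes n})^{\otimes m},(N^{\otimes n})^{\otimes m})$ are isomorphisms, so that there are homomorphisms $$V^n=\sigma\circ\Gamma^{-1}\colon\widetilde K_0(R,S;M^{\otimes n},N^{\otimes n})\to\widetilde K_0(R,S;M,N)$$ and likewise $V^m$ with $M^{\otimes n}$, $N^{\otimes n}$ in place of $M$, $N$. They satisfy: 1. $V^nV^m=V^{nm}$, under the canonical isomorphisms $(M^{\otimes n})^{\otimes m}\cong M^{\otimes nm}$ and $(N^{\otimes n})^{\otimes m}\cong N^{\otimes nm}$. 2. For all $j\ge1$ and $x\in\widetilde K_0(R,S;M,N)$, the map $\mathrm{tr}_j(x)$ is $\mathbb Z/j$-equivariant, that is, $\varsigma\,\mathrm{tr}_j(x)\,\varsigma^{-1}=\mathrm{tr}_j(x)$. 3. For all $n,j\ge1$ and $x\in\widetilde K_0(R,S;M^{\otimes n},N^{\otimes n})$, $$\mathrm{tr}_j(V^n x)=\begin{cases}\tau\bigl(\mathrm{tr}_{j/n}(x)\bigr)&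 n\mid j,\\ 0& n\nmid j.\end{cases}$$ -/

import Mathlib

open scoped TensorProduct
open MulOpposite

universe u v

/-- An `R`-`S`-bimodule: an abelian group with a left `R`-action and a commuting right
`S`-action, the latter written as a left action of `Sᵐᵒᵖ`. -/
structure BiMod (R S : Type u) [Ring R] [Ring S] where
  carrier : Type u
  [addCommGroup : AddCommGroup carrier]
  [leftModule : Module R carrier]
  [rightModule : Module Sᵐᵒᵖ carrier]
  [smulComm : SMulCommClass R Sᵐᵒᵖ carrier]

namespace BiMod

variable {R S T U V : Type u} [Ring R] [Ring S] [Ring T] [Ring U] [Ring V]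

instance : CoeSort (BiMod R S) (Type u) := ⟨BiMod.carrier⟩

attribute [instance] BiMod.addCommGroup BiMod.leftModule BiMod.rightModule BiMod.smulComm

/-- A homomorphism of `R`-`S`-bimodules. -/
@[ext]
structure Hom (X Y : BiMod R S) where
  toFun : X →+ Y
  map_left : ∀ (r : R) (x : X), toFun (r • x) = r • toFun x
  map_right : ∀ (s : S) (x : X), toFun (op s • x) = op s • toFun x

namespace Hom

instance (X Y : BiMod R S) : FunLike (Hom X Y) X Y where
  coe f := f.toFun
  coe_injective _ _ h := Hom.ext (DFunLike.coe_injective h)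

instance (X Y : BiMod R S) : AddMonoidHomClass (Hom X Y) X Y where
  map_add f := f.toFun.map_add
  map_zero f := f.toFun.map_zero

theorem smul_left {X Y : BiMod R S} (f : Hom X Y) (r : R) (x : X) : f (r • x) = r • f x :=
  f.map_left r x

theorem smul_right {X Y : BiMod R S} (f : Hom X Y) (s : S) (x : X) :
    f (op s • x) = op s • f x :=
  f.map_right s x

theorem funext {X Y : BiMod R S} {f g : Hom X Y} (h : ∀ x, f x = g x) : f = g :=
  DFunLike.ext f g h

/-- The identity homomorphism. -/
def id (X : BiMod R S) : Hom X X := ⟨AddMonoidHom.id X, fun _ _ => rfl, fun _ _ => rfl⟩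

/-- Composition `g ∘ f`. -/
def comp {X Y Z : BiMod R S} (g : Hom Y Z) (f : Hom X Y) : Hom X Z where
  toFun := g.toFun.comp f.toFun
  map_left r x := by
    change g (f (r • x)) = r • g (f x)
    rw [f.smul_left, g.smul_left]
  map_right s x := by
    change g (f (op s • x)) = op s • g (f x)
    rw [f.smul_right, g.smul_right]

instance (X Y : BiMod R S) : Zero (Hom X Y) :=
  ⟨⟨0, fun r _ => (smul_zero r).symm, fun s _ => (smul_zero (op s)).symm⟩⟩

/-- A finite sum of bimodule homomorphisms. -/
def sum {ι : Type} [Fintype ι] {X Y : BiMod R S} (f : ι → Hom X Y) : Hom X Y where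
  toFun := ∑ i, (f i).toFun
  map_left r x := by
    simp only [AddMonoidHom.finsetSum_apply, (f _).map_left, Finset.smul_sum]
  map_right s x := by
    simp only [AddMonoidHom.finsetSum_apply, (f _).map_right, Finset.smul_sum]

@[simp] theorem id_apply {X : BiMod R S} (x : X) : Hom.id X x = x := rfl
@[simp] theorem comp_apply {X Y Z : BiMod R S} (g : Hom Y Z) (f : Hom X Y) (x : X) :
    g.comp f x = g (f x) := rfl
@[simp] theorem zero_apply {X Y : BiMod R S} (x : X) : (0 : Hom X Y) x = 0 := rfl
@[simp] theorem sum_apply {ι : Type} [Fintype ι] {X Y : BiMod R S} (f : ι → Hom X Y) (x : X) :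
    sum f x = ∑ i, f i x := by
  change (∑ i, (f i).toFun) x = _
  rw [AddMonoidHom.finsetSum_apply]
  rfl

end Hom

/-- An isomorphism of `R`-`S`-bimodules. -/
structure Iso (X Y : BiMod R S) where
  hom : Hom X Y
  inv : Hom Y X
  hom_inv : ∀ x, inv (hom x) = x
  inv_hom : ∀ y, hom (inv y) = y

namespace Iso

def refl (X : BiMod R S) : Iso X X := ⟨Hom.id X, Hom.id X, fun _ => rfl, fun _ => rfl⟩

def symm {X Y : BiMod R S} (e : Iso X Y) : Iso Y X := ⟨e.inv, e.hom, e.inv_hom, e.hom_inv⟩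

def trans {X Y Z : BiMod R S} (e : Iso X Y) (e' : Iso Y Z) : Iso X Z where
  hom := e'.hom.comp e.hom
  inv := e.inv.comp e'.inv
  hom_inv x := by simp [e.hom_inv, e'.hom_inv]
  inv_hom x := by simp [e.inv_hom, e'.inv_hom]

end Iso

/-- The ring `R` as an `R`-`R`-bimodule. -/
def unit (R : Type u) [Ring R] : BiMod R R := ⟨R⟩

/-- The subgroup of `X ⊗_ℤ Y` generated by the elements `xs ⊗ y - x ⊗ sy`. -/
def tensorRel (X : BiMod R S) (Y : BiMod S T) : AddSubgroup (X ⊗[ℤ] Y) :=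
  AddSubgroup.closure
    {z | ∃ (x : X) (s : S) (y : Y), z = (op s • x) ⊗ₜ[ℤ] y - x ⊗ₜ[ℤ] (s • y)}

/-- The underlying abelian group of `X ⊗_S Y`, for `S` not necessarily commutative. -/
def TensorCarrier (X : BiMod R S) (Y : BiMod S T) : Type u :=
  (X ⊗[ℤ] Y) ⧸ tensorRel X Y

section Tensor

instance (X : BiMod R S) (Y : BiMod S T) : AddCommGroup (TensorCarrier X Y) :=
  inferInstanceAs (AddCommGroup ((X ⊗[ℤ] Y) ⧸ tensorRel X Y))

/-- The class `x ⊗ y` in `X ⊗_S Y`. -/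
def tmk {X : BiMod R S} {Y : BiMod S T} (x : X) (y : Y) : TensorCarrier X Y :=
  QuotientAddGroup.mk (x ⊗ₜ[ℤ] y)

variable {X : BiMod R S} {Y : BiMod S T}

theorem tmk_add_left (x x' : X) (y : Y) : tmk (x + x') y = tmk x y + tmk x' y := by
  simp only [tmk, TensorProduct.add_tmul]; rfl

theorem tmk_add_right (x : X) (y y' : Y) : tmk x (y + y') = tmk x y + tmk x y' := by
  simp only [tmk, TensorProduct.tmul_add]; rfl

theorem tmk_balanced (x : X) (s : S) (y : Y) : tmk (op s • x) y = tmk x (s • y) :=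
  QuotientAddGroup.eq_iff_sub_mem.2 (AddSubgroup.subset_closure ⟨x, s, y, rfl⟩)

/-- The homomorphism on `X ⊗_S Y` induced by a balanced biadditive map. -/
def tliftAdd {A : Type u} [AddCommGroup A] (f : X →+ Y →+ A)
    (hf : ∀ (x : X) (s : S) (y : Y), f (op s • x) y = f x (s • y)) : TensorCarrier X Y →+ A :=
  QuotientAddGroup.lift (tensorRel X Y) (TensorProduct.liftAddHom f (fun r x y => by simp))
    ((AddSubgroup.closure_le _).2 (by
      rintro _ ⟨x, s, y, rfl⟩
      simp [hf]))

@[simp] theorem tliftAdd_tmk {A : Type u} [AddCommGroup A] (f : X →+ Y →+ A)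
    (hf : ∀ (x : X) (s : S) (y : Y), f (op s • x) y = f x (s • y)) (x : X) (y : Y) :
    tliftAdd f hf (tmk x y) = f x y := rfl

theorem tensor_induction {p : TensorCarrier X Y → Prop} (z : TensorCarrier X Y)
    (zero : p 0) (mk : ∀ x y, p (tmk x y)) (add : ∀ a b, p a → p b → p (a + b)) : p z := by
  induction z using QuotientAddGroup.induction_on with
  | H z =>
    induction z using TensorProduct.induction_on with
    | zero => exact zero
    | tmul x y => exact mk x y
    | add a b ha hb => exact add _ _ ha hb

theorem tensor_hom_ext {A : Type u} [AddCommGroup A] {f g : TensorCarrier X Y →+ A}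
    (h : ∀ x y, f (tmk x y) = g (tmk x y)) : f = g := by
  ext z
  induction z using tensor_induction with
  | zero => simp
  | mk x y => exact h x y
  | add a b ha hb => simp [ha, hb]

/-- The additive map `f ⊗ g` on tensor products. -/
def tmapAdd {X' : BiMod U S} {Y' : BiMod S V} (f : X →+ X')
    (g : Y →+ Y') (hf : ∀ (s : S) x, f (op s • x) = op s • f x)
    (hg : ∀ (s : S) y, g (s • y) = s • g y) : TensorCarrier X Y →+ TensorCarrier X' Y' :=
  tliftAdd
    (AddMonoidHom.mk' (fun x => AddMonoidHom.mk' (fun y => tmk (f x) (g y))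
        (fun y y' => by rw [map_add, tmk_add_right]))
      (fun x x' => by ext y; simp [tmk_add_left]))
    (fun x s y => by simp [hf, hg, tmk_balanced])

theorem tmapAdd_tmk {X' : BiMod U S} {Y' : BiMod S V} (f : X →+ X')
    (g : Y →+ Y') (hf : ∀ (s : S) x, f (op s • x) = op s • f x)
    (hg : ∀ (s : S) y, g (s • y) = s • g y) (x : X) (y : Y) :
    tmapAdd f g hf hg (tmk x y) = tmk (f x) (g y) := rfl

instance : SMul R (TensorCarrier X Y) :=
  ⟨fun r => tmapAdd (X' := X) (Y' := Y) (DistribSMul.toAddMonoidHom X r) (AddMonoidHom.id Y)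
    (fun s x => smul_comm r (op s) x) (fun _ _ => rfl)⟩

instance : SMul Tᵐᵒᵖ (TensorCarrier X Y) :=
  ⟨fun t => tmapAdd (X' := X) (Y' := Y) (AddMonoidHom.id X) (DistribSMul.toAddMonoidHom Y t)
    (fun _ _ => rfl) (fun s y => (smul_comm s t y).symm)⟩

theorem smul_tmk (r : R) (x : X) (y : Y) : r • tmk x y = tmk (r • x) y := rfl

theorem op_smul_tmk (t : Tᵐᵒᵖ) (x : X) (y : Y) : t • tmk x y = tmk x (t • y) := rfl

instance : DistribSMul R (TensorCarrier X Y) where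
  smul_zero _ := map_zero (tmapAdd (X' := X) (Y' := Y) _ _ _ _)
  smul_add _ := map_add (tmapAdd (X' := X) (Y' := Y) _ _ _ _)

instance : DistribSMul Tᵐᵒᵖ (TensorCarrier X Y) where
  smul_zero _ := map_zero (tmapAdd (X' := X) (Y' := Y) _ _ _ _)
  smul_add _ := map_add (tmapAdd (X' := X) (Y' := Y) _ _ _ _)

/-- `X ⊗_S Y` as a left `R`-module through `X`. -/
instance : Module R (TensorCarrier X Y) where
  one_smul z := by
    induction z using tensor_induction with
    | zero => exact smul_zero _
    | mk x y => rw [smul_tmk, one_smul]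
    | add a b ha hb => rw [smul_add, ha, hb]
  mul_smul r s z := by
    induction z using tensor_induction with
    | zero => simp only [smul_zero]
    | mk x y => simp only [smul_tmk, mul_smul]
    | add a b ha hb => simp only [smul_add, ha, hb]
  smul_zero := smul_zero
  smul_add := smul_add
  add_smul r s z := by
    induction z using tensor_induction with
    | zero => simp only [smul_zero, add_zero]
    | mk x y => simp only [smul_tmk, add_smul, tmk_add_left]
    | add a b ha hb => simp only [smul_add, ha, hb]; abel
  zero_smul z := by
    induction z using tensor_induction with
    | zero => exact smul_zero _
    | mk x y =>
      rw [smul_tmk, zero_smul]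
      have h := tmk_add_left (0 : X) 0 y
      simpa using h
    | add a b ha hb => rw [smul_add, ha, hb, add_zero]

/-- `X ⊗_S Y` as a right `T`-module through `Y`. -/
instance : Module Tᵐᵒᵖ (TensorCarrier X Y) where
  one_smul z := by
    induction z using tensor_induction with
    | zero => exact smul_zero _
    | mk x y => rw [op_smul_tmk, one_smul]
    | add a b ha hb => rw [smul_add, ha, hb]
  mul_smul r s z := by
    induction z using tensor_induction with
    | zero => simp only [smul_zero]
    | mk x y => simp only [op_smul_tmk, mul_smul]
    | add a b ha hb => simp only [smul_add, ha, hb]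
  smul_zero := smul_zero
  smul_add := smul_add
  add_smul r s z := by
    induction z using tensor_induction with
    | zero => simp only [smul_zero, add_zero]
    | mk x y => simp only [op_smul_tmk, add_smul, tmk_add_right]
    | add a b ha hb => simp only [smul_add, ha, hb]; abel
  zero_smul z := by
    induction z using tensor_induction with
    | zero => exact smul_zero _
    | mk x y =>
      rw [op_smul_tmk, zero_smul]
      have h := tmk_add_right x (0 : Y) 0
      simpa using h
    | add a b ha hb => rw [smul_add, ha, hb, add_zero]

instance : SMulCommClass R Tᵐᵒᵖ (TensorCarrier X Y) where
  smul_comm r t z := by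
    induction z using tensor_induction with
    | zero => simp only [smul_zero]
    | mk x y => simp only [smul_tmk, op_smul_tmk]
    | add a b ha hb => simp only [smul_add, ha, hb]

/-- The `R`-`T`-bimodule `X ⊗_S Y`. -/
def tensor (X : BiMod R S) (Y : BiMod S T) : BiMod R T := ⟨TensorCarrier X Y⟩


/-- The element `x ⊗ y` of the bimodule `X ⊗_S Y`. -/
def pure (x : X) (y : Y) : tensor X Y := tmk x y

theorem pure_add_left (x x' : X) (y : Y) : pure (x + x') y = pure x y + pure x' y :=
  tmk_add_left x x' y

theorem pure_add_right (x : X) (y y' : Y) : pure x (y + y') = pure x y + pure x y' :=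
  tmk_add_right x y y'

theorem pure_balanced (x : X) (s : S) (y : Y) : pure (op s • x) y = pure x (s • y) :=
  tmk_balanced x s y

theorem smul_pure (r : R) (x : X) (y : Y) : r • pure x y = pure (r • x) y := rfl

theorem op_smul_pure (t : T) (x : X) (y : Y) : op t • pure x y = pure x (op t • y) := rfl

/-- The biadditive map `(x, y) ↦ x ⊗ y`. -/
def pureHom (X : BiMod R S) (Y : BiMod S T) : X →+ Y →+ tensor X Y :=
  AddMonoidHom.mk' (fun x => AddMonoidHom.mk' (fun y => pure x y) (pure_add_right x))
    (fun x x' => by ext y; exact pure_add_left x x' y)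

@[simp] theorem pureHom_apply (x : X) (y : Y) : pureHom X Y x y = pure x y := rfl

theorem pure_induction {p : tensor X Y → Prop} (z : tensor X Y)
    (zero : p 0) (mk : ∀ x y, p (pure x y)) (add : ∀ a b, p a → p b → p (a + b)) : p z :=
  tensor_induction z zero mk add

/-- The additive map on `X ⊗_S Y` induced by a balanced biadditive map. -/
def addLift {A : Type u} [AddCommGroup A] (f : X →+ Y →+ A)
    (hf : ∀ (x : X) (s : S) (y : Y), f (op s • x) y = f x (s • y)) : tensor X Y →+ A :=
  tliftAdd f hf

@[simp] theorem addLift_pure {A : Type u} [AddCommGroup A] (f : X →+ Y →+ A)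
    (hf : ∀ (x : X) (s : S) (y : Y), f (op s • x) y = f x (s • y)) (x : X) (y : Y) :
    addLift f hf (pure x y) = f x y := rfl

/-- The bimodule homomorphism on `X ⊗_S Y` induced by a balanced biadditive bimodule map. -/
def tlift {Z : BiMod R T} (f : X →+ Y →+ Z)
    (hf : ∀ (x : X) (s : S) (y : Y), f (op s • x) y = f x (s • y))
    (hl : ∀ (r : R) (x : X) (y : Y), f (r • x) y = r • f x y)
    (hr : ∀ (t : T) (x : X) (y : Y), f x (op t • y) = op t • f x y) :
    Hom (tensor X Y) Z where
  toFun := addLift f hf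
  map_left r z := by
    induction z using pure_induction with
    | zero => rw [smul_zero, map_zero, smul_zero]
    | mk x y => exact hl r x y
    | add a b ha hb => rw [smul_add, map_add, map_add, smul_add, ha, hb]
  map_right t z := by
    induction z using pure_induction with
    | zero => rw [smul_zero, map_zero, smul_zero]
    | mk x y => exact hr t x y
    | add a b ha hb => rw [smul_add, map_add, map_add, smul_add, ha, hb]

@[simp] theorem tlift_pure {Z : BiMod R T} (f : X →+ Y →+ Z)
    (hf : ∀ (x : X) (s : S) (y : Y), f (op s • x) y = f x (s • y))
    (hl : ∀ (r : R) (x : X) (y : Y), f (r • x) y = r • f x y)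
    (hr : ∀ (t : T) (x : X) (y : Y), f x (op t • y) = op t • f x y) (x : X) (y : Y) :
    tlift f hf hl hr (pure x y) = f x y := rfl

theorem addHom_ext {A : Type*} [AddCommGroup A] {f g : tensor X Y →+ A}
    (h : ∀ x y, f (pure x y) = g (pure x y)) : f = g := by
  ext z
  induction z using pure_induction with
  | zero => rw [map_zero, map_zero]
  | mk x y => exact h x y
  | add a b ha hb => rw [map_add, map_add, ha, hb]

theorem hom_ext {Z : BiMod R T} {f g : Hom (tensor X Y) Z}
    (h : ∀ x y, f (pure x y) = g (pure x y)) : f = g :=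
  Hom.ext (addHom_ext h)

/-- The homomorphism `f ⊗ g`. -/
def tmap {X' : BiMod R S} {Y' : BiMod S T} (f : Hom X X') (g : Hom Y Y') :
    Hom (tensor X Y) (tensor X' Y') :=
  tlift (((pureHom X' Y').compr₂ (AddMonoidHom.id _)).comp f.toFun |>.compl₂ g.toFun)
    (fun x s y => by
      change pure (f (op s • x)) (g y) = pure (f x) (g (s • y))
      rw [f.smul_right, g.smul_left, pure_balanced])
    (fun r x y => by
      change pure (f (r • x)) (g y) = r • pure (f x) (g y)
      rw [f.smul_left, smul_pure])
    (fun t x y => by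
      change pure (f x) (g (op t • y)) = op t • pure (f x) (g y)
      rw [g.smul_right, op_smul_pure])

@[simp] theorem tmap_pure {X' : BiMod R S} {Y' : BiMod S T} (f : Hom X X') (g : Hom Y Y')
    (x : X) (y : Y) : tmap f g (pure x y) = pure (f x) (g y) := rfl

theorem tmap_comp {X' X'' : BiMod R S} {Y' Y'' : BiMod S T} (f : Hom X X') (g : Hom Y Y')
    (f' : Hom X' X'') (g' : Hom Y' Y'') :
    (tmap f' g').comp (tmap f g) = tmap (f'.comp f) (g'.comp g) :=
  hom_ext fun _ _ => rfl

theorem tmap_id : tmap (Hom.id X) (Hom.id Y) = Hom.id (tensor X Y) :=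
  hom_ext fun _ _ => rfl

/-- `e ⊗ e'` for isomorphisms `e`, `e'`. -/
def tensorIso {X' : BiMod R S} {Y' : BiMod S T} (e : Iso X X') (e' : Iso Y Y') :
    Iso (tensor X Y) (tensor X' Y') where
  hom := tmap e.hom e'.hom
  inv := tmap e.inv e'.inv
  hom_inv z := by
    rw [← Hom.comp_apply, tmap_comp]
    have h : tmap (e.inv.comp e.hom) (e'.inv.comp e'.hom) = Hom.id (tensor X Y) :=
      hom_ext fun x y => by simp [e.hom_inv, e'.hom_inv]
    rw [h]; rfl
  inv_hom z := by
    rw [← Hom.comp_apply, tmap_comp]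
    have h : tmap (e.hom.comp e.inv) (e'.hom.comp e'.inv) = Hom.id (tensor X' Y') :=
      hom_ext fun x y => by simp [e.inv_hom, e'.inv_hom]
    rw [h]; rfl

/-- The biadditive map underlying `assocHom`. -/
def assocAux (X : BiMod R S) (Y : BiMod S T) (Z : BiMod T U) :
    tensor X Y →+ Z →+ tensor X (tensor Y Z) :=
  addLift
    (AddMonoidHom.mk' (fun x => AddMonoidHom.mk' (fun y => (pureHom X (tensor Y Z) x).comp
        (pureHom Y Z y)) (fun y y' => by ext z; simp [pure_add_right]))
      (fun x x' => by ext y z; simp))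
    (fun x s y => by
      ext z
      exact pure_balanced x s (pure y z))

@[simp] theorem assocAux_pure (X : BiMod R S) (Y : BiMod S T) (Z : BiMod T U) (x : X) (y : Y)
    (z : Z) : assocAux X Y Z (pure x y) z = pure x (pure y z) := rfl

/-- The map `(x ⊗ y) ⊗ z ↦ x ⊗ (y ⊗ z)`. -/
def assocHom (X : BiMod R S) (Y : BiMod S T) (Z : BiMod T U) :
    Hom (tensor (tensor X Y) Z) (tensor X (tensor Y Z)) :=
  tlift (assocAux X Y Z)
    (fun w t z => by
      induction w using pure_induction with
      | zero => rw [smul_zero, map_zero]; rfl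
      | mk x y => exact congrArg (pure x) (pure_balanced y t z)
      | add a b ha hb =>
        rw [smul_add, map_add, map_add, AddMonoidHom.add_apply, AddMonoidHom.add_apply, ha, hb])
    (fun r w z => by
      induction w using pure_induction with
      | zero => rw [smul_zero, map_zero]; exact (smul_zero r).symm
      | mk x y => rfl
      | add a b ha hb =>
        rw [smul_add, map_add, map_add, AddMonoidHom.add_apply, AddMonoidHom.add_apply, ha, hb,
          smul_add])
    (fun t w z => by
      induction w using pure_induction with
      | zero => rw [map_zero]; exact (smul_zero (op t)).symm
      | mk x y => rfl
      | add a b ha hb =>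
        rw [map_add, AddMonoidHom.add_apply, AddMonoidHom.add_apply, ha, hb, smul_add])

@[simp] theorem assocHom_pure (X : BiMod R S) (Y : BiMod S T) (Z : BiMod T U) (x : X) (y : Y)
    (z : Z) : assocHom X Y Z (pure (pure x y) z) = pure x (pure y z) := rfl

/-- The biadditive map underlying `assocInv`. -/
def assocInvAux (X : BiMod R S) (Y : BiMod S T) (Z : BiMod T U) :
    X →+ tensor Y Z →+ tensor (tensor X Y) Z :=
  AddMonoidHom.mk' (fun x => addLift ((pureHom (tensor X Y) Z).comp (pureHom X Y x))
      (fun y t z => by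
        change pure (pure x (op t • y)) z = pure (pure x y) (t • z)
        rw [← op_smul_pure, pure_balanced]))
    (fun x x' => by
      refine addHom_ext fun y z => ?_
      change pure (pure (x + x') y) z = pure (pure x y) z + pure (pure x' y) z
      rw [pure_add_left, pure_add_left])

@[simp] theorem assocInvAux_pure (X : BiMod R S) (Y : BiMod S T) (Z : BiMod T U) (x : X) (y : Y)
    (z : Z) : assocInvAux X Y Z x (pure y z) = pure (pure x y) z := rfl

/-- The map `x ⊗ (y ⊗ z) ↦ (x ⊗ y) ⊗ z`. -/
def assocInv (X : BiMod R S) (Y : BiMod S T) (Z : BiMod T U) :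
    Hom (tensor X (tensor Y Z)) (tensor (tensor X Y) Z) :=
  tlift (assocInvAux X Y Z)
    (fun x s w => by
      induction w using pure_induction with
      | zero => rw [smul_zero, map_zero, map_zero]
      | mk y z => exact congrArg (fun v => pure v z) (pure_balanced x s y)
      | add a b ha hb => rw [smul_add, map_add, map_add, ha, hb])
    (fun r x w => by
      induction w using pure_induction with
      | zero => rw [map_zero, map_zero, smul_zero]
      | mk y z => rfl
      | add a b ha hb => rw [map_add, map_add, ha, hb, smul_add])
    (fun t x w => by
      induction w using pure_induction with
      | zero => rw [smul_zero, map_zero, smul_zero]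
      | mk y z => rfl
      | add a b ha hb => rw [smul_add, map_add, map_add, ha, hb, smul_add])

@[simp] theorem assocInv_pure (X : BiMod R S) (Y : BiMod S T) (Z : BiMod T U) (x : X) (y : Y)
    (z : Z) : assocInv X Y Z (pure x (pure y z)) = pure (pure x y) z := rfl

/-- The associator `(X ⊗ Y) ⊗ Z ≅ X ⊗ (Y ⊗ Z)`. -/
def assoc (X : BiMod R S) (Y : BiMod S T) (Z : BiMod T U) :
    Iso (tensor (tensor X Y) Z) (tensor X (tensor Y Z)) where
  hom := assocHom X Y Z
  inv := assocInv X Y Z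
  hom_inv w := by
    induction w using pure_induction with
    | zero => rw [map_zero, map_zero]
    | mk v z =>
      induction v using pure_induction with
      | zero =>
        rw [← pureHom_apply, map_zero, AddMonoidHom.zero_apply, map_zero, map_zero]
      | mk x y => rfl
      | add a b ha hb => rw [pure_add_left, map_add, map_add, ha, hb]
    | add a b ha hb => rw [map_add, map_add, ha, hb]
  inv_hom w := by
    induction w using pure_induction with
    | zero => rw [map_zero, map_zero]
    | mk x v =>
      induction v using pure_induction with
      | zero => rw [← pureHom_apply, map_zero, map_zero, map_zero]
      | mk x y => rfl
      | add a b ha hb => rw [pure_add_right, map_add, map_add, ha, hb]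
    | add a b ha hb => rw [map_add, map_add, ha, hb]

/-- The element `r` of `R`, in the bimodule `unit R`. -/
def toUnit (R : Type u) [Ring R] : R →+ unit R := AddMonoidHom.id R

/-- The element of `R` underlying an element of `unit R`. -/
def ofUnit (R : Type u) [Ring R] : unit R →+ R := AddMonoidHom.id R

theorem ofUnit_toUnit (r : R) : ofUnit R (toUnit R r) = r := rfl
theorem toUnit_ofUnit (r : unit R) : toUnit R (ofUnit R r) = r := rfl
theorem ofUnit_smul (r : R) (x : unit R) : ofUnit R (r • x) = r * ofUnit R x := rfl
theorem ofUnit_op_smul (r : R) (x : unit R) : ofUnit R (op r • x) = ofUnit R x * r := rfl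
theorem smul_toUnit (r s : R) : r • toUnit R s = toUnit R (r * s) := rfl
theorem op_smul_toUnit (r s : R) : op r • toUnit R s = toUnit R (s * r) := rfl

/-- The biadditive map `(r, x) ↦ r x`. -/
def lunitAux (X : BiMod R S) : unit R →+ X →+ X :=
  AddMonoidHom.mk' (fun r => DistribSMul.toAddMonoidHom X (ofUnit R r))
    (fun r r' => by ext x; simp [add_smul])

theorem lunitAux_apply (X : BiMod R S) (r : unit R) (x : X) :
    lunitAux X r x = ofUnit R r • x := rfl

/-- The left unitor `R ⊗_R X ≅ X`, `r ⊗ x ↦ r x`. -/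
def lunit (X : BiMod R S) : Iso (tensor (unit R) X) X where
  hom := tlift (lunitAux X)
    (fun r s x => by simp only [lunitAux_apply, ofUnit_op_smul, mul_smul])
    (fun r s x => by simp only [lunitAux_apply, ofUnit_smul, mul_smul])
    (fun s r x => smul_comm (ofUnit R r) (op s) x)
  inv :=
    { toFun := pureHom (unit R) X (toUnit R 1)
      map_left := fun r x => by
        rw [pureHom_apply, pureHom_apply, ← pure_balanced, smul_pure, op_smul_toUnit,
          smul_toUnit, one_mul, mul_one]
      map_right := fun s x => by rw [pureHom_apply, pureHom_apply, op_smul_pure] }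
  hom_inv w := by
    induction w using pure_induction with
    | zero => rw [map_zero, map_zero]
    | mk r x =>
      change pure (toUnit R 1) (ofUnit R r • x) = _
      rw [← pure_balanced, op_smul_toUnit, one_mul, toUnit_ofUnit]
    | add a b ha hb => rw [map_add, map_add, ha, hb]
  inv_hom x := one_smul R x

@[simp] theorem lunit_hom_pure (X : BiMod R S) (r : unit R) (x : X) :
    (lunit X).hom (pure r x) = ofUnit R r • x := rfl

/-- The biadditive map `(x, s) ↦ x s`. -/
def runitAux (X : BiMod R S) : X →+ unit S →+ X :=
  AddMonoidHom.mk' (fun x => AddMonoidHom.mk' (fun s => op (ofUnit S s) • x)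
      (fun s s' => by simp [add_smul]))
    (fun x x' => by ext s; simp)

theorem runitAux_apply (X : BiMod R S) (x : X) (s : unit S) :
    runitAux X x s = op (ofUnit S s) • x := rfl

/-- The right unitor `X ⊗_S S ≅ X`, `x ⊗ s ↦ x s`. -/
def runit (X : BiMod R S) : Iso (tensor X (unit S)) X where
  hom := tlift (runitAux X)
    (fun x s s' => by simp only [runitAux_apply, ofUnit_smul, op_mul, mul_smul])
    (fun r x s => (smul_comm r (op (ofUnit S s)) x).symm)
    (fun s' x s => by simp only [runitAux_apply, ofUnit_op_smul, op_mul, mul_smul])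
  inv :=
    { toFun := (pureHom X (unit S)).flip (toUnit S 1)
      map_left := fun r x => by
        rw [AddMonoidHom.flip_apply, AddMonoidHom.flip_apply, pureHom_apply, pureHom_apply, smul_pure]
      map_right := fun s x => by
        rw [AddMonoidHom.flip_apply, AddMonoidHom.flip_apply, pureHom_apply, pureHom_apply,
          pure_balanced, op_smul_pure, op_smul_toUnit, smul_toUnit, one_mul, mul_one] }
  hom_inv w := by
    induction w using pure_induction with
    | zero => rw [map_zero, map_zero]
    | mk x s =>
      change pure (op (ofUnit S s) • x) (toUnit S 1) = _
      rw [pure_balanced, smul_toUnit, mul_one, toUnit_ofUnit]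
    | add a b ha hb => rw [map_add, map_add, ha, hb]
  inv_hom x := one_smul Sᵐᵒᵖ x

@[simp] theorem runit_hom_pure (X : BiMod R S) (x : X) (s : unit S) :
    (runit X).hom (pure x s) = op (ofUnit S s) • x := rfl

end Tensor

/-- The tensor powers `M^{⊗ n} = M ⊗ (M ⊗ (⋯ ⊗ (M ⊗ R)))` of an `R`-`R`-bimodule. -/
def pow (M : BiMod R R) : ℕ → BiMod R R
  | 0 => unit R
  | n + 1 => tensor M (pow M n)

/-- The canonical isomorphism `M^{⊗ a} ⊗ M^{⊗ b} ≅ M^{⊗ (b + a)}` (concatenation). -/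
def powAdd (M : BiMod R R) : ∀ a b : ℕ, Iso (tensor (pow M a) (pow M b)) (pow M (b + a))
  | 0, b => lunit (pow M b)
  | a + 1, b => (assoc M (pow M a) (pow M b)).trans (tensorIso (Iso.refl M) (powAdd M a b))

/-- The canonical isomorphism `(M^{⊗ n})^{⊗ k} ≅ M^{⊗ nk}`. -/
def powMul (M : BiMod R R) (n : ℕ) : ∀ k : ℕ, Iso (pow (pow M n) k) (pow M (n * k))
  | 0 => Iso.refl (unit R)
  | k + 1 => (tensorIso (Iso.refl (pow M n)) (powMul M n k)).trans (powAdd M n (n * k))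

/-- The canonical isomorphism `M^{⊗ n} ⊗ M ≅ M^{⊗ (n + 1)}`. -/
def powSnoc (M : BiMod R R) : ∀ n : ℕ, Iso (tensor (pow M n) M) (pow M (n + 1))
  | 0 => (lunit M).trans (runit M).symm
  | n + 1 => (assoc M (pow M n) M).trans (tensorIso (Iso.refl M) (powSnoc M n))

/-- The subgroup of `M` generated by the elements `r m - m r`. -/
def shadowRel (M : BiMod R R) : AddSubgroup M :=
  AddSubgroup.closure {z | ∃ (r : R) (m : M), z = r • m - op r • m}

/-- The shadow `⟨⟨M⟩⟩ = M / (r m ∼ m r)` of an `R`-`R`-bimodule. -/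
def Shadow (M : BiMod R R) : Type u := M ⧸ shadowRel M

section Shadow

instance (M : BiMod R R) : AddCommGroup (Shadow M) :=
  inferInstanceAs (AddCommGroup (M ⧸ shadowRel M))

/-- The quotient map `M → ⟨⟨M⟩⟩`. -/
def toShadow (M : BiMod R R) : M →+ Shadow M := QuotientAddGroup.mk' (shadowRel M)

theorem toShadow_smul (M : BiMod R R) (r : R) (m : M) :
    toShadow M (r • m) = toShadow M (op r • m) :=
  QuotientAddGroup.eq_iff_sub_mem.2 (AddSubgroup.subset_closure ⟨r, m, rfl⟩)

/-- The homomorphism on `⟨⟨M⟩⟩` induced by an additive map `f` with `f (r m) = f (m r)`. -/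
def shadowLift {M : BiMod R R} {A : Type u} [AddCommGroup A] (f : M →+ A)
    (hf : ∀ (r : R) (m : M), f (r • m) = f (op r • m)) : Shadow M →+ A :=
  QuotientAddGroup.lift (shadowRel M) f ((AddSubgroup.closure_le _).2 (by
    rintro _ ⟨r, m, rfl⟩
    simp [hf]))

@[simp] theorem shadowLift_toShadow {M : BiMod R R} {A : Type u} [AddCommGroup A] (f : M →+ A)
    (hf : ∀ (r : R) (m : M), f (r • m) = f (op r • m)) (m : M) :
    shadowLift f hf (toShadow M m) = f m := rfl

theorem toShadow_surjective (M : BiMod R R) : Function.Surjective (toShadow M) :=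
  QuotientAddGroup.mk'_surjective _

theorem shadow_hom_ext {M : BiMod R R} {A : Type*} [AddCommGroup A] {f g : Shadow M →+ A}
    (h : ∀ m, f (toShadow M m) = g (toShadow M m)) : f = g := by
  ext x
  obtain ⟨m, rfl⟩ := toShadow_surjective M x
  exact h m

/-- Functoriality of the shadow. -/
def shadowMap {M M' : BiMod R R} (f : Hom M M') : Shadow M →+ Shadow M' :=
  shadowLift ((toShadow M').comp f.toFun) (fun r m => by
    change toShadow M' (f (r • m)) = toShadow M' (f (op r • m))
    rw [f.smul_left, f.smul_right, toShadow_smul])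

@[simp] theorem shadowMap_toShadow {M M' : BiMod R R} (f : Hom M M') (m : M) :
    shadowMap f (toShadow M m) = toShadow M' (f m) := rfl

/-- The isomorphism of shadows induced by an isomorphism of bimodules. -/
def shadowIso {M M' : BiMod R R} (e : Iso M M') : Shadow M ≃+ Shadow M' :=
  AddMonoidHom.toAddEquiv (shadowMap e.hom) (shadowMap e.inv)
    (shadow_hom_ext fun m => by simp [e.hom_inv])
    (shadow_hom_ext fun m => by simp [e.inv_hom])

/-- The map `⟨⟨X ⊗ Y⟩⟩ → ⟨⟨Y ⊗ X⟩⟩`, `[x ⊗ y] ↦ [y ⊗ x]`. -/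
def thetaHom (X : BiMod R S) (Y : BiMod S R) : Shadow (tensor X Y) →+ Shadow (tensor Y X) :=
  shadowLift
    (addLift ((pureHom Y X).flip.compr₂ (toShadow (tensor Y X)))
      (fun x s y => by
        change toShadow _ (pure y (op s • x)) = toShadow _ (pure (s • y) x)
        rw [← op_smul_pure, ← smul_pure, toShadow_smul]))
    (fun r w => by
      induction w using pure_induction with
      | zero => rw [smul_zero, smul_zero]
      | mk x y =>
        change toShadow (tensor Y X) (pure y (r • x)) = toShadow (tensor Y X) (pure (op r • y) x)
        rw [pure_balanced]
      | add a b ha hb => rw [smul_add, smul_add, map_add, map_add, ha, hb])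

@[simp] theorem thetaHom_pure (X : BiMod R S) (Y : BiMod S R) (x : X) (y : Y) :
    thetaHom X Y (toShadow _ (pure x y)) = toShadow _ (pure y x) := rfl

theorem thetaHom_comp (X : BiMod R S) (Y : BiMod S R) :
    (thetaHom Y X).comp (thetaHom X Y) = AddMonoidHom.id _ :=
  shadow_hom_ext fun w => by
    have h : ((thetaHom Y X).comp (thetaHom X Y)).comp (toShadow _) = toShadow (tensor X Y) :=
      addHom_ext fun _ _ => rfl
    exact DFunLike.congr_fun h w

/-- The cyclicity isomorphism `θ : ⟨⟨X ⊗ Y⟩⟩ ≅ ⟨⟨Y ⊗ X⟩⟩`. -/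
def theta (X : BiMod R S) (Y : BiMod S R) : Shadow (tensor X Y) ≃+ Shadow (tensor Y X) :=
  AddMonoidHom.toAddEquiv (thetaHom X Y) (thetaHom Y X) (thetaHom_comp X Y) (thetaHom_comp Y X)

/-- The rotation `[m₀ ⊗ m₁ ⊗ ⋯ ⊗ m_{n-1}] ↦ [m₁ ⊗ ⋯ ⊗ m_{n-1} ⊗ m₀]` of `⟨⟨M^{⊗ n}⟩⟩`, the
generator of the `ℤ/n`-action. -/
def rot (M : BiMod R R) : ∀ n : ℕ, Shadow (pow M n) ≃+ Shadow (pow M n)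
  | 0 => AddEquiv.refl _
  | n + 1 => (theta M (pow M n)).trans (shadowIso (powSnoc M n))

/-- The element `w 0 ⊗ w 1 ⊗ ⋯ ⊗ w (n - 1)` of `M^{⊗ n}`. -/
def tpure {M : BiMod R R} : ∀ (n : ℕ) (_ : ℕ → M), pow M n
  | 0, _ => toUnit R 1
  | n + 1, w => pure (w 0) (tpure n fun i => w (i + 1))

theorem powSnoc_tpure {M : BiMod R R} : ∀ (n : ℕ) (w : ℕ → M),
    (powSnoc M n).hom (pure (tpure n w) (w n)) = tpure (n + 1) w
  | 0, w => by
    change (runit M).symm.hom ((lunit M).hom (pure (toUnit R 1) (w 0))) = pure (w 0) (toUnit R 1)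
    rw [lunit_hom_pure, ofUnit_toUnit, one_smul]
    rfl
  | n + 1, w => congrArg (pure (w 0)) (powSnoc_tpure n fun i => w (i + 1))

theorem rot_tpure {M : BiMod R R} (n : ℕ) (w : ℕ → M) (hw : w n = w 0) :
    rot M n (toShadow _ (tpure n w)) = toShadow _ (tpure n fun i => w (i + 1)) := by
  cases n with
  | zero => rfl
  | succ n =>
    have h := powSnoc_tpure n fun i => w (i + 1)
    rw [← h, hw]
    rfl

theorem tpure_congr {M : BiMod R R} : ∀ (n : ℕ) {w w' : ℕ → M} (_ : ∀ i < n, w i = w' i),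
    tpure n w = tpure n w'
  | 0, _, _, _ => rfl
  | n + 1, _, _, h => by
    rw [tpure, tpure, h 0 n.succ_pos, tpure_congr n fun i hi => h (i + 1) (Nat.succ_lt_succ hi)]

theorem pow_hom_ext {M : BiMod R R} {A : Type u} [AddCommGroup A] :
    ∀ (n : ℕ) (f g : pow M (n + 1) →+ A)
      (_ : ∀ w : ℕ → M, f (tpure (n + 1) w) = g (tpure (n + 1) w)), f = g
  | 0, f, g, h => by
    refine addHom_ext (X := M) (Y := unit R) fun m r => ?_
    have hr : pure m r = pure (op (ofUnit R r) • m) (toUnit R 1) := by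
      rw [pure_balanced, smul_toUnit, mul_one, toUnit_ofUnit]
    rw [hr]
    exact h fun _ => op (ofUnit R r) • m
  | n + 1, f, g, h => addHom_ext fun m y => by
    have h1 : f.comp (pureHom M (pow M (n + 1)) m) = g.comp (pureHom M (pow M (n + 1)) m) :=
      pow_hom_ext n _ _ fun w =>
        h fun i => Nat.rec (motive := fun _ => M) m (fun i _ => w i) i
    exact DFunLike.congr_fun h1 y

theorem rot_iterate_tpure {M : BiMod R R} (n : ℕ) (w : ℕ → M) (hw : ∀ i, w (i + n) = w i) :
    ∀ k : ℕ, (rot M n)^[k] (toShadow _ (tpure n w)) = toShadow _ (tpure n fun i => w (i + k))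
  | 0 => rfl
  | k + 1 => by
    rw [Function.iterate_succ_apply', rot_iterate_tpure n w hw k,
      rot_tpure n _ (by rw [Nat.add_comm n k, hw, Nat.zero_add])]
    simp only [Nat.add_right_comm _ 1 k, Nat.add_assoc]

theorem rot_iterate (M : BiMod R R) (n : ℕ) (x : Shadow (pow M n)) : (rot M n)^[n] x = x := by
  cases n with
  | zero => rfl
  | succ n =>
    let F : ℕ → (Shadow (pow M (n + 1)) →+ Shadow (pow M (n + 1))) := fun k =>
      Nat.rec (AddMonoidHom.id _) (fun _ g => (rot M (n + 1)).toAddMonoidHom.comp g) k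
    have hF : ∀ k x, F k x = (rot M (n + 1))^[k] x := by
      intro k
      induction k with
      | zero => intro x; rfl
      | succ k ih =>
        intro x
        rw [Function.iterate_succ_apply', ← ih]
        rfl
    have h : (F (n + 1)).comp (toShadow _) = toShadow (pow M (n + 1)) := by
      refine pow_hom_ext n _ _ fun w => ?_
      have hp : tpure (n + 1) w = tpure (n + 1) fun i => w (i % (n + 1)) :=
        tpure_congr _ fun i hi => by rw [Nat.mod_eq_of_lt hi]
      change F (n + 1) (toShadow (pow M (n + 1)) _) = _
      rw [hF (n + 1), hp, rot_iterate_tpure (n + 1) _ fun i => by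
        rw [Nat.add_mod_right]]
      simp only [Nat.add_mod_right]
    obtain ⟨m, rfl⟩ := toShadow_surjective _ x
    rw [← hF]
    exact DFunLike.congr_fun h m

end Shadow

/-- `X` is finitely generated and projective as a right `S`-module. -/
structure IsFGP (X : BiMod R S) : Prop where
  finite : Module.Finite Sᵐᵒᵖ X
  projective : Module.Projective Sᵐᵒᵖ X

/-- `0 → X → Y → Z → 0` is exact. -/
structure ShortExact {X Y Z : BiMod R S} (i : Hom X Y) (p : Hom Y Z) : Prop where
  injective : Function.Injective i
  surjective : Function.Surjective p
  exact : ∀ y, p y = 0 ↔ ∃ x, i x = y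

end BiMod

open BiMod

/-! ### `K₀` of a class of objects with a notion of short exact sequence -/

section KTheory

variable {Ob : Type v} {Ob' : Type v} {Z : Type v} {Z' : Type v}

/-- The relations `[B] = [A] + [C]`, one for each short exact sequence `A → B → C`. -/
def K0Rel (ses : Ob → Ob → Ob → Prop) : AddSubgroup (FreeAbelianGroup Ob) :=
  AddSubgroup.closure {x | ∃ A B C, ses A B C ∧
    x = FreeAbelianGroup.of B - (FreeAbelianGroup.of A + FreeAbelianGroup.of C)}

/-- The group `K₀`: generators `[A]`, relations `[B] = [A] + [C]` for each short exact sequence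
`A → B → C`. -/
def K0 (ses : Ob → Ob → Ob → Prop) : Type v := FreeAbelianGroup Ob ⧸ K0Rel ses

instance (ses : Ob → Ob → Ob → Prop) : AddCommGroup (K0 ses) :=
  inferInstanceAs (AddCommGroup (FreeAbelianGroup Ob ⧸ K0Rel ses))

/-- The class `[A]` in `K₀`. -/
def K0.cls (ses : Ob → Ob → Ob → Prop) (A : Ob) : K0 ses :=
  QuotientAddGroup.mk (FreeAbelianGroup.of A)

theorem K0.cls_eq {ses : Ob → Ob → Ob → Prop} {A B C : Ob} (h : ses A B C) :
    K0.cls ses B = K0.cls ses A + K0.cls ses C :=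
  QuotientAddGroup.eq_iff_sub_mem.2 (AddSubgroup.subset_closure ⟨A, B, C, h, rfl⟩)

/-- An additive function on objects induces a homomorphism on `K₀`. -/
def K0.lift {G : Type*} [AddCommGroup G] (ses : Ob → Ob → Ob → Prop) (F : Ob → G)
    (hF : ∀ A B C, ses A B C → F B = F A + F C) : K0 ses →+ G :=
  QuotientAddGroup.lift (K0Rel ses) (FreeAbelianGroup.lift F)
    ((AddSubgroup.closure_le _).2 (by
      rintro _ ⟨A, B, C, h, rfl⟩
      simp [hF A B C h]))

@[simp] theorem K0.lift_cls {G : Type*} [AddCommGroup G] (ses : Ob → Ob → Ob → Prop) (F : Ob → G)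
    (hF : ∀ A B C, ses A B C → F B = F A + F C) (A : Ob) :
    K0.lift ses F hF (K0.cls ses A) = F A :=
  FreeAbelianGroup.lift_apply_of F A

theorem K0.hom_ext {G : Type*} [AddCommGroup G] {ses : Ob → Ob → Ob → Prop} {f g : K0 ses →+ G}
    (h : ∀ A, f (K0.cls ses A) = g (K0.cls ses A)) : f = g := by
  have h' : f.comp (QuotientAddGroup.mk' (K0Rel ses)) = g.comp (QuotientAddGroup.mk' (K0Rel ses)) :=
    FreeAbelianGroup.lift_ext _ _ h
  ext x
  obtain ⟨y, rfl⟩ := QuotientAddGroup.mk'_surjective (K0Rel ses) x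
  exact DFunLike.congr_fun h' y

/-- The homomorphism on `K₀` induced by an exact assignment. -/
def K0.map {ses : Ob → Ob → Ob → Prop} {ses' : Ob' → Ob' → Ob' → Prop} (F : Ob → Ob')
    (hF : ∀ A B C, ses A B C → ses' (F A) (F B) (F C)) : K0 ses →+ K0 ses' :=
  K0.lift ses (fun A => K0.cls ses' (F A)) (fun A B C h => K0.cls_eq (hF A B C h))

/-- Reduced `K₀`: the cokernel of the map on `K₀` induced by an exact assignment `zero`. -/
def K0Red {ses : Ob → Ob → Ob → Prop} {zses : Z → Z → Z → Prop} (zero : Z → Ob)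
    (hz : ∀ A B C, zses A B C → ses (zero A) (zero B) (zero C)) : Type v :=
  K0 ses ⧸ (K0.map (ses := zses) (ses' := ses) zero hz).range

section Red

variable {ses : Ob → Ob → Ob → Prop} {zses : Z → Z → Z → Prop} {zero : Z → Ob}
  {hz : ∀ A B C, zses A B C → ses (zero A) (zero B) (zero C)}
  {ses' : Ob' → Ob' → Ob' → Prop} {zses' : Z' → Z' → Z' → Prop} {zero' : Z' → Ob'}
  {hz' : ∀ A B C, zses' A B C → ses' (zero' A) (zero' B) (zero' C)}

instance : AddCommGroup (K0Red (ses := ses) (zses := zses) zero hz) :=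
  inferInstanceAs (AddCommGroup (K0 ses ⧸ (K0.map (ses := zses) (ses' := ses) zero hz).range))

/-- The class of an object in reduced `K₀`. -/
def K0Red.cls (hz : ∀ A B C, zses A B C → ses (zero A) (zero B) (zero C)) (A : Ob) :
    K0Red (ses := ses) (zses := zses) zero hz :=
  QuotientAddGroup.mk (K0.cls ses A)

theorem K0Red.cls_eq {A B C : Ob} (h : ses A B C) :
    K0Red.cls hz B = K0Red.cls hz A + K0Red.cls hz C :=
  congrArg (QuotientAddGroup.mk' (K0.map (ses := zses) (ses' := ses) zero hz).range)
    (K0.cls_eq h)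

theorem K0Red.cls_zero (z : Z) : K0Red.cls hz (zero z) = 0 :=
  (QuotientAddGroup.eq_zero_iff _).2 ⟨K0.cls zses z, K0.lift_cls _ _ _ z⟩

/-- An additive function that vanishes on the objects `zero z` induces a homomorphism on reduced
`K₀`. -/
def K0Red.lift {G : Type*} [AddCommGroup G]
    (hz : ∀ A B C, zses A B C → ses (zero A) (zero B) (zero C)) (F : Ob → G)
    (hF : ∀ A B C, ses A B C → F B = F A + F C) (h0 : ∀ z, F (zero z) = 0) :
    K0Red (ses := ses) (zses := zses) zero hz →+ G :=
  QuotientAddGroup.lift _ (K0.lift ses F hF) (by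
    rintro _ ⟨y, rfl⟩
    have h : (K0.lift ses F hF).comp (K0.map (ses := zses) (ses' := ses) zero hz) = 0 :=
      K0.hom_ext fun z => by
        change K0.lift ses F hF (K0.map zero hz (K0.cls zses z)) = 0
        rw [K0.map, K0.lift_cls, K0.lift_cls, h0]
    exact DFunLike.congr_fun h y)

@[simp] theorem K0Red.lift_cls {G : Type*} [AddCommGroup G]
    (hz : ∀ A B C, zses A B C → ses (zero A) (zero B) (zero C)) (F : Ob → G)
    (hF : ∀ A B C, ses A B C → F B = F A + F C) (h0 : ∀ z, F (zero z) = 0) (A : Ob) :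
    K0Red.lift hz F hF h0 (K0Red.cls hz A) = F A :=
  K0.lift_cls ses F hF A

/-- The homomorphism on reduced `K₀` induced by an exact assignment that sends the objects
`zero z` to such objects. -/
def K0Red.map (F : Ob → Ob') (hF : ∀ A B C, ses A B C → ses' (F A) (F B) (F C))
    (Fz : Z → Z') (h0 : ∀ z, F (zero z) = zero' (Fz z)) :
    K0Red (ses := ses) (zses := zses) zero hz →+ K0Red (ses := ses') (zses := zses') zero' hz' :=
  K0Red.lift hz (fun A => K0Red.cls hz' (F A)) (fun A B C h => K0Red.cls_eq (hF A B C h))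
    (fun z => by rw [h0, K0Red.cls_zero])

end Red

end KTheory

/-! ### Endomorphism categories -/

section Endo

variable {R S : Type u} [Ring R] [Ring S]

/-- An object of `Mod^c_{R,S}`: an `R`-`S`-bimodule that is finitely generated and projective as
a right `S`-module. -/
structure ModC (R S : Type u) [Ring R] [Ring S] where
  mod : BiMod R S
  fgp : mod.IsFGP

instance : CoeSort (ModC R S) (Type u) := ⟨fun P => P.mod⟩

/-- `A → B → C` can be completed to a short exact sequence in `Mod^c_{R,S}`. -/
def ModC.Ses (A B C : ModC R S) : Prop :=
  ∃ (i : Hom A.mod B.mod) (p : Hom B.mod C.mod), ShortExact i p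

/-- The identity `P → Q` for equal `P` and `Q`. -/
def ModC.homOfEq {P Q : ModC R S} (h : P = Q) : Hom P.mod Q.mod :=
  h ▸ Hom.id P.mod

/-- An object of the twisted endomorphism category `End(R,S;M,N)`: a bimodule homomorphism
`M ⊗_R P → P ⊗_S N` with `P` in `Mod^c_{R,S}`. -/
@[ext]
structure EndObj (M : BiMod R R) (N : BiMod S S) where
  P : ModC R S
  f : Hom (tensor M P.mod) (tensor P.mod N)

/-- An object of `End(Mod^c_{R,S}; M ⊗_R -, - ⊗_S N; n, 1)`: a cyclic tuple of homomorphisms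
`f_j : M ⊗_R c_{j+1} → c_j ⊗_S N`, with indices `j` modulo `n`. -/
@[ext]
structure CycObj (M : BiMod R R) (N : BiMod S S) (n : ℕ) [NeZero n] where
  c : Fin n → ModC R S
  f : ∀ j, Hom (tensor M (c (j + 1)).mod) (tensor (c j).mod N)

/-- The square of `h : P → Q`, `h' : P' → Q'` with `f : M ⊗ P' → P ⊗ N` and
`g : M ⊗ Q' → Q ⊗ N` commutes. -/
def Intertwines {M : BiMod R R} {N : BiMod S S} {P P' Q Q' : BiMod R S}
    (f : Hom (tensor M P') (tensor P N)) (g : Hom (tensor M Q') (tensor Q N))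
    (h' : Hom P' Q') (h : Hom P Q) : Prop :=
  g.comp (tmap (Hom.id M) h') = (tmap h (Hom.id N)).comp f

/-- `A → B → C` can be completed to a short exact sequence in `End(R,S;M,N)`. -/
def EndObj.Ses {M : BiMod R R} {N : BiMod S S} (A B C : EndObj M N) : Prop :=
  ∃ (i : Hom A.P.mod B.P.mod) (p : Hom B.P.mod C.P.mod),
    Intertwines A.f B.f i i ∧ Intertwines B.f C.f p p ∧ ShortExact i p

/-- `A → B → C` can be completed to a short exact sequence of cyclic tuples. -/
def CycObj.Ses {M : BiMod R R} {N : BiMod S S} {n : ℕ} [NeZero n] (A B C : CycObj M N n) : Prop :=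
  ∃ (i : ∀ j, Hom (A.c j).mod (B.c j).mod) (p : ∀ j, Hom (B.c j).mod (C.c j).mod),
    (∀ j, Intertwines (A.f j) (B.f j) (i (j + 1)) (i j)) ∧
    (∀ j, Intertwines (B.f j) (C.f j) (p (j + 1)) (p j)) ∧ ∀ j, ShortExact (i j) (p j)

theorem intertwines_zero {M : BiMod R R} {N : BiMod S S} {P P' Q Q' : BiMod R S}
    (h' : Hom P' Q') (h : Hom P Q) :
    Intertwines (0 : Hom (tensor M P') (tensor P N)) (0 : Hom (tensor M Q') (tensor Q N)) h' h :=
  Hom.funext fun _ => (map_zero (tmap h (Hom.id N))).symm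

/-- The object `0 : M ⊗ P → P ⊗ N`. -/
def EndObj.zero (M : BiMod R R) (N : BiMod S S) (P : ModC R S) : EndObj M N := ⟨P, 0⟩

/-- The cyclic tuple of zero maps. -/
def CycObj.zero (M : BiMod R R) (N : BiMod S S) (n : ℕ) [NeZero n] (c : Fin n → ModC R S) :
    CycObj M N n := ⟨c, fun _ => 0⟩

theorem EndObj.zero_ses (M : BiMod R R) (N : BiMod S S) (A B C : ModC R S) (h : ModC.Ses A B C) :
    EndObj.Ses (EndObj.zero M N A) (EndObj.zero M N B) (EndObj.zero M N C) := by
  obtain ⟨i, p, h⟩ := h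
  exact ⟨i, p, intertwines_zero i i, intertwines_zero p p, h⟩

theorem CycObj.zero_ses (M : BiMod R R) (N : BiMod S S) (n : ℕ) [NeZero n]
    (A B C : Fin n → ModC R S) (h : ∀ j, ModC.Ses (A j) (B j) (C j)) :
    CycObj.Ses (CycObj.zero M N n A) (CycObj.zero M N n B) (CycObj.zero M N n C) := by
  choose i p h using h
  exact ⟨i, p, fun j => intertwines_zero _ _, fun j => intertwines_zero _ _, h⟩

/-- The reduced `K`-theory `K̃₀(R,S;M,N)`: the cokernel of `K₀(Mod^c_{R,S}) → K₀(End(R,S;M,N))`,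
`[P] ↦ [0 : M ⊗ P → P ⊗ N]`. -/
abbrev KTilde (M : BiMod R R) (N : BiMod S S) : Type (u + 1) :=
  K0Red (EndObj.zero M N) (EndObj.zero_ses M N)

/-- The reduced `K`-theory `K̃₀(Mod^c_{R,S}; M ⊗ -, - ⊗ N; n, 1)`: the cokernel of
`K₀((Mod^c_{R,S})^{× n}) → K₀(End(Mod^c_{R,S}; M ⊗ -, - ⊗ N; n, 1))`. -/
abbrev KTildeCyc (M : BiMod R R) (N : BiMod S S) (n : ℕ) [NeZero n] : Type (u + 1) :=
  K0Red (CycObj.zero M N n) (CycObj.zero_ses M N n)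

/-- The class of `f : M ⊗ P → P ⊗ N` in `K̃₀(R,S;M,N)`. -/
def KTilde.cls {M : BiMod R R} {N : BiMod S S} (A : EndObj M N) : KTilde M N :=
  K0Red.cls (EndObj.zero_ses M N) A

/-- The class of a cyclic tuple. -/
def KTildeCyc.cls {M : BiMod R R} {N : BiMod S S} {n : ℕ} [NeZero n] (A : CycObj M N n) :
    KTildeCyc M N n :=
  K0Red.cls (CycObj.zero_ses M N n) A

/-! ### The composition map `Γ` -/

section Gamma

variable {M : BiMod R R} {N : BiMod S S}

/-- From `f : M ⊗ P' → P ⊗ N` and `g : X ⊗ P'' → P' ⊗ Y`, the composite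
`M ⊗ X ⊗ P'' → M ⊗ P' ⊗ Y → P ⊗ N ⊗ Y`. -/
def composeStep {X : BiMod R R} {Y : BiMod S S} {P P' P'' : BiMod R S}
    (f : Hom (tensor M P') (tensor P N)) (g : Hom (tensor X P'') (tensor P' Y)) :
    Hom (tensor (tensor M X) P'') (tensor P (tensor N Y)) :=
  (assoc P N Y).hom.comp <| (tmap f (Hom.id Y)).comp <|
    (assoc M P' Y).inv.comp <| (tmap (Hom.id M) g).comp (assoc M X P'').hom

/-- The canonical isomorphism `R ⊗ P ≅ P ≅ P ⊗ S`, the composite of the empty family. -/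
def composeNil (P : BiMod R S) : Hom (tensor (unit R) P) (tensor P (unit S)) :=
  (runit P).inv.comp (lunit P).hom

theorem composeNil_natural {P Q : BiMod R S} (h : Hom P Q) :
    Intertwines (composeNil P) (composeNil Q) h h := by
  refine hom_ext fun r x => ?_
  change (runit Q).inv ((lunit Q).hom (pure r (h x))) =
    tmap h (Hom.id (unit S)) ((runit P).inv ((lunit P).hom (pure r x)))
  rw [lunit_hom_pure, lunit_hom_pure, ← h.smul_left]
  rfl

/-- The composite `Γ'(f_i, f_{s i}, …, f_{s^{n-1} i}) : M^{⊗ n} ⊗ c_{s^n i} → c_i ⊗ N^{⊗ n}` of a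
family `f_i : M ⊗ c_{s i} → c_i ⊗ N`, where `s` is the successor map on indices. -/
def compose {I : Type} (s : I → I) (c : I → BiMod R S)
    (f : ∀ i, Hom (tensor M (c (s i))) (tensor (c i) N)) :
    ∀ (n : ℕ) (i : I), Hom (tensor (pow M n) (c (s^[n] i))) (tensor (c i) (pow N n))
  | 0, i => composeNil (c i)
  | n + 1, i => composeStep (f i) (compose s c f n (s i))

theorem Intertwines.step {X : BiMod R R} {Y : BiMod S S} {P P' P'' Q Q' Q'' : BiMod R S}
    {f : Hom (tensor M P') (tensor P N)}
    {g : Hom (tensor X P'') (tensor P' Y)}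
    {f₁ : Hom (tensor M Q') (tensor Q N)}
    {g₁ : Hom (tensor X Q'') (tensor Q' Y)}
    {h : Hom P Q} {h' : Hom P' Q'} {h'' : Hom P'' Q''}
    (hf : Intertwines f f₁ h' h) (hg : Intertwines g g₁ h'' h') :
    Intertwines (composeStep f g) (composeStep f₁ g₁) h'' h := by
  have e1 : (assoc M X Q'').hom.comp (tmap (Hom.id (tensor M X)) h'') =
      (tmap (Hom.id M) (tmap (Hom.id X) h'')).comp (assoc M X P'').hom := by
    refine hom_ext fun w x => ?_
    induction w using pure_induction with
    | zero =>
      rw [← pureHom_apply, map_zero, AddMonoidHom.zero_apply, map_zero, map_zero]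
    | mk m v => rfl
    | add a b ha hb => rw [pure_add_left, map_add, map_add, ha, hb]
  have e2 : (assoc M Q' Y).inv.comp (tmap (Hom.id M) (tmap h' (Hom.id Y))) =
      (tmap (tmap (Hom.id M) h') (Hom.id Y)).comp (assoc M P' Y).inv := by
    refine hom_ext fun m w => ?_
    induction w using pure_induction with
    | zero => rw [← pureHom_apply, map_zero, map_zero, map_zero]
    | mk m v => rfl
    | add a b ha hb => rw [pure_add_right, map_add, map_add, ha, hb]
  have e3 : (assoc Q N Y).hom.comp (tmap (tmap h (Hom.id N)) (Hom.id Y)) =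
      (tmap h (Hom.id (tensor N Y))).comp (assoc P N Y).hom := by
    refine hom_ext fun w x => ?_
    induction w using pure_induction with
    | zero =>
      rw [← pureHom_apply, map_zero, AddMonoidHom.zero_apply, map_zero, map_zero]
    | mk m v => rfl
    | add a b ha hb => rw [pure_add_left, map_add, map_add, ha, hb]
  have e4 : (tmap (Hom.id M) g₁).comp (tmap (Hom.id M) (tmap (Hom.id X) h'')) =
      (tmap (Hom.id M) (tmap h' (Hom.id Y))).comp (tmap (Hom.id M) g) := by
    rw [tmap_comp, tmap_comp, hg]
  have e5 : (tmap f₁ (Hom.id Y)).comp (tmap (tmap (Hom.id M) h') (Hom.id Y)) =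
      (tmap (tmap h (Hom.id N)) (Hom.id Y)).comp (tmap f (Hom.id Y)) := by
    rw [tmap_comp, tmap_comp, hf]
  refine Hom.funext fun x => ?_
  have e1 := DFunLike.congr_fun e1 x
  have e4 := DFunLike.congr_fun e4 ((assoc M X P'').hom x)
  have e2 := DFunLike.congr_fun e2 (tmap (Hom.id M) g ((assoc M X P'').hom x))
  have e5 := DFunLike.congr_fun e5
    ((assoc M P' Y).inv (tmap (Hom.id M) g ((assoc M X P'').hom x)))
  have e3 := DFunLike.congr_fun e3 (tmap f (Hom.id Y)
    ((assoc M P' Y).inv (tmap (Hom.id M) g ((assoc M X P'').hom x))))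
  simp only [Hom.comp_apply] at e1 e2 e3 e4 e5
  simp only [composeStep, Hom.comp_apply]
  rw [e1, e4, e2, e5, e3]

theorem Intertwines.compose {I : Type} (s : I → I) {c d : I → BiMod R S}
    {f : ∀ i, Hom (tensor M (c (s i))) (tensor (c i) N)}
    {g : ∀ i, Hom (tensor M (d (s i))) (tensor (d i) N)} {h : ∀ i, Hom (c i) (d i)}
    (hfg : ∀ i, Intertwines (f i) (g i) (h (s i)) (h i)) :
    ∀ (n : ℕ) (i : I),
      Intertwines (compose s c f n i) (compose s d g n i) (h (s^[n] i)) (h i)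
  | 0, i => composeNil_natural (h i)
  | n + 1, i => (hfg i).step (Intertwines.compose s hfg n (s i))

theorem composeStep_zero {X : BiMod R R} {Y : BiMod S S} {P P' P'' : BiMod R S}
    (g : Hom (tensor X P'') (tensor P' Y)) :
    composeStep (0 : Hom (tensor M P') (tensor P N)) g = 0 := by
  have h : tmap (0 : Hom (tensor M P') (tensor P N)) (Hom.id Y) = 0 :=
    hom_ext fun w x => by
      rw [tmap_pure, Hom.zero_apply, Hom.zero_apply, ← pureHom_apply, map_zero,
        AddMonoidHom.zero_apply]
  refine Hom.funext fun x => ?_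
  simp only [composeStep, Hom.comp_apply, h, Hom.zero_apply, map_zero]

theorem succ_iterate (n : ℕ) [NeZero n] : (fun j : Fin n => j + 1)^[n] 0 = 0 := by
  have h : ∀ k : ℕ, (fun j : Fin n => j + 1)^[k] 0 = Fin.ofNat n k := by
    intro k
    induction k with
    | zero => rfl
    | succ k ih =>
      rw [Function.iterate_succ_apply', ih]
      ext
      simp [Fin.val_add]
  rw [h]
  ext
  simp

/-- The composition `Γ(f_0, …, f_{n-1}) : M^{⊗ n} ⊗ c_0 → c_0 ⊗ N^{⊗ n}` of a cyclic tuple. -/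
def CycObj.gammaHom {n : ℕ} [NeZero n] (A : CycObj M N n) :
    Hom (tensor (pow M n) (A.c 0).mod) (tensor (A.c 0).mod (pow N n)) :=
  (compose (fun j : Fin n => j + 1) (fun j => (A.c j).mod) A.f n 0).comp
    (tmap (Hom.id (pow M n)) (ModC.homOfEq (congrArg A.c (succ_iterate n).symm)))

/-- The functor `Γ` on objects. -/
def CycObj.gamma {n : ℕ} [NeZero n] (A : CycObj M N n) : EndObj (pow M n) (pow N n) :=
  ⟨A.c 0, A.gammaHom⟩

theorem homOfEq_natural {I : Type} {c d : I → ModC R S} (h : ∀ i, Hom (c i).mod (d i).mod)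
    {i j : I} (e : i = j) (x : (c i).mod) :
    h j (ModC.homOfEq (congrArg c e) x) = ModC.homOfEq (congrArg d e) (h i x) := by
  subst e; rfl

theorem gamma_intertwines {n : ℕ} [NeZero n] {A B : CycObj M N n}
    {h : ∀ j, Hom (A.c j).mod (B.c j).mod}
    (hh : ∀ j, Intertwines (A.f j) (B.f j) (h (j + 1)) (h j)) :
    Intertwines A.gammaHom B.gammaHom (h 0) (h 0) := by
  have h1 := Intertwines.compose (fun j : Fin n => j + 1) (c := fun j => (A.c j).mod)
    (d := fun j => (B.c j).mod) (f := A.f) (g := B.f) (h := h) hh n 0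
  refine hom_ext fun m x => ?_
  have h2 := DFunLike.congr_fun h1
    (pure m (ModC.homOfEq (congrArg A.c (succ_iterate n).symm) x))
  have h3 := homOfEq_natural h (succ_iterate n).symm x
  simp only [Hom.comp_apply, tmap_pure, Hom.id_apply, CycObj.gammaHom] at h2 h3 ⊢
  rw [← h2, h3]

/-- The homomorphism `Γ : K̃₀(Mod^c_{R,S}; M ⊗ -, - ⊗ N; n, 1) → K̃₀(R,S;M^{⊗ n},N^{⊗ n})` induced
by composition. -/
def gammaMap (M : BiMod R R) (N : BiMod S S) (n : ℕ) [NeZero n] :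
    KTildeCyc M N n →+ KTilde (pow M n) (pow N n) :=
  K0Red.map CycObj.gamma
    (by
      rintro A B C ⟨i, p, hi, hp, h⟩
      exact ⟨i 0, p 0, gamma_intertwines hi, gamma_intertwines hp, h 0⟩)
    (fun c => c 0)
    (fun c => by
      have h : compose (fun j : Fin n => j + 1) (fun j => (c j).mod)
          (fun j => (0 : Hom (tensor M (c (j + 1)).mod) (tensor (c j).mod N))) n 0 = 0 := by
        obtain ⟨k, rfl⟩ := Nat.exists_eq_succ_of_ne_zero (NeZero.ne n)
        exact composeStep_zero _
      refine EndObj.ext rfl (heq_of_eq (Hom.funext fun x => ?_))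
      change (compose (fun j : Fin n => j + 1) (fun j => (c j).mod)
          (fun j => (0 : Hom (tensor M (c (j + 1)).mod) (tensor (c j).mod N))) n 0) _ = 0
      rw [h]
      rfl)

end Gamma

/-! ### Frobenius -/

/-- The constant tuple `(f, …, f)`. -/
def EndObj.diag {M : BiMod R R} {N : BiMod S S} (n : ℕ) [NeZero n] (A : EndObj M N) :
    CycObj M N n := ⟨fun _ => A.P, fun _ => A.f⟩

/-- The `n`-Frobenius `F^n : K̃₀(R,S;M,N) → K̃₀(R,S;M^{⊗ n},N^{⊗ n})`, `[f] ↦ [Γ(f, …, f)]`. -/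
def frobMap (M : BiMod R R) (N : BiMod S S) (n : ℕ) [NeZero n] :
    KTilde M N →+ KTilde (pow M n) (pow N n) :=
  (gammaMap M N n).comp
    (K0Red.map (EndObj.diag n)
      (by
        rintro A B C ⟨i, p, hi, hp, h⟩
        exact ⟨fun _ => i, fun _ => p, fun _ => hi, fun _ => hp, fun _ => h⟩)
      (fun P _ => P) (fun _ => rfl))

/-! ### The cyclic summing functor -/

section Sigma

/-- The direct sum `⨁_j c_j` of a finite family. -/
def BiMod.directSum {n : ℕ} (c : Fin n → BiMod R S) : BiMod R S := ⟨∀ j, c j⟩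

theorem BiMod.directSum_fgp {n : ℕ} (c : Fin n → BiMod R S) (h : ∀ j, (c j).IsFGP) :
    (BiMod.directSum c).IsFGP where
  finite := by
    have := fun j => (h j).finite
    exact (inferInstance : Module.Finite Sᵐᵒᵖ (∀ j, c j))
  projective := by
    have := fun j => (h j).projective
    exact Module.Projective.of_equiv (DFinsupp.linearEquivFunOnFintype (R := Sᵐᵒᵖ)
      (M := fun j => (c j).carrier))

/-- The direct sum of a finite family in `Mod^c_{R,S}`. -/
def ModC.directSum {n : ℕ} (c : Fin n → ModC R S) : ModC R S :=
  ⟨BiMod.directSum fun j => (c j).mod, BiMod.directSum_fgp _ fun j => (c j).fgp⟩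

/-- The inclusion `c_j → ⨁_j c_j`. -/
def BiMod.incl {n : ℕ} (c : Fin n → BiMod R S) (j : Fin n) : Hom (c j) (BiMod.directSum c) where
  toFun := AddMonoidHom.single (fun j => (c j).carrier) j
  map_left r x := Pi.single_smul (f := fun j => (c j).carrier) j r x
  map_right s x := Pi.single_smul (f := fun j => (c j).carrier) j (op s) x

/-- The projection `⨁_j c_j → c_j`. -/
def BiMod.proj {n : ℕ} (c : Fin n → BiMod R S) (j : Fin n) : Hom (BiMod.directSum c) (c j) where
  toFun := Pi.evalAddMonoidHom (fun j => (c j).carrier) j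
  map_left _ _ := rfl
  map_right _ _ := rfl

/-- The direct sum of a finite family of homomorphisms. -/
def BiMod.sumHom {n : ℕ} {c d : Fin n → BiMod R S} (h : ∀ j, Hom (c j) (d j)) :
    Hom (BiMod.directSum c) (BiMod.directSum d) where
  toFun := AddMonoidHom.mk' (fun x j => h j (x j)) (fun _ _ => funext fun j => map_add (h j) _ _)
  map_left r x := funext fun j => (h j).smul_left r (x j)
  map_right s x := funext fun j => (h j).smul_right s (x j)

theorem BiMod.sumHom_apply {n : ℕ} {c d : Fin n → BiMod R S} (h : ∀ j, Hom (c j) (d j))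
    (x : BiMod.directSum c) (j : Fin n) : BiMod.proj d j (BiMod.sumHom h x) =
      h j (BiMod.proj c j x) := rfl

theorem BiMod.sumHom_incl {n : ℕ} {c d : Fin n → BiMod R S} (h : ∀ j, Hom (c j) (d j))
    (j : Fin n) : (BiMod.sumHom h).comp (BiMod.incl c j) = (BiMod.incl d j).comp (h j) :=
  Hom.funext fun x => (Pi.single_op (M := fun j => (c j).carrier) (N := fun j => (d j).carrier)
    (fun k => h k) (fun k => map_zero (h k)) j x).symm

variable {M : BiMod R R} {N : BiMod S S}

/-- The endomorphism `M ⊗ ⨁_j c_j → ⨁_j c_j ⊗ N` which is `f_j : M ⊗ c_{j+1} → c_j ⊗ N` from the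
summand `c_{j+1}` to the summand `c_j`. -/
def CycObj.sigmaHom {n : ℕ} [NeZero n] (A : CycObj M N n) :
    Hom (tensor M (BiMod.directSum fun j => (A.c j).mod))
      (tensor (BiMod.directSum fun j => (A.c j).mod) N) :=
  Hom.sum fun j =>
    (tmap (BiMod.incl (fun j => (A.c j).mod) j) (Hom.id N)).comp
      ((A.f j).comp (tmap (Hom.id M) (BiMod.proj (fun j => (A.c j).mod) (j + 1))))

/-- The cyclic summing functor on objects. -/
def CycObj.sigma {n : ℕ} [NeZero n] (A : CycObj M N n) : EndObj M N :=
  ⟨ModC.directSum A.c, A.sigmaHom⟩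

theorem sigma_intertwines {n : ℕ} [NeZero n] {A B : CycObj M N n}
    {h : ∀ j, Hom (A.c j).mod (B.c j).mod}
    (hh : ∀ j, Intertwines (A.f j) (B.f j) (h (j + 1)) (h j)) :
    Intertwines A.sigmaHom B.sigmaHom (BiMod.sumHom h) (BiMod.sumHom h) := by
  refine hom_ext fun m x => ?_
  simp only [CycObj.sigmaHom, Hom.comp_apply, Hom.sum_apply, map_sum, tmap_pure, Hom.id_apply]
  refine Finset.sum_congr rfl fun j _ => ?_
  rw [BiMod.sumHom_apply]
  have h1 := DFunLike.congr_fun (hh j) (pure m (BiMod.proj (fun j => (A.c j).mod) (j + 1) x))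
  simp only [Hom.comp_apply, tmap_pure, Hom.id_apply] at h1
  have h2 : ∀ z, tmap (BiMod.incl (fun j => (B.c j).mod) j) (Hom.id N) (tmap (h j) (Hom.id N) z) =
      tmap (BiMod.sumHom h) (Hom.id N) (tmap (BiMod.incl (fun j => (A.c j).mod) j) (Hom.id N) z) :=
    fun z => by
      rw [← Hom.comp_apply, ← Hom.comp_apply, tmap_comp, tmap_comp, BiMod.sumHom_incl]
  rw [h1, h2]

theorem sumHom_shortExact {n : ℕ} {c d e : Fin n → BiMod R S} {i : ∀ j, Hom (c j) (d j)}
    {p : ∀ j, Hom (d j) (e j)} (h : ∀ j, ShortExact (i j) (p j)) :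
    ShortExact (BiMod.sumHom i) (BiMod.sumHom p) where
  injective x y hxy := funext fun j => (h j).injective (congrFun hxy j)
  surjective z := by
    choose y hy using fun j => (h j).surjective (z j)
    exact ⟨y, funext hy⟩
  exact y := by
    constructor
    · intro hy
      choose x hx using fun j => ((h j).exact (y j)).1 (congrFun hy j)
      exact ⟨x, funext hx⟩
    · rintro ⟨x, rfl⟩
      exact funext fun j => ((h j).exact _).2 ⟨x j, rfl⟩

theorem sigmaHom_zero {n : ℕ} [NeZero n] (c : Fin n → ModC R S) :
    (CycObj.zero M N n c).sigmaHom = 0 := by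
  refine Hom.funext fun x => (Hom.sum_apply _ x).trans (Finset.sum_eq_zero fun j _ => ?_)
  exact map_zero (tmap (BiMod.incl (fun j => (c j).mod) j) (Hom.id N))

/-- The homomorphism `K̃₀(Mod^c_{R,S}; M ⊗ -, - ⊗ N; n, 1) → K̃₀(R,S;M,N)` induced by the cyclic
summing functor. -/
def sigmaMap (M : BiMod R R) (N : BiMod S S) (n : ℕ) [NeZero n] :
    KTildeCyc M N n →+ KTilde M N :=
  K0Red.map CycObj.sigma
    (by
      rintro A B C ⟨i, p, hi, hp, h⟩
      exact ⟨BiMod.sumHom i, BiMod.sumHom p, sigma_intertwines hi, sigma_intertwines hp,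
        sumHom_shortExact h⟩)
    ModC.directSum
    (fun c => EndObj.ext rfl (heq_of_eq (sigmaHom_zero c)))

/-- The `n`-Verschiebung `V^n : K̃₀(R,S;M^{⊗ n},N^{⊗ n}) → K̃₀(R,S;M,N)`: the inverse of the
isomorphism `Γ` followed by the cyclic summing homomorphism. -/
noncomputable def verschiebungMap (M : BiMod R R) (N : BiMod S S) (n : ℕ) [NeZero n]
    (hΓ : Function.Bijective (gammaMap M N n)) : KTilde (pow M n) (pow N n) →+ KTilde M N :=
  (sigmaMap M N n).comp (AddEquiv.ofBijective (gammaMap M N n) hΓ).symm.toAddMonoidHom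

end Sigma

/-! ### Change of coefficients along isomorphisms -/

/-- An isomorphism of coefficient bimodules induces a homomorphism
`K̃₀(R,S;M,N) → K̃₀(R,S;M',N')`. -/
def coeffMap {M M' : BiMod R R} {N N' : BiMod S S} (e : Iso M M') (e' : Iso N N') :
    KTilde M N →+ KTilde M' N' :=
  K0Red.map
    (fun A => ⟨A.P, (tmap (Hom.id A.P.mod) e'.hom).comp (A.f.comp (tmap e.inv (Hom.id A.P.mod)))⟩)
    (by
      have key : ∀ {A B : EndObj M N} {h : Hom A.P.mod B.P.mod}, Intertwines A.f B.f h h →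
          Intertwines ((tmap (Hom.id A.P.mod) e'.hom).comp (A.f.comp (tmap e.inv (Hom.id A.P.mod))))
            ((tmap (Hom.id B.P.mod) e'.hom).comp (B.f.comp (tmap e.inv (Hom.id B.P.mod)))) h h := by
        intro A B h hh
        refine Hom.funext fun x => ?_
        have h1 := DFunLike.congr_fun hh (tmap e.inv (Hom.id A.P.mod) x)
        simp only [Hom.comp_apply] at h1 ⊢
        have h2 : tmap e.inv (Hom.id B.P.mod) (tmap (Hom.id M') h x) =
            tmap (Hom.id M) h (tmap e.inv (Hom.id A.P.mod) x) := by
          rw [← Hom.comp_apply, ← Hom.comp_apply, tmap_comp, tmap_comp]; rfl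
        rw [h2, h1, ← Hom.comp_apply, ← Hom.comp_apply (tmap h (Hom.id N')), tmap_comp, tmap_comp]
        rfl
      rintro A B C ⟨i, p, hi, hp, h⟩
      exact ⟨i, p, key hi, key hp, h⟩)
    id
    (fun P => EndObj.ext rfl (heq_of_eq (Hom.funext fun x =>
      map_zero (tmap (Hom.id P.mod) e'.hom))))

/-! ### The trace -/

section Trace

/-- A finite dual basis of `X` as a right `S`-module: elements `e_i` and right `S`-linear
functionals `φ_i` with `x = ∑ e_i φ_i(x)`.  It amounts to the coevaluation
`η(1) = ∑ e_i ⊗ φ_i ∈ X ⊗_S Hom_S(X, S)`. -/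
structure DualBasis (X : BiMod R S) where
  n : ℕ
  e : Fin n → X
  φ : Fin n → (X →ₗ[Sᵐᵒᵖ] S)
  expand : ∀ x, ∑ i, op (φ i x) • e i = x

theorem DualBasis.nonempty {X : BiMod R S} (h : X.IsFGP) : Nonempty (DualBasis X) := by
  have := h.finite
  have := h.projective
  obtain ⟨n, f, g, -, -, hfg⟩ := Module.Finite.exists_comp_eq_id_of_projective Sᵐᵒᵖ X
  let u : Sᵐᵒᵖ →ₗ[Sᵐᵒᵖ] S :=
    { toFun := unop
      map_add' := fun _ _ => rfl
      map_smul' := fun _ _ => rfl }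
  refine ⟨⟨n, fun i => f (Pi.single i 1), fun i => u.comp ((LinearMap.proj i).comp g), fun x => ?_⟩⟩
  have h1 : f (g x) = x := DFunLike.congr_fun hfg x
  conv_rhs => rw [← h1, ← (Pi.basisFun Sᵐᵒᵖ (Fin n)).sum_repr (g x), map_sum]
  refine Finset.sum_congr rfl fun i _ => ?_
  rw [map_smul, Pi.basisFun_repr, Pi.basisFun_apply]
  rfl

/-- The map `φ ⊗ 1 : X ⊗_S N → S ⊗_S N = N` for a right `S`-linear functional `φ`. -/
def contract {X : BiMod R S} (N : BiMod S S) (φ : X →ₗ[Sᵐᵒᵖ] S) : tensor X N →+ N :=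
  addLift
    (AddMonoidHom.mk' (fun x => DistribSMul.toAddMonoidHom N (φ x))
      (fun x y => by ext n; simp [add_smul]))
    (fun x s n => by
      change φ (op s • x) • n = φ x • s • n
      rw [map_smul, op_smul_eq_mul, mul_smul])

variable {N : BiMod S S}

theorem contract_pure {X : BiMod R S} (φ : X →ₗ[Sᵐᵒᵖ] S) (x : X) (n : N) :
    contract N φ (pure x n) = φ x • n := rfl

theorem contract_smul {X : BiMod R S} (φ : X →ₗ[Sᵐᵒᵖ] S) (s : S) (z : tensor X N) :
    contract N φ (op s • z) = op s • contract N φ z := by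
  induction z using pure_induction with
  | zero => rw [smul_zero, map_zero, smul_zero]
  | mk x n => rw [op_smul_pure, contract_pure, contract_pure, smul_comm]
  | add a b ha hb => rw [smul_add, map_add, map_add, smul_add, ha, hb]

theorem contract_sum {X : BiMod R S} {k : ℕ} (φ : X →ₗ[Sᵐᵒᵖ] S) (t : Fin k → S)
    (ψ : Fin k → (X →ₗ[Sᵐᵒᵖ] S)) (h : ∀ x, φ x = ∑ i, t i * ψ i x) (z : tensor X N) :
    contract N φ z = ∑ i, t i • contract N (ψ i) z := by
  induction z using pure_induction with
  | zero => simp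
  | mk x n => simp only [contract_pure, h, Finset.sum_smul, mul_smul]
  | add a b ha hb => simp only [map_add, smul_add, Finset.sum_add_distrib, ha, hb]

/-- A homomorphism of bimodules as a map of right modules. -/
def BiMod.Hom.right {X Y : BiMod R S} (f : Hom X Y) : X →ₗ[Sᵐᵒᵖ] Y where
  toFun := f
  map_add' := map_add f
  map_smul' s x := f.smul_right (unop s) x

theorem contract_tmap {X Y : BiMod R S} (g : Hom X Y) (φ : Y →ₗ[Sᵐᵒᵖ] S) (z : tensor X N) :
    contract N φ (tmap g (Hom.id N) z) = contract N (φ.comp g.right) z := by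
  induction z using pure_induction with
  | zero => simp
  | mk x n => rfl
  | add a b ha hb => simp only [map_add, ha, hb]

/-- The trace formula is cyclic. -/
theorem trace_cyclic {P Q : BiMod R S} (b : DualBasis P) (b' : DualBasis Q)
    (u : P →ₗ[Sᵐᵒᵖ] Q) (F : Q →ₗ[Sᵐᵒᵖ] tensor P N) :
    ∑ i, toShadow N (contract N (b.φ i) (F (u (b.e i)))) =
      ∑ j, toShadow N (contract N ((b'.φ j).comp u) (F (b'.e j))) := by
  have h1 : ∀ i, toShadow N (contract N (b.φ i) (F (u (b.e i)))) =
      ∑ j, toShadow N (b'.φ j (u (b.e i)) • contract N (b.φ i) (F (b'.e j))) := by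
    intro i
    conv_lhs => rw [← b'.expand (u (b.e i))]
    simp only [map_sum, map_smul, contract_smul, ← toShadow_smul]
  simp only [h1]
  rw [Finset.sum_comm]
  refine Finset.sum_congr rfl fun j _ => ?_
  rw [← map_sum]
  congr 1
  refine (contract_sum _ _ _ (fun x => ?_) _).symm
  conv_lhs => rw [← b.expand x]
  simp only [map_sum, map_smul, LinearMap.comp_apply, op_smul_eq_mul]

variable {M : BiMod R R}

/-- The right `S`-linear map `f (m ⊗ -) : P → P ⊗ N`. -/
def partialApp {P Q : BiMod R S} (f : Hom (tensor M P) Q) (m : M) : P →ₗ[Sᵐᵒᵖ] Q where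
  toFun p := f (pure m p)
  map_add' p q := by rw [pure_add_right, map_add]
  map_smul' s p := by
    obtain ⟨s, rfl⟩ := op_surjective s
    rw [← op_smul_pure, f.smul_right]; rfl

/-- The additive map `m ↦ ∑_i [(φ_i ⊗ 1) (f (m ⊗ e_i))]`. -/
def traceAux {P : BiMod R S} (b : DualBasis P) (f : Hom (tensor M P) (tensor P N)) :
    M →+ Shadow N :=
  ∑ i, ((toShadow N).comp (contract N (b.φ i))).comp (f.toFun.comp ((pureHom M P).flip (b.e i)))

theorem traceAux_apply {P : BiMod R S} (b : DualBasis P) (f : Hom (tensor M P) (tensor P N))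
    (m : M) : traceAux b f m =
      ∑ i, toShadow N (contract N (b.φ i) (partialApp f m (b.e i))) := by
  rw [traceAux, AddMonoidHom.finsetSum_apply]
  rfl

/-- Left multiplication by `r` as a map of right modules. -/
def leftMul (P : BiMod R S) (r : R) : P →ₗ[Sᵐᵒᵖ] P where
  toFun p := r • p
  map_add' := smul_add r
  map_smul' s p := smul_comm r s p

theorem contract_left {X : BiMod R S} (φ : X →ₗ[Sᵐᵒᵖ] S) (r : R) (z : tensor X N) :
    contract N φ (r • z) = contract N (φ.comp (leftMul X r)) z := by
  induction z using pure_induction with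
  | zero => rw [smul_zero, map_zero, map_zero]
  | mk x n => rfl
  | add a b ha hb => simp only [smul_add, map_add, ha, hb]

theorem traceAux_smul {P : BiMod R S} (b : DualBasis P) (f : Hom (tensor M P) (tensor P N))
    (r : R) (m : M) : traceAux b f (r • m) = traceAux b f (op r • m) := by
  rw [traceAux_apply, traceAux_apply]
  have h1 : ∀ i, partialApp f (op r • m) (b.e i) = partialApp f m (leftMul P r (b.e i)) :=
    fun i => congrArg f (pure_balanced m r (b.e i))
  have h2 : ∀ i, partialApp f (r • m) (b.e i) = r • partialApp f m (b.e i) :=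
    fun i => f.smul_left r (pure m (b.e i))
  simp only [h1, h2, contract_left]
  exact (trace_cyclic b b (leftMul P r) (partialApp f m)).symm

/-- The trace of `f : M ⊗_R P → P ⊗_S N` computed with a dual basis `(e_i, φ_i)` of `P`, as the
homomorphism `⟨⟨M⟩⟩ → ⟨⟨N⟩⟩`, `[m] ↦ ∑_i [(φ_i ⊗ 1) (f (m ⊗ e_i))]`. -/
def traceWith {P : BiMod R S} (b : DualBasis P) (f : Hom (tensor M P) (tensor P N)) :
    Shadow M →+ Shadow N :=
  shadowLift (traceAux b f) (traceAux_smul b f)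

theorem traceWith_apply {P : BiMod R S} (b : DualBasis P) (f : Hom (tensor M P) (tensor P N))
    (m : M) : traceWith b f (toShadow M m) =
      ∑ i, toShadow N (contract N (b.φ i) (partialApp f m (b.e i))) :=
  traceAux_apply b f m

/-- The trace does not depend on the dual basis. -/
theorem traceWith_eq {P : BiMod R S} (b b' : DualBasis P) (f : Hom (tensor M P) (tensor P N)) :
    traceWith b f = traceWith b' f :=
  shadow_hom_ext fun m => by
    rw [traceWith_apply, traceWith_apply]
    exact trace_cyclic b b' LinearMap.id (partialApp f m)

/-- The bicategorical (Hattori–Stallings) trace `tr(f) : ⟨⟨M⟩⟩ → ⟨⟨N⟩⟩` of `f : M ⊗ P → P ⊗ N`. -/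
noncomputable def EndObj.trace (A : EndObj M N) : Shadow M →+ Shadow N :=
  traceWith (Classical.choice (DualBasis.nonempty A.P.fgp)) A.f

theorem EndObj.trace_eq (A : EndObj M N) (b : DualBasis A.P.mod) : A.trace = traceWith b A.f :=
  traceWith_eq _ b A.f

theorem EndObj.trace_add (A B C : EndObj M N) (h : EndObj.Ses A B C) :
    B.trace = A.trace + C.trace := by
  obtain ⟨i, p, hi, hp, h⟩ := h
  have := C.P.fgp.projective
  obtain ⟨s, hs⟩ := Module.projective_lifting_property p.right LinearMap.id h.surjective
  have hs' : ∀ z, p (s z) = z := fun z => DFunLike.congr_fun hs z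
  have hex : ∀ y, ∃ x, i x = y - s (p y) := fun y =>
    (h.exact _).1 (by rw [map_sub, hs', sub_self])
  choose ρ hρ using hex
  let ρ' : B.P.mod →ₗ[Sᵐᵒᵖ] A.P.mod :=
    { toFun := ρ
      map_add' := fun x y => h.injective (by
        rw [map_add, hρ, hρ, hρ, map_add, map_add]; abel)
      map_smul' := fun t x => h.injective (by
        obtain ⟨t, rfl⟩ := op_surjective t
        rw [RingHom.id_apply, i.smul_right, hρ, hρ, p.smul_right, map_smul, smul_sub]) }
  have hρi : ∀ x, ρ' (i x) = x := fun x => h.injective (by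
    change i (ρ (i x)) = i x
    rw [hρ, (h.exact (i x)).2 ⟨x, rfl⟩, map_zero, sub_zero])
  have hdec : ∀ y, i (ρ' y) + s (p y) = y := fun y => by
    change i (ρ y) + _ = y
    rw [hρ, sub_add_cancel]
  obtain ⟨a⟩ := DualBasis.nonempty A.P.fgp
  obtain ⟨b⟩ := DualBasis.nonempty B.P.fgp
  obtain ⟨c⟩ := DualBasis.nonempty C.P.fgp
  rw [A.trace_eq a, B.trace_eq b, C.trace_eq c]
  refine shadow_hom_ext fun m => ?_
  rw [AddMonoidHom.add_apply, traceWith_apply, traceWith_apply, traceWith_apply]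
  have e1 := trace_cyclic b a ρ' ((partialApp B.f m).comp i.right)
  have e2 := trace_cyclic b c p.right ((partialApp B.f m).comp s)
  have h1 : ∀ x, partialApp B.f m (i x) = tmap i (Hom.id N) (partialApp A.f m x) := fun x =>
    DFunLike.congr_fun hi (pure m x)
  have h2 : ∀ y, partialApp C.f m (p y) = tmap p (Hom.id N) (partialApp B.f m y) := fun y =>
    DFunLike.congr_fun hp (pure m y)
  have e3 : ∀ j, contract N ((a.φ j).comp ρ') ((partialApp B.f m).comp i.right (a.e j)) =
      contract N (a.φ j) (partialApp A.f m (a.e j)) := by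
    intro j
    change contract N ((a.φ j).comp ρ') (partialApp B.f m (i (a.e j))) = _
    rw [h1, contract_tmap]
    congr 1
    congr 1
    exact LinearMap.ext fun x => congrArg (a.φ j) (hρi x)
  have e4 : ∀ j, contract N ((c.φ j).comp p.right) ((partialApp B.f m).comp s (c.e j)) =
      contract N (c.φ j) (partialApp C.f m (c.e j)) := by
    intro j
    rw [← contract_tmap]
    change contract N (c.φ j) (tmap p (Hom.id N) (partialApp B.f m (s (c.e j)))) = _
    rw [← h2, hs']
  simp only [e3] at e1
  simp only [e4] at e2
  rw [← e1, ← e2, ← Finset.sum_add_distrib]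
  refine Finset.sum_congr rfl fun k _ => ?_
  rw [← map_add, ← map_add]
  congr 2
  change _ = partialApp B.f m (i (ρ' (b.e k))) + partialApp B.f m (s (p (b.e k)))
  rw [← map_add, hdec]

theorem EndObj.trace_zero (P : ModC R S) : (EndObj.zero M N P).trace = 0 := by
  refine shadow_hom_ext fun m => ?_
  rw [EndObj.trace, traceWith_apply]
  refine Finset.sum_eq_zero fun i _ => ?_
  change toShadow N (contract N _ 0) = 0
  rw [map_zero, map_zero]

/-- The trace homomorphism `K̃₀(R,S;M,N) → Map(⟨⟨M⟩⟩, ⟨⟨N⟩⟩)`. -/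
noncomputable def traceMap (M : BiMod R R) (N : BiMod S S) :
    KTilde M N →+ (Shadow M →+ Shadow N) :=
  K0Red.lift (EndObj.zero_ses M N) EndObj.trace EndObj.trace_add EndObj.trace_zero

/-- The `n`-th component `tr_n : K̃₀(R,S;M,N) → Map(⟨⟨M^{⊗ n}⟩⟩, ⟨⟨N^{⊗ n}⟩⟩)`,
`[f] ↦ tr(F^n(f))`, of the iterated trace map `tr_•`. -/
noncomputable def iterTrace (M : BiMod R R) (N : BiMod S S) (n : ℕ) [NeZero n] :
    KTilde M N →+ (Shadow (pow M n) →+ Shadow (pow N n)) :=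
  (traceMap (pow M n) (pow N n)).comp (frobMap M N n)

/-- The generator of the `ℤ/j`-action on `Map(⟨⟨M^{⊗ j}⟩⟩, ⟨⟨N^{⊗ j}⟩⟩)`, sending `f` to
`ς_N ∘ f ∘ ς_M⁻¹`. -/
def rotGen (M : BiMod R R) (N : BiMod S S) (j : ℕ)
    (f : Shadow (pow M j) →+ Shadow (pow N j)) : Shadow (pow M j) →+ Shadow (pow N j) :=
  ((rot N j).toAddMonoidHom.comp f).comp (rot M j).symm.toAddMonoidHom

/-- `rotGen` generates an action of `ℤ/j`. -/
theorem rotGen_iterate (M : BiMod R R) (N : BiMod S S) (j : ℕ)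
    (f : Shadow (pow M j) →+ Shadow (pow N j)) : (rotGen M N j)^[j] f = f := by
  have h : ∀ k x, (rotGen M N j)^[k] f ((rot M j)^[k] x) = (rot N j)^[k] (f x) := by
    intro k
    induction k with
    | zero => intro x; rfl
    | succ k ih =>
      intro x
      rw [Function.iterate_succ_apply', Function.iterate_succ_apply' (rot M j),
        Function.iterate_succ_apply' (rot N j), ← ih]
      change rot N j _ = _
      congr 2
      exact (rot M j).symm_apply_apply _
  ext x
  have := h j x
  rwa [rot_iterate, rot_iterate] at this

/-- The transfer `τ : Map_{ℤ/k}(⟨⟨(M^{⊗ n})^{⊗ k}⟩⟩, ⟨⟨(N^{⊗ n})^{⊗ k}⟩⟩) →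
Map_{ℤ/nk}(⟨⟨M^{⊗ nk}⟩⟩, ⟨⟨N^{⊗ nk}⟩⟩)` along `ℤ/k ≅ n (ℤ/nk) ⊆ ℤ/nk`: the sum of the translates of
`f` by the coset representatives `0, …, n - 1`, after the identifications
`(M^{⊗ n})^{⊗ k} ≅ M^{⊗ nk}` and `(N^{⊗ n})^{⊗ k} ≅ N^{⊗ nk}`. -/
def transferMap (M : BiMod R R) (N : BiMod S S) (n k : ℕ)
    (f : Shadow (pow (pow M n) k) →+ Shadow (pow (pow N n) k)) :
    Shadow (pow M (n * k)) →+ Shadow (pow N (n * k)) :=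
  ∑ i ∈ Finset.range n, (rotGen M N (n * k))^[i]
    (((shadowIso (powMul N n k)).toAddMonoidHom.comp f).comp
      (shadowIso (powMul M n k)).symm.toAddMonoidHom)

end Trace

end Endo

/-! Bijectivity of Γ. Classes of cyclic tuples in reduced K-theory are coarse: a morphism of tuples
that is bijective at a single index already forces equal classes
(`KTildeCyc.cls_eq_of_bijective_at`). The source of this is a tuple on c ⊕ d that is an extension in
two ways, once along c and once along the graph of a morphism h : c → d; equating its two classes
gives `KTildeCyc.cls_add_cls`. Shift equivalence follows, then the fact that a zero map spreads
round the cycle, so that a tuple with one zero map has class 0.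

If M ≅ R, then Γ has a right adjoint, sending f on P to the tuple (1, …, 1, f) on P, P ⊗ N, P ⊗ N ⊗
N, …. If N ≅ S, it has a left adjoint built from M ⊗ ⋯ ⊗ M ⊗ P. In both cases the map relating a
tuple A to the tuple attached to ΓA is an isomorphism at index 0, hence invisible in reduced
K-theory. The adjoint E need not be exact, but it preserves surjections, and this suffices: for X →
Y → Z short exact, the kernel K of EY → EZ satisfies ΓK ≅ X, so [K] = [E(ΓK)] = [EX]. This is
`gammaMap_bijective_of`.

Verschiebung. Because Γ is onto, identities for V^n may be tested on elements Γy, where V^n(Γy) =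
σy. For V^n V^m = V^{nm}, a tuple A of length nm produces a tuple z of length m (composites of
consecutive blocks of length n) and a tuple w of length n (sums over residue classes modulo n), with
Γz = ΓA, Γw = σz and σw = σA (`exists_iterated_blocks`).

Traces. The trace is cyclic, so rotation carries the trace of a closed path of twisted maps to the
trace of the same loop started one step later (`rotGen_traceWith`). For a constant loop this is
equivariance. The j-th iterated trace of σA is the sum of the traces of the closed paths of length j
in A (`iterTrace_sigma`). There are none unless n divides j. For j = nk there is one at each of the
n indices; rotation permutes them cyclically, and the one at index 0 is the k-th iterated trace of
ΓA, so their sum is the transfer.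

Coherence is handled by `TwistedPath`: composites are evaluated along paths, and regroupings are
commuting squares `Sq` over the canonical isomorphisms of tensor powers. -/

open BiMod

/-! ### Bimodule maps: sums, differences and inverses -/

namespace BiMod

variable {R S T U : Type u} [Ring R] [Ring S] [Ring T] [Ring U]

namespace Hom

instance (X Y : BiMod R S) : Add (Hom X Y) where
  add f g :=
    { toFun := f.toFun + g.toFun
      map_left := fun r x => by
        simp only [AddMonoidHom.add_apply, f.map_left, g.map_left, smul_add]
      map_right := fun s x => by
        simp only [AddMonoidHom.add_apply, f.map_right, g.map_right, smul_add] }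

instance (X Y : BiMod R S) : Sub (Hom X Y) where
  sub f g :=
    { toFun := f.toFun - g.toFun
      map_left := fun r x => by
        simp only [AddMonoidHom.sub_apply, f.map_left, g.map_left, smul_sub]
      map_right := fun s x => by
        simp only [AddMonoidHom.sub_apply, f.map_right, g.map_right, smul_sub] }

@[simp] theorem add_apply {X Y : BiMod R S} (f g : Hom X Y) (x : X) : (f + g) x = f x + g x := rfl

@[simp] theorem sub_apply {X Y : BiMod R S} (f g : Hom X Y) (x : X) : (f - g) x = f x - g x := rfl

theorem id_comp {X Y : BiMod R S} (f : Hom X Y) : (Hom.id Y).comp f = f := rfl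

theorem comp_id {X Y : BiMod R S} (f : Hom X Y) : f.comp (Hom.id X) = f := rfl

theorem comp_assoc {X Y Z W : BiMod R S} (f : Hom Z W) (g : Hom Y Z) (h : Hom X Y) :
    (f.comp g).comp h = f.comp (g.comp h) := rfl

theorem zero_comp {X Y Z : BiMod R S} (f : Hom X Y) : (0 : Hom Y Z).comp f = 0 := rfl

theorem comp_zero {X Y Z : BiMod R S} (f : Hom Y Z) : f.comp (0 : Hom X Y) = 0 :=
  funext fun _ => map_zero f

end Hom

/-- A bijective homomorphism is an isomorphism. -/
noncomputable def Iso.ofBijective {X Y : BiMod R S} (f : Hom X Y) (hf : Function.Bijective f) :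
    Iso X Y where
  hom := f
  inv :=
    { toFun := (AddEquiv.ofBijective f hf).symm.toAddMonoidHom
      map_left := fun r y => hf.1 <| by
        have h : ∀ y, f ((AddEquiv.ofBijective f hf).symm y) = y :=
          (AddEquiv.ofBijective f hf).apply_symm_apply
        change f ((AddEquiv.ofBijective f hf).symm _) =
          f (r • (AddEquiv.ofBijective f hf).symm y)
        rw [f.smul_left, h, h]
      map_right := fun s y => hf.1 <| by
        have h : ∀ y, f ((AddEquiv.ofBijective f hf).symm y) = y :=
          (AddEquiv.ofBijective f hf).apply_symm_apply
        change f ((AddEquiv.ofBijective f hf).symm _) =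
          f (op s • (AddEquiv.ofBijective f hf).symm y)
        rw [f.smul_right, h, h] }
  hom_inv := (AddEquiv.ofBijective f hf).symm_apply_apply
  inv_hom := (AddEquiv.ofBijective f hf).apply_symm_apply

theorem Iso.hom_comp_inv {X Y : BiMod R S} (e : Iso X Y) : e.hom.comp e.inv = Hom.id Y :=
  Hom.funext e.inv_hom

theorem Iso.inv_comp_hom {X Y : BiMod R S} (e : Iso X Y) : e.inv.comp e.hom = Hom.id X :=
  Hom.funext e.hom_inv

theorem Iso.bijective {X Y : BiMod R S} (e : Iso X Y) : Function.Bijective e.hom :=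
  ⟨Function.LeftInverse.injective e.hom_inv, Function.RightInverse.surjective e.inv_hom⟩

/-! ### Tensor products of maps -/

section TensorMaps

variable {X X' : BiMod R S} {Y Y' : BiMod S T}

@[simp] theorem pure_zero_left (y : Y) : pure (0 : X) y = 0 := by
  rw [← pureHom_apply, map_zero, AddMonoidHom.zero_apply]

@[simp] theorem pure_zero_right (x : X) : pure x (0 : Y) = 0 := by
  rw [← pureHom_apply, map_zero]

theorem tmap_comp_apply {X'' : BiMod R S} {Y'' : BiMod S T} (f : Hom X X') (g : Hom Y Y')
    (f' : Hom X' X'') (g' : Hom Y' Y'') (z : tensor X Y) :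
    tmap f' g' (tmap f g z) = tmap (f'.comp f) (g'.comp g) z :=
  DFunLike.congr_fun (tmap_comp f g f' g') z

@[simp] theorem tmap_id_apply (z : tensor X Y) : tmap (Hom.id X) (Hom.id Y) z = z :=
  DFunLike.congr_fun tmap_id z

theorem tmap_add_left (f f' : Hom X X') (g : Hom Y Y') :
    tmap (f + f') g = tmap f g + tmap f' g :=
  hom_ext fun _ _ => pure_add_left _ _ _

theorem tmap_sub_left (f f' : Hom X X') (g : Hom Y Y') :
    tmap (f - f') g = tmap f g - tmap f' g :=
  hom_ext fun x y => by
    change pureHom X' Y' (f x - f' x) (g y) = pureHom X' Y' (f x) (g y) - pureHom X' Y' (f' x) (g y)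
    rw [map_sub]; rfl

theorem tmap_sub_right (f : Hom X X') (g g' : Hom Y Y') :
    tmap f (g - g') = tmap f g - tmap f g' :=
  hom_ext fun x y => map_sub (pureHom X' Y' (f x)) (g y) (g' y)

@[simp] theorem tmap_zero_left (g : Hom Y Y') : tmap (0 : Hom X X') g = 0 :=
  hom_ext fun _ _ => pure_zero_left _

@[simp] theorem tmap_zero_right (f : Hom X X') : tmap f (0 : Hom Y Y') = 0 :=
  hom_ext fun _ _ => pure_zero_right _

theorem tmap_surjective {f : Hom X X'} {g : Hom Y Y'} (hf : Function.Surjective f)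
    (hg : Function.Surjective g) : Function.Surjective (tmap f g) := fun z => by
  induction z using pure_induction with
  | zero => exact ⟨0, map_zero _⟩
  | mk x y =>
    obtain ⟨x, rfl⟩ := hf x
    obtain ⟨y, rfl⟩ := hg y
    exact ⟨pure x y, rfl⟩
  | add a b ha hb =>
    obtain ⟨a, rfl⟩ := ha
    obtain ⟨b, rfl⟩ := hb
    exact ⟨a + b, map_add _ _ _⟩

theorem hom_ext₃ {Z : BiMod T U} {W : BiMod R U} {f g : Hom (tensor (tensor X Y) Z) W}
    (h : ∀ x y z, f (pure (pure x y) z) = g (pure (pure x y) z)) : f = g :=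
  hom_ext fun w z => by
    induction w using pure_induction with
    | zero => simp
    | mk x y => exact h x y z
    | add a b ha hb => rw [pure_add_left, map_add, map_add, ha, hb]

end TensorMaps

/-! ### Squares of twisted homomorphisms -/

section Squares

variable {X X' X'' : BiMod R R} {Y Y' Y'' : BiMod S S} {P P' P'' P''' Q Q' Q'' : BiMod R S}

/-- The square formed by `f : X ⊗ P' → P ⊗ Y`, `g : X' ⊗ Q' → Q ⊗ Y'` and the maps
`α : X → X'`, `β : Y → Y'`, `h' : P' → Q'`, `h : P → Q` commutes. -/
def Sq (α : Hom X X') (β : Hom Y Y') (h' : Hom P' Q') (h : Hom P Q)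
    (f : Hom (tensor X P') (tensor P Y)) (g : Hom (tensor X' Q') (tensor Q Y')) : Prop :=
  g.comp (tmap α h') = (tmap h β).comp f

theorem sq_iff {α : Hom X X'} {β : Hom Y Y'} {h' : Hom P' Q'} {h : Hom P Q}
    {f : Hom (tensor X P') (tensor P Y)} {g : Hom (tensor X' Q') (tensor Q Y')} :
    Sq α β h' h f g ↔ ∀ x p, g (pure (α x) (h' p)) = tmap h β (f (pure x p)) :=
  ⟨fun H x p => DFunLike.congr_fun H (pure x p), fun H => hom_ext H⟩

theorem Sq.apply {α : Hom X X'} {β : Hom Y Y'} {h' : Hom P' Q'} {h : Hom P Q}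
    {f : Hom (tensor X P') (tensor P Y)} {g : Hom (tensor X' Q') (tensor Q Y')}
    (H : Sq α β h' h f g) (z : tensor X P') : g (tmap α h' z) = tmap h β (f z) :=
  DFunLike.congr_fun H z

theorem Sq.refl (f : Hom (tensor X P') (tensor P Y)) :
    Sq (Hom.id X) (Hom.id Y) (Hom.id P') (Hom.id P) f f := by
  rw [Sq, tmap_id, tmap_id]; rfl

theorem Sq.trans {α : Hom X X'} {β : Hom Y Y'} {h' : Hom P' P''} {h : Hom P Q}
    {α' : Hom X' X''} {β' : Hom Y' Y''} {k' : Hom P'' P'''} {k : Hom Q Q'}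
    {f : Hom (tensor X P') (tensor P Y)} {g : Hom (tensor X' P'') (tensor Q Y')}
    {l : Hom (tensor X'' P''') (tensor Q' Y'')} (H : Sq α β h' h f g) (H' : Sq α' β' k' k g l) :
    Sq (α'.comp α) (β'.comp β) (k'.comp h') (k.comp h) f l :=
  sq_iff.2 fun x p => by
    have h1 := H'.apply (pure (α x) (h' p))
    have h2 := H.apply (pure x p)
    rw [tmap_pure] at h1 h2
    rw [Hom.comp_apply, Hom.comp_apply, h1, h2, tmap_comp_apply]

theorem Sq.trans_id {α : Hom X X'} {β : Hom Y Y'} {α' : Hom X' X''} {β' : Hom Y' Y''}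
    {f : Hom (tensor X P') (tensor P Y)} {g : Hom (tensor X' P') (tensor P Y')}
    {l : Hom (tensor X'' P') (tensor P Y'')} (H : Sq α β (Hom.id P') (Hom.id P) f g)
    (H' : Sq α' β' (Hom.id P') (Hom.id P) g l) :
    Sq (α'.comp α) (β'.comp β) (Hom.id P') (Hom.id P) f l := by
  have h := H.trans H'
  rwa [Hom.comp_id, Hom.comp_id] at h

theorem Sq.symm {α : Iso X X'} {β : Iso Y Y'} {h' : Iso P' Q'} {h : Iso P Q}
    {f : Hom (tensor X P') (tensor P Y)} {g : Hom (tensor X' Q') (tensor Q Y')}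
    (H : Sq α.hom β.hom h'.hom h.hom f g) : Sq α.inv β.inv h'.inv h.inv g f :=
  sq_iff.2 fun x p => by
    have h1 := H.apply (pure (α.inv x) (h'.inv p))
    rw [tmap_pure, α.inv_hom, h'.inv_hom] at h1
    rw [h1, tmap_comp_apply, h.inv_comp_hom, β.inv_comp_hom, tmap_id_apply]

/-- The map `z ↦ (f ⊗ 1)(x ⊗ z)`. -/
def stepMap (f : Hom (tensor X P') (tensor P Y)) (Y' : BiMod S S) (x : X) :
    tensor P' Y' →+ tensor P (tensor Y Y') :=
  ((assoc P Y Y').hom.comp ((tmap f (Hom.id Y')).comp (assoc X P' Y').inv)).toFun.comp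
    (pureHom X (tensor P' Y') x)

theorem stepMap_pure (f : Hom (tensor X P') (tensor P Y)) (x : X) (p : P') (y : Y') :
    stepMap f Y' x (pure p y) = assocAux P Y Y' (f (pure x p)) y := rfl

theorem composeStep_pure (f : Hom (tensor X P') (tensor P Y)) (g : Hom (tensor X' P'') (tensor P' Y'))
    (x : X) (x' : X') (p : P'') :
    composeStep f g (pure (pure x x') p) = stepMap f Y' x (g (pure x' p)) := rfl

theorem assocAux_tmap {Z Z' : BiMod S S} (h : Hom P Q) (β : Hom Y Y') (γ : Hom Z Z')
    (w : tensor P Y) (z : Z) :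
    assocAux Q Y' Z' (tmap h β w) (γ z) = tmap h (tmap β γ) (assocAux P Y Z w z) := by
  induction w using pure_induction with
  | zero => simp
  | mk x y => rfl
  | add a b ha hb => simp only [map_add, AddMonoidHom.add_apply, ha, hb]

/-- Squares paste along the middle object P' → Q'. Unlike `Intertwines.step`, the coefficient
bimodules may change as well, which is what comparison over associators and unitors requires. -/
theorem Sq.step {X₁ X₁' : BiMod R R} {Y₁ Y₁' : BiMod S S} {α : Hom X X'} {β : Hom Y Y'}
    {α₁ : Hom X₁ X₁'} {β₁ : Hom Y₁ Y₁'} {h'' : Hom P'' Q''} {h' : Hom P' Q'} {h : Hom P Q}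
    {f : Hom (tensor X P') (tensor P Y)} {g : Hom (tensor X' Q') (tensor Q Y')}
    {f₁ : Hom (tensor X₁ P'') (tensor P' Y₁)} {g₁ : Hom (tensor X₁' Q'') (tensor Q' Y₁')}
    (H : Sq α β h' h f g) (H₁ : Sq α₁ β₁ h'' h' f₁ g₁) :
    Sq (tmap α α₁) (tmap β β₁) h'' h (composeStep f f₁) (composeStep g g₁) := by
  refine hom_ext₃ fun x x₁ p => ?_
  rw [Hom.comp_apply, Hom.comp_apply, tmap_pure, tmap_pure, composeStep_pure, composeStep_pure]
  have h1 := H₁.apply (pure x₁ p)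
  rw [tmap_pure] at h1
  rw [h1]
  generalize f₁ (pure x₁ p) = z
  induction z using pure_induction with
  | zero => simp
  | mk p' y' =>
    have h2 := H.apply (pure x p')
    rw [tmap_pure] at h2
    rw [tmap_pure, stepMap_pure, stepMap_pure, h2, assocAux_tmap]
  | add a b ha hb => simp only [map_add, ha, hb]

/-- The two bracketings involve the same three maps and differ only by associators of the
coefficients. The value of h, g or f on a pure tensor need not be pure, so each value is generalized
and expanded in turn, innermost map first. -/
theorem composeStep_assoc (f : Hom (tensor X P') (tensor P Y))
    (g : Hom (tensor X' P'') (tensor P' Y')) (h : Hom (tensor X'' P''') (tensor P'' Y'')) :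
    Sq (assoc X X' X'').hom (assoc Y Y' Y'').hom (Hom.id P''') (Hom.id P)
      (composeStep (composeStep f g) h) (composeStep f (composeStep g h)) := by
  refine hom_ext₃ fun w x'' p => ?_
  induction w using pure_induction with
  | zero => simp only [pure_zero_left, map_zero]
  | mk x x' =>
    change stepMap f (tensor Y' Y'') x (stepMap g Y'' x' (h (pure x'' p))) =
      tmap (Hom.id P) (assoc Y Y' Y'').hom
        (stepMap (composeStep f g) Y'' (pure x x') (h (pure x'' p)))
    generalize h (pure x'' p) = z
    induction z using pure_induction with
    | zero => simp only [map_zero]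
    | mk p'' y'' =>
      rw [stepMap_pure, stepMap_pure, composeStep_pure]
      generalize g (pure x' p'') = z'
      induction z' using pure_induction with
      | zero => simp only [map_zero, AddMonoidHom.zero_apply]
      | mk p' y' =>
        rw [assocAux_pure, stepMap_pure, stepMap_pure]
        generalize f (pure x p') = z''
        induction z'' using pure_induction with
        | zero => simp only [map_zero, AddMonoidHom.zero_apply]
        | mk p y => rfl
        | add a b ha hb => simp only [map_add, AddMonoidHom.add_apply, ha, hb]
      | add a b ha hb => simp only [map_add, AddMonoidHom.add_apply, ha, hb]
    | add a b ha hb => simp only [map_add, ha, hb]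
  | add a b ha hb => simp only [pure_add_left, map_add, ha, hb]

theorem composeNil_apply (r : unit R) (p : P) :
    composeNil P (pure r p) = pure (ofUnit R r • p) (toUnit S 1) := rfl

theorem composeStep_nil_left (g : Hom (tensor X P') (tensor P Y)) :
    Sq (lunit X).hom (lunit Y).hom (Hom.id P') (Hom.id P) (composeStep (composeNil P) g) g := by
  refine hom_ext₃ fun r x p => ?_
  change g (pure (ofUnit R r • x) p) = tmap (Hom.id P) (lunit Y).hom
    (stepMap (composeNil P) Y r (g (pure x p)))
  rw [← smul_pure, g.smul_left]
  generalize g (pure x p) = z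
  induction z using pure_induction with
  | zero => simp
  | mk p' y =>
    rw [stepMap_pure, composeNil_apply, assocAux_pure, tmap_pure, lunit_hom_pure, ofUnit_toUnit,
      one_smul]
    rfl
  | add a b ha hb => simp only [smul_add, map_add, ha, hb]

theorem composeStep_nil_right (g : Hom (tensor X P') (tensor P Y)) :
    Sq (runit X).hom (runit Y).hom (Hom.id P') (Hom.id P) (composeStep g (composeNil P')) g := by
  refine hom_ext₃ fun x r p => ?_
  change g (pure (op (ofUnit R r) • x) p) = tmap (Hom.id P) (runit Y).hom
    (assocAux P Y (unit S) (g (pure x (ofUnit R r • p))) (toUnit S 1))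
  rw [pure_balanced]
  generalize g (pure x _) = z
  induction z using pure_induction with
  | zero => simp
  | mk p' y =>
    rw [assocAux_pure, tmap_pure, runit_hom_pure, ofUnit_toUnit, op_one, one_smul]
    rfl
  | add a b ha hb => simp only [map_add, AddMonoidHom.add_apply, ← ha, ← hb]

end Squares

end BiMod

/-! ### Paths of twisted homomorphisms and their composites -/

section Paths

variable {R S : Type u} [Ring R] [Ring S]

theorem Intertwines.trans {M : BiMod R R} {N : BiMod S S} {P P' Q Q' V V' : BiMod R S}
    {f : Hom (tensor M P') (tensor P N)} {g : Hom (tensor M Q') (tensor Q N)}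
    {l : Hom (tensor M V') (tensor V N)} {h' : Hom P' Q'} {h : Hom P Q} {k' : Hom Q' V'}
    {k : Hom Q V} (H : Intertwines f g h' h) (H' : Intertwines g l k' k) :
    Intertwines f l (k'.comp h') (k.comp h) := by
  have h1 : Sq (Hom.id M) (Hom.id N) (k'.comp h') (k.comp h) f l := by
    have h2 := Sq.trans (α := Hom.id M) (β := Hom.id N) (α' := Hom.id M) (β' := Hom.id N) H H'
    rwa [Hom.comp_id, Hom.comp_id] at h2
  exact h1

/-- A sequence of `n` composable twisted homomorphisms `M ⊗ P_{k+1} → P_k ⊗ N`, starting at `P_0`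
and ending at `P_n`. -/
inductive TwistedPath (M : BiMod R R) (N : BiMod S S) : ℕ → BiMod R S → BiMod R S → Type (u + 1)
  | nil (P : BiMod R S) : TwistedPath M N 0 P P
  | cons {n : ℕ} {P P' P'' : BiMod R S} (f : Hom (tensor M P') (tensor P N))
      (p : TwistedPath M N n P' P'') : TwistedPath M N (n + 1) P P''

theorem powAdd_succ_hom (M : BiMod R R) (a b : ℕ) :
    (powAdd M (a + 1) b).hom =
      (tmap (Hom.id M) (powAdd M a b).hom).comp (assoc M (pow M a) (pow M b)).hom := rfl

theorem powSnoc_succ_hom (M : BiMod R R) (n : ℕ) :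
    (powSnoc M (n + 1)).hom =
      (tmap (Hom.id M) (powSnoc M n).hom).comp (assoc M (pow M n) M).hom := rfl

theorem powMul_succ_hom (M : BiMod R R) (n k : ℕ) :
    (powMul M n (k + 1)).hom =
      (powAdd M n (n * k)).hom.comp (tmap (Hom.id (pow M n)) (powMul M n k).hom) := rfl

namespace TwistedPath

variable {M : BiMod R R} {N : BiMod S S}

/-- The composite `M^{⊗ n} ⊗ P_n → P_0 ⊗ N^{⊗ n}` of a path. -/
def eval : ∀ {n : ℕ} {P Q : BiMod R S}, TwistedPath M N n P Q →
    Hom (tensor (pow M n) Q) (tensor P (pow N n))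
  | _, _, _, nil P => composeNil P
  | _, _, _, cons f p => composeStep f p.eval

/-- Concatenation of paths. -/
def append : ∀ {a b : ℕ} {P Q Q' : BiMod R S}, TwistedPath M N a P Q → TwistedPath M N b Q Q' →
    TwistedPath M N (b + a) P Q'
  | _, _, _, _, _, nil _, q => q
  | _, _, _, _, _, cons f p, q => cons f (p.append q)

/-- Extension of a path by one homomorphism at its end. -/
def snoc : ∀ {n : ℕ} {P Q Q' : BiMod R S}, TwistedPath M N n P Q →
    Hom (tensor M Q') (tensor Q N) → TwistedPath M N (n + 1) P Q'
  | _, _, _, _, nil _, f => cons f (nil _)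
  | _, _, _, _, cons g p, f => cons g (p.snoc f)

theorem eval_cons {n : ℕ} {P P' P'' : BiMod R S} (f : Hom (tensor M P') (tensor P N))
    (p : TwistedPath M N n P' P'') : (cons f p).eval = composeStep f p.eval := rfl

theorem append_cons {a b : ℕ} {P P' Q Q' : BiMod R S} (f : Hom (tensor M P') (tensor P N))
    (p : TwistedPath M N a P' Q) (q : TwistedPath M N b Q Q') :
    (cons f p).append q = cons f (p.append q) := rfl

theorem snoc_cons {n : ℕ} {P P' Q Q' : BiMod R S} (g : Hom (tensor M P') (tensor P N))
    (p : TwistedPath M N n P' Q) (f : Hom (tensor M Q') (tensor Q N)) :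
    (cons g p).snoc f = cons g (p.snoc f) := rfl

/-- The left unit law and associativity of composition give the two cases. The length is `b + a`
because both `append` and `powAdd` recurse on their first argument, so lengths match by definition.
-/
theorem eval_append {a b : ℕ} {P Q Q' : BiMod R S} (p : TwistedPath M N a P Q)
    (q : TwistedPath M N b Q Q') :
    Sq (powAdd M a b).hom (powAdd N a b).hom (Hom.id Q') (Hom.id P)
      (composeStep p.eval q.eval) (p.append q).eval := by
  induction p with
  | nil P => exact composeStep_nil_left q.eval
  | @cons a P P' P'' f p ih =>
    rw [append_cons, eval_cons, eval_cons, powAdd_succ_hom, powAdd_succ_hom]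
    exact (composeStep_assoc f p.eval q.eval).trans_id ((Sq.refl f).step (ih q))

/-- The version of `eval_append` for a single map on the right, phrased with `powSnoc` because the
rotation of shadows is defined through it. In the base case the left unit law is followed by the
inverse of the right one. -/
theorem eval_snoc {n : ℕ} {P Q Q' : BiMod R S} (p : TwistedPath M N n P Q)
    (f : Hom (tensor M Q') (tensor Q N)) :
    Sq (powSnoc M n).hom (powSnoc N n).hom (Hom.id Q') (Hom.id P)
      (composeStep p.eval f) (p.snoc f).eval := by
  induction p with
  | nil P =>
    exact (composeStep_nil_left f).trans_id
      (Sq.symm (α := runit M) (β := runit N) (h' := Iso.refl _) (h := Iso.refl _)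
        (composeStep_nil_right f))
  | @cons n P P' P'' g p ih =>
    rw [snoc_cons, eval_cons, eval_cons, powSnoc_succ_hom, powSnoc_succ_hom]
    exact (composeStep_assoc g p.eval f).trans_id ((Sq.refl g).step (ih f))

/-- A map between two paths of the same length, with the given maps at the start and at the
end. -/
inductive Map : ∀ {n : ℕ} {P P' Q Q' : BiMod R S}, TwistedPath M N n P P' →
    TwistedPath M N n Q Q' → Hom P Q → Hom P' Q' → Prop
  | nil {P Q : BiMod R S} (h : Hom P Q) : Map (nil P) (nil Q) h h
  | cons {n : ℕ} {P P' P'' Q Q' Q'' : BiMod R S} {f : Hom (tensor M P') (tensor P N)}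
      {g : Hom (tensor M Q') (tensor Q N)} {p : TwistedPath M N n P' P''}
      {q : TwistedPath M N n Q' Q''} {h : Hom P Q} {h' : Hom P' Q'} {h'' : Hom P'' Q''}
      (H : Intertwines f g h' h) (H' : Map p q h' h'') : Map (cons f p) (cons g q) h h''

/-- Squares paste along the whole path, so only the maps at the two ends survive. Every later
comparison of composites is obtained by exhibiting a `Map` of paths. -/
theorem Map.intertwines {n : ℕ} {P P' Q Q' : BiMod R S} {p : TwistedPath M N n P P'}
    {q : TwistedPath M N n Q Q'} {h : Hom P Q} {h' : Hom P' Q'} (H : Map p q h h') :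
    Intertwines p.eval q.eval h' h := by
  induction H with
  | nil h => exact composeNil_natural h
  | cons H _ ih => exact H.step ih

section System

variable {I : Type} (s : I → I) (c : I → BiMod R S)
  (f : ∀ i, Hom (tensor M (c (s i))) (tensor (c i) N))

/-- The path of length `n` from `i` to `j = s^n i` in a family `f_i : M ⊗ c_{s i} → c_i ⊗ N`. -/
def iter : ∀ (n : ℕ) (i j : I), s^[n] i = j → TwistedPath M N n (c i) (c j)
  | 0, i, _, h => h ▸ nil (c i)
  | n + 1, i, j, h => cons (f i) (iter n (s i) j h)

theorem iter_succ (n : ℕ) (i j : I) (h : s^[n + 1] i = j) :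
    iter s c f (n + 1) i j h = cons (f i) (iter s c f n (s i) j h) := rfl

theorem iter_append {a b : ℕ} {i j k : I} (h : s^[a] i = j) (h' : s^[b] j = k) :
    (iter s c f a i j h).append (iter s c f b j k h') =
      iter s c f (b + a) i k (by rw [Function.iterate_add_apply, h, h']) := by
  induction a generalizing i with
  | zero =>
    obtain rfl : i = j := h
    rfl
  | succ a ih => exact congrArg (cons (f i)) (ih h)

theorem iter_snoc {n : ℕ} {i j : I} (h : s^[n] i = j) :
    (iter s c f n i j h).snoc (f j) =
      iter s c f (n + 1) i (s j) (by rw [Function.iterate_succ_apply', h]) := by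
  induction n generalizing i with
  | zero =>
    obtain rfl : i = j := h
    rfl
  | succ n ih => exact congrArg (cons (f i)) (ih h)

/-- The composite of `k` blocks of length `n` is the composite of length `n * k`. -/
theorem eval_iter_mul {I' : Type} (s' : I' → I') (ι : I' → I) (n : ℕ)
    (hι : ∀ j, s^[n] (ι j) = ι (s' j)) (k : ℕ) (i j : I') (h : s'^[k] i = j)
    (h' : s^[n * k] (ι i) = ι j) :
    Sq (powMul M n k).hom (powMul N n k).hom (Hom.id (c (ι j))) (Hom.id (c (ι i)))
      (iter s' (fun j => c (ι j)) (fun j => (iter s c f n (ι j) (ι (s' j)) (hι j)).eval) k i j h).eval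
      (iter s c f (n * k) (ι i) (ι j) h').eval := by
  induction k generalizing i with
  | zero =>
    obtain rfl : i = j := h
    exact Sq.refl _
  | succ k ih =>
    have e : s^[n * k] (ι (s' i)) = ι j := by
      rw [← hι, ← Function.iterate_add_apply]; exact h'
    -- First regroup the remaining k blocks by induction, keeping the leading block; then
    -- concatenate that block with the regrouped rest.
    have h1 := (Sq.refl (iter s c f n (ι i) (ι (s' i)) (hι i)).eval).step (ih (s' i) h e)
    have h2 := eval_append (iter s c f n (ι i) (ι (s' i)) (hι i)) (iter s c f (n * k) _ _ e)
    rw [iter_append] at h2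
    rw [powMul_succ_hom, powMul_succ_hom, iter_succ, eval_cons]
    exact h1.trans_id h2

end System

theorem eval_iter {I : Type} (s : I → I) (c : I → ModC R S)
    (f : ∀ i, Hom (tensor M (c (s i)).mod) (tensor (c i).mod N)) (n : ℕ) (i j : I)
    (h : s^[n] i = j) :
    (iter s (fun i => (c i).mod) f n i j h).eval =
      (compose s (fun i => (c i).mod) f n i).comp
        (tmap (Hom.id (pow M n)) (ModC.homOfEq (congrArg c h.symm))) := by
  subst h
  have h1 : tmap (Hom.id (pow M n)) (ModC.homOfEq (congrArg c (Eq.refl (s^[n] i)))) = Hom.id _ :=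
    tmap_id
  rw [h1, Hom.comp_id]
  induction n generalizing i with
  | zero => rfl
  | succ n ih => exact congrArg (composeStep (f i)) (ih (s i) tmap_id)

end TwistedPath

variable {M : BiMod R R} {N : BiMod S S}

/-- The path of length `k` from `i` to `j` in a cyclic tuple. -/
def CycObj.path {n : ℕ} [NeZero n] (A : CycObj M N n) (k : ℕ) (i j : Fin n)
    (h : (fun j : Fin n => j + 1)^[k] i = j) : TwistedPath M N k (A.c i).mod (A.c j).mod :=
  TwistedPath.iter (fun j : Fin n => j + 1) (fun j => (A.c j).mod) A.f k i j h

/-- Γ becomes the evaluation of a closed path. The transport along `succ_iterate` in `gammaHom` is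
absorbed into the endpoint of the path and does not appear again. -/
theorem CycObj.gammaHom_eq {n : ℕ} [NeZero n] (A : CycObj M N n) :
    A.gammaHom = (A.path n 0 0 (succ_iterate n)).eval :=
  (TwistedPath.eval_iter _ _ _ _ _ _ _).symm

theorem fin_succ_iterate (n : ℕ) [NeZero n] (k : ℕ) (i : Fin n) :
    (fun j : Fin n => j + 1)^[k] i = i + Fin.ofNat n k := by
  induction k with
  | zero =>
    ext
    simp
  | succ k ih =>
    rw [Function.iterate_succ_apply', ih]
    ext
    simp [Fin.val_add, Nat.add_assoc]

end Paths

/-! ### Relations in reduced `K`-theory -/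

namespace BiMod

variable {R S : Type u} [Ring R] [Ring S]

/-- The direct sum of two bimodules. -/
def prod (X Y : BiMod R S) : BiMod R S := ⟨X × Y⟩

/-- The first inclusion. -/
def inl (X Y : BiMod R S) : Hom X (prod X Y) where
  toFun := AddMonoidHom.inl X Y
  map_left r _ := Prod.ext rfl (smul_zero r).symm
  map_right s _ := Prod.ext rfl (smul_zero (op s)).symm

/-- The second inclusion. -/
def inr (X Y : BiMod R S) : Hom Y (prod X Y) where
  toFun := AddMonoidHom.inr X Y
  map_left r _ := Prod.ext (smul_zero r).symm rfl
  map_right s _ := Prod.ext (smul_zero (op s)).symm rfl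

/-- The first projection. -/
def fst (X Y : BiMod R S) : Hom (prod X Y) X where
  toFun := AddMonoidHom.fst X Y
  map_left _ _ := rfl
  map_right _ _ := rfl

/-- The second projection. -/
def snd (X Y : BiMod R S) : Hom (prod X Y) Y where
  toFun := AddMonoidHom.snd X Y
  map_left _ _ := rfl
  map_right _ _ := rfl

theorem IsFGP.prod {X Y : BiMod R S} (hX : X.IsFGP) (hY : Y.IsFGP) : (prod X Y).IsFGP where
  finite := by
    have := hX.finite
    have := hY.finite
    exact (inferInstance : Module.Finite Sᵐᵒᵖ (X × Y))
  projective := by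
    have := hX.projective
    have := hY.projective
    exact (inferInstance : Module.Projective Sᵐᵒᵖ (X × Y))

theorem IsFGP.of_iso {X Y : BiMod R S} (e : Iso X Y) (hX : X.IsFGP) : Y.IsFGP := by
  let e' : X ≃ₗ[Sᵐᵒᵖ] Y :=
    LinearEquiv.ofLinearMap e.hom.right e.inv.right (LinearMap.ext e.inv_hom)
      (LinearMap.ext e.hom_inv)
  have := hX.finite
  have := hX.projective
  exact ⟨Module.Finite.equiv e', Module.Projective.of_equiv e'⟩

/-- The zero bimodule. -/
def trivial (R S : Type u) [Ring R] [Ring S] : BiMod R S := ⟨PUnit⟩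

theorem trivial_fgp : (trivial R S).IsFGP where
  finite := (inferInstance : Module.Finite Sᵐᵒᵖ PUnit.{u + 1})
  projective := (inferInstance : Module.Projective Sᵐᵒᵖ PUnit.{u + 1})

theorem shortExact_of_bijective {X Y : BiMod R S} {f : Hom X Y} (hf : Function.Bijective f) :
    ShortExact f (0 : Hom Y (trivial R S)) where
  injective := hf.1
  surjective _ := ⟨0, rfl⟩
  exact y := ⟨fun _ => hf.2 y, fun _ => rfl⟩

/-- The graph of h embeds X in X ⊕ Y, and (x, y) ↦ y - h x is the quotient by it. -/
theorem shortExact_graph {X Y : BiMod R S} (h : Hom X Y) :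
    ShortExact (inl X Y + (inr X Y).comp h) (snd X Y - h.comp (fst X Y)) where
  injective x y hxy := by
    have h1 : x + 0 = y + 0 := congrArg Prod.fst hxy
    simpa using h1
  surjective y := ⟨inr X Y y, by
    change y - h 0 = y
    rw [map_zero, sub_zero]⟩
  exact z := by
    obtain ⟨x, y⟩ := z
    constructor
    · intro hz
      exact ⟨x, Prod.ext (add_zero x) ((zero_add _).trans (sub_eq_zero.1 hz).symm)⟩
    · rintro ⟨x', hx⟩
      obtain ⟨rfl, rfl⟩ := Prod.ext_iff.1 hx
      change (0 + h x') - h (x' + 0) = 0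
      rw [zero_add, add_zero, sub_self]

theorem shortExact_inl_snd (X Y : BiMod R S) : ShortExact (inl X Y) (snd X Y) where
  injective x y hxy := congrArg Prod.fst hxy
  surjective y := ⟨inr X Y y, rfl⟩
  exact z := by
    obtain ⟨x, y⟩ := z
    constructor
    · intro hz
      exact ⟨x, Prod.ext rfl (Eq.symm hz)⟩
    · rintro ⟨x', hx⟩
      exact (congrArg Prod.snd hx).symm

end BiMod

section Relations

variable {R S : Type u} [Ring R] [Ring S] {M : BiMod R R} {N : BiMod S S}

/-- The direct sum in `Mod^c_{R,S}`. -/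
def ModC.prod (P Q : ModC R S) : ModC R S := ⟨BiMod.prod P.mod Q.mod, P.fgp.prod Q.fgp⟩

/-- The zero object of `Mod^c_{R,S}`. -/
def ModC.trivial (R S : Type u) [Ring R] [Ring S] : ModC R S := ⟨BiMod.trivial R S, trivial_fgp⟩

theorem KTilde.cls_eq {A B C : EndObj M N} (h : EndObj.Ses A B C) :
    KTilde.cls B = KTilde.cls A + KTilde.cls C := K0Red.cls_eq h

theorem KTildeCyc.cls_eq {n : ℕ} [NeZero n] {A B C : CycObj M N n} (h : CycObj.Ses A B C) :
    KTildeCyc.cls B = KTildeCyc.cls A + KTildeCyc.cls C := K0Red.cls_eq h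

theorem KTildeCyc.cls_zero {n : ℕ} [NeZero n] (c : Fin n → ModC R S) :
    KTildeCyc.cls (CycObj.zero M N n c) = 0 := K0Red.cls_zero c

/-- An isomorphism is a short exact sequence with quotient the zero bimodule, whose only twisted
endomorphism is a zero map and so dies in the reduced group. -/
theorem KTilde.cls_eq_of_bijective {A B : EndObj M N} (h : Hom A.P.mod B.P.mod)
    (hh : Intertwines A.f B.f h h) (hb : Function.Bijective h) :
    KTilde.cls A = KTilde.cls B := by
  have h1 : EndObj.Ses A B (EndObj.zero M N (ModC.trivial R S)) :=
    ⟨h, 0, hh, by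
      rw [Intertwines, tmap_zero_left]; rfl, shortExact_of_bijective hb⟩
  have h2 : KTilde.cls (EndObj.zero M N (ModC.trivial R S)) = 0 :=
    K0Red.cls_zero (hz := EndObj.zero_ses M N) _
  rw [KTilde.cls_eq h1, h2, add_zero]

theorem K0Red.induction {Ob Z : Type v} {ses : Ob → Ob → Ob → Prop} {zses : Z → Z → Z → Prop}
    {zero : Z → Ob} {hz : ∀ A B C, zses A B C → ses (zero A) (zero B) (zero C)}
    {p : K0Red (ses := ses) (zses := zses) zero hz → Prop} (x : K0Red zero hz)
    (h0 : p 0) (hcls : ∀ A, p (K0Red.cls hz A)) (hneg : ∀ x, p x → p (-x))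
    (hadd : ∀ x y, p x → p y → p (x + y)) : p x := by
  obtain ⟨x, rfl⟩ := QuotientAddGroup.mk_surjective x
  obtain ⟨x, rfl⟩ := QuotientAddGroup.mk_surjective x
  induction x using FreeAbelianGroup.induction_on with
  | zero => exact h0
  | of A => exact hcls A
  | neg A h => exact hneg _ h
  | add x y hx hy => exact hadd _ _ hx hy

/-! ### Relations between classes of cyclic tuples -/

section Cyc

variable {n : ℕ} [NeZero n]

open Classical in
/-- The family obtained from `f` by replacing the maps `f_j` with `j ∈ J` by zero. -/
noncomputable def zeroOn {c : Fin n → ModC R S}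
    (f : ∀ j, Hom (tensor M (c (j + 1)).mod) (tensor (c j).mod N)) (J : Set (Fin n)) (j : Fin n) :
    Hom (tensor M (c (j + 1)).mod) (tensor (c j).mod N) :=
  if j ∈ J then 0 else f j

theorem zeroOn_of_mem {c : Fin n → ModC R S}
    (f : ∀ j, Hom (tensor M (c (j + 1)).mod) (tensor (c j).mod N)) {J : Set (Fin n)} {j : Fin n}
    (hj : j ∈ J) : zeroOn f J j = 0 := if_pos hj

theorem zeroOn_of_notMem {c : Fin n → ModC R S}
    (f : ∀ j, Hom (tensor M (c (j + 1)).mod) (tensor (c j).mod N)) {J : Set (Fin n)} {j : Fin n}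
    (hj : j ∉ J) : zeroOn f J j = f j := if_neg hj

theorem tmap_graph_sub {X Y : BiMod R S} (h : Hom X Y) (w : tensor X N) (w' : tensor Y N) :
    tmap (snd X Y - h.comp (fst X Y)) (Hom.id N)
      (tmap (inl X Y) (Hom.id N) w + tmap (inr X Y) (Hom.id N) w') =
        w' - tmap h (Hom.id N) w := by
  have h1 : (snd X Y - h.comp (fst X Y)).comp (inl X Y) = 0 - h := rfl
  have h2 : (snd X Y - h.comp (fst X Y)).comp (inr X Y) = Hom.id Y :=
    Hom.funext fun y => by
      change y - h 0 = y
      rw [map_zero, sub_zero]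
  rw [map_add, tmap_comp_apply, tmap_comp_apply, h1, h2, Hom.id_comp, tmap_sub_left,
    tmap_zero_left, tmap_id_apply, Hom.sub_apply, Hom.zero_apply]
  abel

section Cone

variable {P P' Q Q' : BiMod R S} (G : Hom (tensor M (BiMod.prod P' Q')) (tensor P N))
  (b : Hom (tensor M Q') (tensor Q N))

/-- The map `M ⊗ (P' ⊕ Q') → (P ⊕ Q) ⊗ N` with components `G` and `b`. -/
def coneHom : Hom (tensor M (BiMod.prod P' Q')) (tensor (BiMod.prod P Q) N) :=
  (tmap (inl P Q) (Hom.id N)).comp G +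
    (tmap (inr P Q) (Hom.id N)).comp (b.comp (tmap (Hom.id M) (snd P' Q')))

theorem coneHom_apply (z : tensor M (BiMod.prod P' Q')) : coneHom G b z =
    tmap (inl P Q) (Hom.id N) (G z) +
      tmap (inr P Q) (Hom.id N) (b (tmap (Hom.id M) (snd P' Q') z)) := rfl

theorem coneHom_graph {a : Hom (tensor M P') (tensor P N)} {h' : Hom P' Q'} {h : Hom P Q}
    (hG : G.comp (tmap (Hom.id M) (inl P' Q' + (inr P' Q').comp h')) = a)
    (hab : Intertwines a b h' h) :
    Intertwines a (coneHom G b) (inl P' Q' + (inr P' Q').comp h') (inl P Q + (inr P Q).comp h) := by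
  refine Hom.funext fun z => ?_
  have e1 : (snd P' Q').comp (inl P' Q' + (inr P' Q').comp h') = h' :=
    Hom.funext fun x => zero_add (h' x)
  have e2 := DFunLike.congr_fun hG z
  have e3 := DFunLike.congr_fun hab z
  simp only [Hom.comp_apply] at e2 e3
  rw [Hom.comp_apply, Hom.comp_apply, coneHom_apply, e2, tmap_comp_apply, e1, Hom.comp_id, e3,
    tmap_add_left, Hom.add_apply, tmap_comp_apply, Hom.comp_id]

theorem coneHom_sub {b' : Hom (tensor M Q') (tensor Q N)} {h' : Hom P' Q'} {h : Hom P Q}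
    (hb : ∀ z, b' (tmap (Hom.id M) (snd P' Q' - h'.comp (fst P' Q')) z) =
      b (tmap (Hom.id M) (snd P' Q') z) - tmap h (Hom.id N) (G z)) :
    Intertwines (coneHom G b) b' (snd P' Q' - h'.comp (fst P' Q'))
      (snd P Q - h.comp (fst P Q)) := by
  refine Hom.funext fun z => ?_
  rw [Hom.comp_apply, Hom.comp_apply, coneHom_apply, tmap_graph_sub, hb]

theorem coneHom_inl {a : Hom (tensor M P') (tensor P N)}
    (hG : G.comp (tmap (Hom.id M) (inl P' Q')) = a) :
    Intertwines a (coneHom G b) (inl P' Q') (inl P Q) := by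
  refine Hom.funext fun z => ?_
  have e1 : (snd P' Q').comp (inl P' Q') = 0 := rfl
  have e2 := DFunLike.congr_fun hG z
  rw [Hom.comp_apply] at e2
  rw [Hom.comp_apply, Hom.comp_apply, coneHom_apply, e2, tmap_comp_apply, e1, tmap_zero_right,
    Hom.zero_apply, map_zero, map_zero, add_zero]

theorem coneHom_snd : Intertwines (coneHom G b) b (snd P' Q') (snd P Q) := by
  refine Hom.funext fun z => ?_
  have e1 : (snd P Q).comp (inl P Q) = 0 := rfl
  have e2 : (snd P Q).comp (inr P Q) = Hom.id Q := rfl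
  rw [Hom.comp_apply, Hom.comp_apply, coneHom_apply, map_add, tmap_comp_apply, tmap_comp_apply,
    e1, e2, tmap_zero_left, Hom.comp_id, tmap_id_apply, Hom.zero_apply, zero_add]

end Cone

variable {c d : Fin n → ModC R S}
  {a a' : ∀ j, Hom (tensor M (c (j + 1)).mod) (tensor (c j).mod N)}
  {b b' : ∀ j, Hom (tensor M (d (j + 1)).mod) (tensor (d j).mod N)}

/-- The tuple `coneHom` on c ⊕ d has (c, a) as subobject along the graph of h, with quotient (d,
b'), and (c, a') as subobject along the first inclusion, with quotient (d, b). Both extensions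
compute the class of the same tuple. The hypotheses on G say exactly that these sub- and quotient
structures are the stated ones. -/
theorem KTildeCyc.cls_add_cls (h : ∀ j, Hom (c j).mod (d j).mod)
    (hab : ∀ j, Intertwines (a j) (b j) (h (j + 1)) (h j))
    (G : ∀ j, Hom (tensor M (BiMod.prod (c (j + 1)).mod (d (j + 1)).mod)) (tensor (c j).mod N))
    (ha : ∀ j, (G j).comp (tmap (Hom.id M) (inl (c (j + 1)).mod (d (j + 1)).mod +
      (inr (c (j + 1)).mod (d (j + 1)).mod).comp (h (j + 1)))) = a j)
    (hb' : ∀ j z, b' j (tmap (Hom.id M) (snd (c (j + 1)).mod (d (j + 1)).mod -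
      (h (j + 1)).comp (fst (c (j + 1)).mod (d (j + 1)).mod)) z) =
      b j (tmap (Hom.id M) (snd (c (j + 1)).mod (d (j + 1)).mod) z) - tmap (h j) (Hom.id N) (G j z))
    (ha' : ∀ j, (G j).comp (tmap (Hom.id M) (inl (c (j + 1)).mod (d (j + 1)).mod)) = a' j) :
    KTildeCyc.cls ⟨c, a⟩ + KTildeCyc.cls ⟨d, b'⟩ = KTildeCyc.cls ⟨c, a'⟩ + KTildeCyc.cls ⟨d, b⟩ := by
  have h3 := fun j => coneHom_graph (G j) (b j) (ha j) (hab j)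
  have h4 := fun j => coneHom_sub (G j) (b j) (b' := b' j) (h' := h (j + 1)) (h := h j) (hb' j)
  have h1 : CycObj.Ses ⟨c, a⟩ ⟨fun j => (c j).prod (d j), fun j => coneHom (G j) (b j)⟩
      ⟨d, b'⟩ := by
    refine ⟨fun j => inl _ _ + (inr _ _).comp (h j), fun j => snd _ _ - (h j).comp (fst _ _),
      fun j => ?_, fun j => ?_, fun j => ?_⟩
    · exact h3 j
    · exact h4 j
    · exact shortExact_graph (h j)
  have h2 : CycObj.Ses ⟨c, a'⟩ ⟨fun j => (c j).prod (d j), fun j => coneHom (G j) (b j)⟩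
      ⟨d, b⟩ := by
    refine ⟨fun j => inl _ _, fun j => snd _ _, fun j => ?_, fun j => ?_, fun j => ?_⟩
    · exact coneHom_inl (G j) (b j) (ha' j)
    · exact coneHom_snd (G j) (b j)
    · exact shortExact_inl_snd _ _
  rw [← KTildeCyc.cls_eq h1, ← KTildeCyc.cls_eq h2]

theorem snd_comp_graph {P Q : BiMod R S} (h : Hom P Q) :
    (snd P Q).comp (inl P Q + (inr P Q).comp h) = h := Hom.funext fun _ => zero_add _

theorem fst_comp_graph {P Q : BiMod R S} (h : Hom P Q) :
    (fst P Q).comp (inl P Q + (inr P Q).comp h) = Hom.id P := Hom.funext fun _ => add_zero _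

theorem snd_comp_inl {P Q : BiMod R S} : (snd P Q).comp (inl P Q) = 0 := rfl

theorem fst_comp_inl {P Q : BiMod R S} : (fst P Q).comp (inl P Q) = Hom.id P := rfl

/-- At the indices in J the map F is a diagonal filler of the square from a to b over h. A filler
allows the maps at these indices to be cut from the quotient d and from the subobject c
simultaneously. -/
theorem KTildeCyc.cls_add_zeroOn (J : Set (Fin n)) (h : ∀ j, Hom (c j).mod (d j).mod)
    (F : ∀ j, Hom (tensor M (d (j + 1)).mod) (tensor (c j).mod N))
    (hJ : ∀ j ∉ J, Intertwines (a j) (b j) (h (j + 1)) (h j))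
    (hA : ∀ j ∈ J, (F j).comp (tmap (Hom.id M) (h (j + 1))) = a j)
    (hB : ∀ j ∈ J, (tmap (h j) (Hom.id N)).comp (F j) = b j) :
    KTildeCyc.cls ⟨c, a⟩ + KTildeCyc.cls ⟨d, zeroOn b J⟩ =
      KTildeCyc.cls ⟨c, zeroOn a J⟩ + KTildeCyc.cls ⟨d, b⟩ := by
  classical
  have hh : ∀ j, Intertwines (a j) (b j) (h (j + 1)) (h j) := by
    intro j
    by_cases hj : j ∈ J
    · rw [Intertwines, ← hB j hj, ← hA j hj]; rfl
    · exact hJ j hj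
  -- On J, G is F ∘ snd: it restricts to a on the graph and to 0 on c, and it cancels b in the graph
  -- quotient. Off J, G is a ∘ fst, so both filtrations see the original maps.
  refine KTildeCyc.cls_add_cls h hh (fun j => if j ∈ J then (F j).comp (tmap (Hom.id M) (snd _ _))
      else (a j).comp (tmap (Hom.id M) (fst _ _))) (fun j => ?_) (fun j z => ?_) (fun j => ?_)
  · by_cases hj : j ∈ J
    · rw [if_pos hj, Hom.comp_assoc, tmap_comp, snd_comp_graph, Hom.comp_id, hA j hj]
    · rw [if_neg hj, Hom.comp_assoc, tmap_comp, fst_comp_graph, Hom.comp_id, tmap_id, Hom.comp_id]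
  · by_cases hj : j ∈ J
    · have e := DFunLike.congr_fun (hB j hj) (tmap (Hom.id M) (snd _ _) z)
      rw [Hom.comp_apply] at e
      rw [if_pos hj, zeroOn_of_mem b hj, Hom.zero_apply, Hom.comp_apply, e, sub_self]
    · have e := DFunLike.congr_fun (hh j) (tmap (Hom.id M) (fst _ _) z)
      rw [Hom.comp_apply, Hom.comp_apply, tmap_comp_apply, Hom.comp_id] at e
      rw [if_neg hj, zeroOn_of_notMem b hj, Hom.comp_apply, ← e, tmap_sub_right, Hom.sub_apply,
        map_sub]
  · by_cases hj : j ∈ J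
    · rw [if_pos hj, zeroOn_of_mem a hj, Hom.comp_assoc, tmap_comp, snd_comp_inl, tmap_zero_right,
        Hom.comp_zero]
    · rw [if_neg hj, zeroOn_of_notMem a hj, Hom.comp_assoc, tmap_comp, fst_comp_inl, Hom.comp_id,
        tmap_id, Hom.comp_id]

variable (c) in
theorem KTildeCyc.cls_zeroOn_univ : KTildeCyc.cls ⟨c, zeroOn a Set.univ⟩ = 0 := by
  have h : zeroOn a Set.univ = fun _ => 0 := funext fun j => zeroOn_of_mem a (Set.mem_univ j)
  rw [h]
  exact KTildeCyc.cls_zero c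

/-- Strong shift equivalence: `[F ∘ (1 ⊗ u)] = [(u ⊗ 1) ∘ F]`. -/
theorem KTildeCyc.cls_shift (h : ∀ j, Hom (c j).mod (d j).mod)
    (F : ∀ j, Hom (tensor M (d (j + 1)).mod) (tensor (c j).mod N))
    (hA : ∀ j, (F j).comp (tmap (Hom.id M) (h (j + 1))) = a j)
    (hB : ∀ j, (tmap (h j) (Hom.id N)).comp (F j) = b j) :
    KTildeCyc.cls ⟨c, a⟩ = KTildeCyc.cls ⟨d, b⟩ := by
  have h1 := KTildeCyc.cls_add_zeroOn Set.univ h F (fun j hj => (hj (Set.mem_univ j)).elim)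
    (fun j _ => hA j) (fun j _ => hB j)
  rwa [KTildeCyc.cls_zeroOn_univ, KTildeCyc.cls_zeroOn_univ, zero_add, add_zero] at h1

/-- Shift equivalence for the endomorphism of c that is 0 at index i + 1 and the identity elsewhere.
Precomposing with it affects only the map at i, which already vanishes, while postcomposing kills
the map at i + 1. -/
theorem KTildeCyc.cls_zeroOn_insert (J : Set (Fin n)) (i : Fin n) (hi : i ∈ J) :
    KTildeCyc.cls ⟨c, zeroOn a J⟩ = KTildeCyc.cls ⟨c, zeroOn a (insert (i + 1) J)⟩ := by
  classical
  refine KTildeCyc.cls_shift (fun j => if j = i + 1 then 0 else Hom.id _) (zeroOn a J)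
    (fun j => ?_) (fun j => ?_)
  · by_cases hj : j = i
    · rw [hj, zeroOn_of_mem a hi, Hom.zero_comp]
    · rw [if_neg (fun h => hj (add_right_cancel h)), tmap_id, Hom.comp_id]
  · by_cases hj : j = i + 1
    · rw [if_pos hj, zeroOn_of_mem a (J := insert (i + 1) J) (Or.inl hj), tmap_zero_left,
        Hom.zero_comp]
    · rw [if_neg hj, tmap_id, Hom.id_comp]
      by_cases hj' : j ∈ J
      · rw [zeroOn_of_mem a hj', zeroOn_of_mem a (Set.mem_insert_of_mem _ hj')]
      · rw [zeroOn_of_notMem a hj', zeroOn_of_notMem a (by simp [hj, hj'])]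

/-- A zero at one index can be propagated to its successor without changing the class; going once
round the cycle makes every map zero. -/
theorem KTildeCyc.cls_zeroOn (J : Set (Fin n)) (i : Fin n) (hi : i ∈ J) :
    KTildeCyc.cls ⟨c, zeroOn a J⟩ = 0 := by
  have h1 : ∀ k : ℕ, ∃ J' : Set (Fin n), (∀ t ≤ k, i + Fin.ofNat n t ∈ J') ∧
      KTildeCyc.cls ⟨c, zeroOn a J⟩ = KTildeCyc.cls ⟨c, zeroOn a J'⟩ := by
    intro k
    induction k with
    | zero =>
      refine ⟨J, fun t ht => ?_, rfl⟩
      obtain rfl : t = 0 := by omega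
      have := fin_succ_iterate n 0 i
      rwa [← this]
    | succ k ih =>
      obtain ⟨J', h1, h2⟩ := ih
      refine ⟨insert (i + Fin.ofNat n k + 1) J', fun t ht => ?_,
        h2.trans (KTildeCyc.cls_zeroOn_insert J' _ (h1 k le_rfl))⟩
      rcases Nat.lt_or_ge k t with hk | hk
      · obtain rfl : t = k + 1 := by omega
        left
        rw [← fin_succ_iterate, ← fin_succ_iterate, Function.iterate_succ_apply']
      · exact Or.inr (h1 t hk)
  -- After n propagations every index occurs, since j is reached from i in `(j - i).val` < n steps.
  obtain ⟨J', h1, h2⟩ := h1 n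
  obtain rfl : J' = Set.univ := Set.eq_univ_of_forall fun j => by
    have h3 : i + Fin.ofNat n (j - i).val = j := by
      have : Fin.ofNat n (j - i).val = j - i := by
        ext
        exact Nat.mod_eq_of_lt (j - i).isLt
      rw [this, add_sub_cancel]
    rw [← h3]
    exact h1 _ (j - i).isLt.le
  rw [h2, KTildeCyc.cls_zeroOn_univ]

/-- A tuple in which one of the maps is zero vanishes in reduced `K`-theory. -/
theorem KTildeCyc.cls_eq_zero (A : CycObj M N n) (i : Fin n) (hi : A.f i = 0) :
    KTildeCyc.cls A = 0 := by
  have h : zeroOn A.f {i} = A.f := funext fun j => by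
    by_cases hj : j = i
    · subst hj
      exact (zeroOn_of_mem A.f rfl).trans hi.symm
    · exact zeroOn_of_notMem A.f hj
  have h1 := KTildeCyc.cls_zeroOn (a := A.f) {i} i rfl
  rwa [h] at h1

/-- A morphism of tuples which is bijective at one index induces an equality in reduced
`K`-theory. -/
theorem KTildeCyc.cls_eq_of_bijective_at (A B : CycObj M N n)
    (h : ∀ j, Hom (A.c j).mod (B.c j).mod)
    (hh : ∀ j, Intertwines (A.f j) (B.f j) (h (j + 1)) (h j)) (i : Fin n)
    (hi : Function.Bijective (h i)) : KTildeCyc.cls A = KTildeCyc.cls B := by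
  classical
  -- Bijectivity at the index k + 1 is used on the source side of the k-th map, since f_k starts
  -- from M ⊗ c_{k+1}.
  obtain ⟨i, rfl⟩ : ∃ k, i = k + 1 := ⟨i - 1, (sub_add_cancel i 1).symm⟩
  let e := Iso.ofBijective (h (i + 1)) hi
  have he : e.hom = h (i + 1) := rfl
  -- The square at i has the filler f_i ∘ (1 ⊗ h_{i+1}⁻¹). The other values of F play no role, and
  -- the default 0 serves.
  have h1 := KTildeCyc.cls_add_zeroOn (a := A.f) (b := B.f) {i} h
    (fun j => if hj : j = i then
      (A.f j).comp (tmap (Hom.id M) (hj ▸ e.inv : Hom (B.c (j + 1)).mod (A.c (j + 1)).mod))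
      else 0)
    (fun j _ => hh j)
    (by
      rintro j rfl
      simp only [dif_pos]
      rw [Hom.comp_assoc, tmap_comp, ← he, e.inv_comp_hom, Hom.comp_id, tmap_id, Hom.comp_id])
    (by
      rintro j rfl
      simp only [dif_pos]
      rw [← Hom.comp_assoc, ← hh j, Hom.comp_assoc, tmap_comp, ← he, e.hom_comp_inv, Hom.comp_id,
        tmap_id, Hom.comp_id])
  -- Both tuples truncated at i vanish, so the relation reduces to the equality of the two
  -- untruncated classes.
  rwa [KTildeCyc.cls_zeroOn {i} i rfl, KTildeCyc.cls_zeroOn {i} i rfl, add_zero, zero_add] at h1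

end Cyc

end Relations

/-! ### Kernels -/

namespace BiMod

variable {R S T : Type u} [Ring R] [Ring S] [Ring T]

section Ker

variable {X Y : BiMod R S} (p : Hom X Y)

instance : SMul R p.toFun.ker :=
  ⟨fun r x => ⟨r • (x : X), (p.smul_left r x).trans ((congrArg (r • ·) x.2).trans (smul_zero r))⟩⟩

instance : SMul Sᵐᵒᵖ p.toFun.ker :=
  ⟨fun s x => ⟨s • (x : X),
    (p.smul_right (unop s) x).trans ((congrArg (s • ·) x.2).trans (smul_zero s))⟩⟩

instance : Module R p.toFun.ker :=
  Function.Injective.module R p.toFun.ker.subtype Subtype.coe_injective (fun _ _ => rfl)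

instance : Module Sᵐᵒᵖ p.toFun.ker :=
  Function.Injective.module Sᵐᵒᵖ p.toFun.ker.subtype Subtype.coe_injective (fun _ _ => rfl)

/-- The kernel of a bimodule homomorphism. -/
def ker : BiMod R S where
  carrier := p.toFun.ker
  smulComm := ⟨fun r s x => Subtype.ext (smul_comm r s (x : X))⟩

/-- The inclusion of the kernel. -/
def kerIncl : Hom (ker p) X where
  toFun := p.toFun.ker.subtype
  map_left _ _ := rfl
  map_right _ _ := rfl

theorem shortExact_kerIncl (hp : Function.Surjective p) : ShortExact (kerIncl p) p where
  injective := Subtype.coe_injective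
  surjective := hp
  exact y := ⟨fun hy => ⟨⟨y, hy⟩, rfl⟩, by
    rintro ⟨x, rfl⟩
    exact x.2⟩

end Ker

/-- A homomorphism with values in the range of an injective homomorphism lifts along it. -/
theorem Hom.exists_lift {X Y Z : BiMod R S} (j : Hom X Y) (hj : Function.Injective j)
    (f : Hom Z Y) (hf : ∀ z, ∃ x, j x = f z) : ∃ g : Hom Z X, j.comp g = f := by
  choose g hg using hf
  refine ⟨⟨AddMonoidHom.mk' g fun x y => hj ?_, fun r x => hj ?_, fun s x => hj ?_⟩,
    Hom.funext hg⟩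
  · rw [map_add, hg, hg, hg, map_add]
  · change j (g (r • x)) = j (r • g x)
    rw [j.smul_left, hg, hg, f.smul_left]
  · change j (g (op s • x)) = j (op s • g x)
    rw [j.smul_right, hg, hg, f.smul_right]

/-- A short exact sequence ending in a projective right module splits as right modules. -/
theorem ShortExact.exists_splitting {X Y Z : BiMod R S} {i : Hom X Y} {p : Hom Y Z}
    (h : ShortExact i p) (hZ : Module.Projective Sᵐᵒᵖ Z) :
    ∃ (ρ : Y →ₗ[Sᵐᵒᵖ] X) (s : Z →ₗ[Sᵐᵒᵖ] Y),
      (∀ x, ρ (i x) = x) ∧ ∀ y, i (ρ y) + s (p y) = y := by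
  obtain ⟨s, hs⟩ := Module.projective_lifting_property p.right LinearMap.id h.surjective
  have hs' : ∀ z, p (s z) = z := fun z => DFunLike.congr_fun hs z
  have hex : ∀ y, ∃ x, i x = y - s (p y) := fun y =>
    (h.exact _).1 (by rw [map_sub, hs', sub_self])
  choose ρ hρ using hex
  refine ⟨{ toFun := ρ, map_add' := fun x y => h.injective ?_, map_smul' := fun t x =>
    h.injective ?_ }, s, fun x => h.injective ?_, fun y => ?_⟩
  · rw [map_add, hρ, hρ, hρ, map_add, map_add]; abel
  · obtain ⟨t, rfl⟩ := op_surjective t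
    rw [RingHom.id_apply, i.smul_right, hρ, hρ, p.smul_right, map_smul, smul_sub]
  · change i (ρ (i x)) = i x
    rw [hρ, (h.exact (i x)).2 ⟨x, rfl⟩, map_zero, sub_zero]
  · change i (ρ y) + _ = y
    rw [hρ, sub_add_cancel]

theorem ShortExact.fgp {X Y Z : BiMod R S} {i : Hom X Y} {p : Hom Y Z}
    (h : ShortExact i p) (hY : Y.IsFGP) (hZ : Z.IsFGP) : X.IsFGP := by
  obtain ⟨ρ, s, hρ, -⟩ := h.exists_splitting hZ.projective
  have := hY.finite
  have := hY.projective
  exact ⟨Module.Finite.of_surjective ρ fun x => ⟨i x, hρ x⟩,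
    Module.Projective.of_split i.right ρ (LinearMap.ext hρ)⟩

/-- The map `ρ ⊗ 1` for a map `ρ` of right modules. -/
def rmap {X Y : BiMod R S} (N : BiMod S T) (ρ : X →ₗ[Sᵐᵒᵖ] Y) : tensor X N →+ tensor Y N :=
  tmapAdd (X := X) (Y := N) (X' := Y) (Y' := N) ρ.toAddMonoidHom (AddMonoidHom.id N)
    (fun s x => map_smul ρ (op s) x) (fun _ _ => rfl)

theorem rmap_pure {X Y : BiMod R S} (N : BiMod S T) (ρ : X →ₗ[Sᵐᵒᵖ] Y) (x : X) (n : N) :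
    rmap N ρ (pure x n) = pure (ρ x) n := rfl

/-- No flatness of N is needed: the quotient is projective on the right, so the sequence splits as
right modules. The retraction ρ need not respect the left action, and tensoring it with N only uses
its right linearity. -/
theorem ShortExact.tmap_injective {X Y Z : BiMod R S} {i : Hom X Y} {p : Hom Y Z}
    (h : ShortExact i p) (hZ : Module.Projective Sᵐᵒᵖ Z) (N : BiMod S T) :
    Function.Injective (tmap i (Hom.id N)) := by
  obtain ⟨ρ, s, hρ, -⟩ := h.exists_splitting hZ
  refine Function.LeftInverse.injective (g := rmap N ρ) fun z => ?_
  induction z using pure_induction with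
  | zero => rw [map_zero, map_zero]
  | mk x n => rw [tmap_pure, rmap_pure, hρ, Hom.id_apply]
  | add a b ha hb => rw [map_add, map_add, ha, hb]

/-- The splitting identity i ρ + s p = 1 survives tensoring with N, so an element killed by p ⊗ 1 is
the image under i ⊗ 1 of its value under ρ ⊗ 1. -/
theorem ShortExact.exists_of_tmap_eq_zero {X Y Z : BiMod R S} {i : Hom X Y} {p : Hom Y Z}
    (h : ShortExact i p) (hZ : Module.Projective Sᵐᵒᵖ Z) (N : BiMod S T) (z : tensor Y N)
    (hz : tmap p (Hom.id N) z = 0) : ∃ w, tmap i (Hom.id N) w = z := by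
  obtain ⟨ρ, s, -, hs⟩ := h.exists_splitting hZ
  have key : ∀ z, tmap i (Hom.id N) (rmap N ρ z) + rmap N s (tmap p (Hom.id N) z) = z := by
    intro z
    induction z using pure_induction with
    | zero => simp
    | mk y n =>
      rw [tmap_pure, rmap_pure, rmap_pure, tmap_pure, Hom.id_apply, ← pure_add_left, hs]
    | add a b ha hb =>
      conv_rhs => rw [← ha, ← hb]
      simp only [map_add]
      abel
  exact ⟨rmap N ρ z, by simpa [hz] using key z⟩

end BiMod

/-! ### A criterion for the bijectivity of Γ -/

section Bijective

variable {R S : Type u} [Ring R] [Ring S] {M : BiMod R R} {N : BiMod S S} {n : ℕ} [NeZero n]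

/-- The restriction of a twisted homomorphism to kernels. -/
theorem exists_ker_hom {P P' Q Q' : BiMod R S} {f : Hom (tensor M P') (tensor P N)}
    {g : Hom (tensor M Q') (tensor Q N)} {p' : Hom P' Q'} {p : Hom P Q}
    (h : Intertwines f g p' p) (hp : Function.Surjective p) (hQ : Q.IsFGP) :
    ∃ k : Hom (tensor M (ker p')) (tensor (ker p) N), Intertwines k f (kerIncl p') (kerIncl p) := by
  have hse := shortExact_kerIncl p hp
  obtain ⟨k, hk⟩ := Hom.exists_lift (tmap (kerIncl p) (Hom.id N))
    (hse.tmap_injective hQ.projective N) (f.comp (tmap (Hom.id M) (kerIncl p')))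
    (fun z => hse.exists_of_tmap_eq_zero hQ.projective N _ (by
      have h1 := DFunLike.congr_fun h (tmap (Hom.id M) (kerIncl p') z)
      have h2 : p'.comp (kerIncl p') = 0 := Hom.funext fun x => x.2
      rw [Hom.comp_apply, Hom.comp_apply, tmap_comp_apply, h2, tmap_zero_right, Hom.zero_apply,
        map_zero] at h1
      exact h1.symm))
  exact ⟨k, hk.symm⟩

/-- A levelwise surjective morphism of cyclic tuples has a kernel. -/
theorem CycObj.exists_kernel {B C : CycObj M N n} (p : ∀ j, Hom (B.c j).mod (C.c j).mod)
    (hp : ∀ j, Intertwines (B.f j) (C.f j) (p (j + 1)) (p j))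
    (hs : ∀ j, Function.Surjective (p j)) :
    ∃ (K : CycObj M N n) (i : ∀ j, Hom (K.c j).mod (B.c j).mod),
      (∀ j, Intertwines (K.f j) (B.f j) (i (j + 1)) (i j)) ∧ ∀ j, ShortExact (i j) (p j) := by
  choose k hk using fun j => exists_ker_hom (hp j) (hs j) (C.c j).fgp
  have hse := fun j => shortExact_kerIncl (p j) (hs j)
  exact ⟨⟨fun j => ⟨ker (p j), (hse j).fgp (B.c j).fgp (C.c j).fgp⟩, k⟩, fun j => kerIncl (p j),
    hk, hse⟩

/-- A map into Y with values in the subobject K factors through K on underlying bimodules.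
Compatibility with the twisted endomorphisms may be checked in Y because k ⊗ 1 is injective. -/
theorem EndObj.exists_lift {X Y K : EndObj M N} {i : Hom X.P.mod Y.P.mod}
    (hi : Intertwines X.f Y.f i i) {k : Hom K.P.mod Y.P.mod} (hk : Intertwines K.f Y.f k k)
    (hk1 : Function.Injective k) (hk2 : Function.Injective (tmap k (Hom.id N)))
    (hr : ∀ x, ∃ y, k y = i x) :
    ∃ h : Hom X.P.mod K.P.mod, Intertwines X.f K.f h h ∧ k.comp h = i := by
  obtain ⟨h, hh⟩ := Hom.exists_lift k hk1 i hr
  refine ⟨h, Hom.funext fun z => hk2 ?_, hh⟩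
  have h1 := DFunLike.congr_fun hk (tmap (Hom.id M) h z)
  have h2 := DFunLike.congr_fun hi z
  rw [Hom.comp_apply, Hom.comp_apply, tmap_comp_apply, hh, Hom.comp_id] at h1
  rw [Hom.comp_apply, Hom.comp_apply] at h2
  rw [Hom.comp_apply, Hom.comp_apply, ← h1, tmap_comp_apply, hh, Hom.comp_id]
  exact h2

/-- `Γ` is an isomorphism if it has a section on objects that respects surjections, zero objects
and classes of tuples. -/
theorem gammaMap_bijective_of (E : EndObj (pow M n) (pow N n) → CycObj M N n)
    (e : ∀ X, Iso X.P.mod ((E X).c 0).mod)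
    (he : ∀ X, Intertwines X.f (E X).gamma.f (e X).hom (e X).hom)
    (hfun : ∀ (X Y : EndObj (pow M n) (pow N n)) (p : Hom X.P.mod Y.P.mod),
      Intertwines X.f Y.f p p → Function.Surjective p →
      ∃ q : ∀ j, Hom ((E X).c j).mod ((E Y).c j).mod,
        (∀ j, Intertwines ((E X).f j) ((E Y).f j) (q (j + 1)) (q j)) ∧
        (∀ j, Function.Surjective (q j)) ∧ (q 0).comp (e X).hom = (e Y).hom.comp p)
    (hnorm : ∀ A, KTildeCyc.cls A = KTildeCyc.cls (E A.gamma))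
    (hzero : ∀ P, KTildeCyc.cls (E (EndObj.zero _ _ P)) = 0) :
    Function.Bijective (gammaMap M N n) := by
  -- The component at 0 of the induced map of tuples is p up to the isomorphisms e, hence bijective,
  -- and bijectivity at one index suffices.
  have hiso : ∀ (X Y : EndObj (pow M n) (pow N n)) (p : Hom X.P.mod Y.P.mod),
      Intertwines X.f Y.f p p → Function.Bijective p →
      KTildeCyc.cls (E X) = KTildeCyc.cls (E Y) := by
    intro X Y p hp hb
    obtain ⟨q, hq, -, hq0⟩ := hfun X Y p hp hb.2
    refine KTildeCyc.cls_eq_of_bijective_at _ _ q hq 0 ?_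
    have h1 : q 0 = ((e Y).hom.comp p).comp (e X).inv := by
      rw [← hq0, Hom.comp_assoc, (e X).hom_comp_inv, Hom.comp_id]
    rw [h1]
    exact ((e Y).bijective.comp hb).comp (e X).symm.bijective
  have hadd : ∀ X Y Z : EndObj (pow M n) (pow N n), EndObj.Ses X Y Z →
      KTildeCyc.cls (E Y) = KTildeCyc.cls (E X) + KTildeCyc.cls (E Z) := by
    rintro X Y Z ⟨i, p, hi, hp, h⟩
    obtain ⟨q, hq, hqs, hq0⟩ := hfun Y Z p hp h.surjective
    -- E X itself need not be this kernel. But the kernel K gives [E Y] = [K] + [E Z], and it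
    -- remains to see that ΓK ≅ X: then [K] = [E(ΓK)] = [E X] by `hnorm` and `hiso`.
    obtain ⟨K, k, hk, hse⟩ := CycObj.exists_kernel q hq hqs
    have hq0' : ∀ y, q 0 ((e Y).hom y) = (e Z).hom (p y) := fun y => DFunLike.congr_fun hq0 y
    have hei : Intertwines X.f (E Y).gamma.f ((e Y).hom.comp i) ((e Y).hom.comp i) :=
      hi.trans (he Y)
    obtain ⟨g, hg, hgk⟩ := EndObj.exists_lift (X := X) (Y := (E Y).gamma) (K := K.gamma) hei
      (gamma_intertwines hk) (hse 0).injective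
      ((hse 0).tmap_injective ((E Z).c 0).fgp.projective _)
      (fun x => ((hse 0).exact _).1 ((hq0' (i x)).trans (by
        rw [(h.exact _).2 ⟨x, rfl⟩, map_zero])))
    have hgk' : ∀ x, k 0 (g x) = (e Y).hom (i x) := fun x => DFunLike.congr_fun hgk x
    -- At index 0 the map of tuples is Y → Z up to isomorphism, so its kernel there is X.
    have hb : Function.Bijective g := by
      refine ⟨fun x y hxy => h.injective ((e Y).bijective.1 ?_), fun y => ?_⟩
      · rw [← hgk', ← hgk', hxy]
      · obtain ⟨b, hb⟩ := (e Y).bijective.2 (k 0 y)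
        obtain ⟨x, rfl⟩ := (h.exact b).1 ((e Z).bijective.1 (by
          rw [← hq0', hb, map_zero]
          exact ((hse 0).exact _).2 ⟨y, rfl⟩))
        exact ⟨x, (hse 0).injective (by rw [hgk', hb])⟩
    rw [KTildeCyc.cls_eq (A := K) ⟨k, q, hk, hq, hse⟩, hnorm K, ← hiso X K.gamma g hg hb]
  let Φ : KTilde (pow M n) (pow N n) →+ KTildeCyc M N n :=
    K0Red.lift (EndObj.zero_ses _ _) (fun X => KTildeCyc.cls (E X)) hadd hzero
  have hΦ : ∀ X, Φ (KTilde.cls X) = KTildeCyc.cls (E X) := fun X => rfl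
  constructor
  -- The candidate inverse sends [X] to [E X]. It is a left inverse by `hnorm` and a right inverse
  -- because ΓE X ≅ X.
  · refine Function.LeftInverse.injective (g := Φ) fun x => ?_
    induction x using K0Red.induction with
    | h0 => rw [map_zero, map_zero]
    | hcls A => exact (hΦ A.gamma).trans (hnorm A).symm
    | hneg x hx => rw [map_neg, map_neg, hx]
    | hadd x y hx hy => rw [map_add, map_add, hx, hy]
  · refine Function.RightInverse.surjective (g := Φ) fun x => ?_
    induction x using K0Red.induction with
    | h0 => rw [map_zero, map_zero]
    | hcls X => exact (KTilde.cls_eq_of_bijective (B := (E X).gamma) _ (he X) (e X).bijective).symm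
    | hneg x hx => rw [map_neg, map_neg, hx]
    | hadd x y hx hy => rw [map_add, map_add, hx, hy]

end Bijective

/-! ### Composition is an isomorphism when one of the coefficient bimodules is trivial -/

section Prelim

variable {R S : Type u} [Ring R] [Ring S] {M : BiMod R R} {N : BiMod S S}

theorem BiMod.tmap_bijective {T : Type u} [Ring T] {X X' : BiMod R S} {Y Y' : BiMod S T}
    {f : Hom X X'} {g : Hom Y Y'} (hf : Function.Bijective f) (hg : Function.Bijective g) :
    Function.Bijective (tmap f g) :=
  (tensorIso (Iso.ofBijective f hf) (Iso.ofBijective g hg)).bijective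

theorem composeStep_bijective {X X' : BiMod R R} {Y Y' : BiMod S S} {P P' P'' : BiMod R S}
    {f : Hom (tensor X P') (tensor P Y)} {g : Hom (tensor X' P'') (tensor P' Y')}
    (hf : Function.Bijective f) (hg : Function.Bijective g) :
    Function.Bijective (composeStep f g) :=
  (assoc P Y Y').bijective.comp <| (tmap_bijective hf Function.bijective_id).comp <|
    (assoc X P' Y').symm.bijective.comp <| (tmap_bijective Function.bijective_id hg).comp
      (assoc X X' P'').bijective

theorem composeNil_bijective (P : BiMod R S) : Function.Bijective (composeNil P) :=
  (runit P).symm.bijective.comp (lunit P).bijective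

theorem TwistedPath.iter_bijective {I : Type} (s : I → I) (c : I → BiMod R S)
    (f : ∀ i, Hom (tensor M (c (s i))) (tensor (c i) N)) (hf : ∀ i, Function.Bijective (f i)) :
    ∀ (n : ℕ) (i j : I) (h : s^[n] i = j), Function.Bijective (iter s c f n i j h).eval
  | 0, i, _, rfl => composeNil_bijective (c i)
  | n + 1, i, j, h => composeStep_bijective (hf i) (iter_bijective s c f hf n (s i) j h)

/-- The isomorphism `X ⊗ P ≅ P` given by `X ≅ R`. -/
def BiMod.lunitOf {X : BiMod R R} (e : Iso X (unit R)) (P : BiMod R S) : Iso (tensor X P) P :=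
  (tensorIso e (Iso.refl P)).trans (lunit P)

theorem BiMod.lunitOf_natural {X : BiMod R R} (e : Iso X (unit R)) {P Q : BiMod R S}
    (g : Hom P Q) : (lunitOf e Q).hom.comp (tmap (Hom.id X) g) = g.comp (lunitOf e P).hom :=
  hom_ext fun x p => (g.smul_left (ofUnit R (e.hom x)) p).symm

theorem BiMod.tmap_left_cancel {X : BiMod R R} (e : Iso X (unit R)) {P Q : BiMod R S}
    {g g' : Hom P Q} (h : tmap (Hom.id X) g = tmap (Hom.id X) g') : g = g' := by
  have h1 : g.comp (lunitOf e P).hom = g'.comp (lunitOf e P).hom := by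
    rw [← lunitOf_natural, ← lunitOf_natural, h]
  refine Hom.funext fun p => ?_
  have h2 := DFunLike.congr_fun h1 ((lunitOf e P).inv p)
  rwa [Hom.comp_apply, Hom.comp_apply, (lunitOf e P).inv_hom] at h2

/-- The isomorphism `P ⊗ Y ≅ P` given by `Y ≅ S`. -/
def BiMod.runitOf {Y : BiMod S S} (e : Iso Y (unit S)) (P : BiMod R S) : Iso (tensor P Y) P :=
  (tensorIso (Iso.refl P) e).trans (runit P)

theorem BiMod.runitOf_natural {Y : BiMod S S} (e : Iso Y (unit S)) {P Q : BiMod R S}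
    (g : Hom P Q) : (runitOf e Q).hom.comp (tmap g (Hom.id Y)) = g.comp (runitOf e P).hom :=
  hom_ext fun p y => (g.smul_right (ofUnit S (e.hom y)) p).symm

theorem BiMod.tmap_right_cancel {Y : BiMod S S} (e : Iso Y (unit S)) {P Q : BiMod R S}
    {g g' : Hom P Q} (h : tmap g (Hom.id Y) = tmap g' (Hom.id Y)) : g = g' := by
  have h1 : g.comp (runitOf e P).hom = g'.comp (runitOf e P).hom := by
    rw [← runitOf_natural, ← runitOf_natural, h]
  refine Hom.funext fun p => ?_
  have h2 := DFunLike.congr_fun h1 ((runitOf e P).inv p)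
  rwa [Hom.comp_apply, Hom.comp_apply, (runitOf e P).inv_hom] at h2

/-- `X^{⊗ n} ≅ R` if `X ≅ R`. -/
def BiMod.powUnit {X : BiMod R R} (e : Iso X (unit R)) : ∀ n : ℕ, Iso (pow X n) (unit R)
  | 0 => Iso.refl _
  | n + 1 => (tensorIso e (powUnit e n)).trans (lunit (unit R))

/-- The identity as an isomorphism between the members of a family at equal indices. -/
def BiMod.castIso {I : Type} (c : I → BiMod R S) {i j : I} (h : i = j) : Iso (c i) (c j) :=
  h ▸ Iso.refl (c i)

theorem CycObj.intertwines_cast {n : ℕ} [NeZero n] (A : CycObj M N n) {i j : Fin n} (h : i = j)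
    (h' : i + 1 = j + 1) :
    Intertwines (A.f i) (A.f j) (castIso (fun k => (A.c k).mod) h').hom
      (castIso (fun k => (A.c k).mod) h).hom := by
  subst h
  exact (congrArg (A.f i).comp tmap_id).trans (congrArg (fun z => Hom.comp z (A.f i)) tmap_id).symm

theorem fin_val_add_one (n : ℕ) [NeZero n] (j : Fin n) :
    (j + 1).val = j.val + 1 ∨ (j + 1 = 0 ∧ j.val + 1 = n) := by
  have h := j.isLt
  have h1 : (j + 1).val = (j.val + 1) % n := by
    rw [Fin.val_add]
    simp
  rcases Nat.lt_or_ge (j.val + 1) n with h2 | h2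
  · exact Or.inl (h1.trans (Nat.mod_eq_of_lt h2))
  · have h3 : j.val + 1 = n := by omega
    refine Or.inr ⟨Fin.ext ?_, h3⟩
    rw [h1, h3]
    simp

theorem nat_succ_iterate (n a : ℕ) : (fun k : ℕ => k + 1)^[n] a = a + n := by
  induction n generalizing a with
  | zero => rfl
  | succ n ih => rw [Function.iterate_succ_apply, ih]; omega

/-- The residue class of `k`. -/
def cycIdx (n : ℕ) [NeZero n] : ℕ → Fin n
  | 0 => 0
  | k + 1 => cycIdx n k + 1

theorem cycIdx_eq (n : ℕ) [NeZero n] (k : ℕ) : cycIdx n k = Fin.ofNat n k := by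
  induction k with
  | zero => rfl
  | succ k ih =>
    rw [cycIdx, ih]
    ext
    simp [Fin.val_add]

theorem cycIdx_val (n : ℕ) [NeZero n] (j : Fin n) : cycIdx n j.val = j := by
  rw [cycIdx_eq]
  exact Fin.ext (Nat.mod_eq_of_lt j.isLt)

theorem cycIdx_self (n : ℕ) [NeZero n] : cycIdx n n = 0 := by
  rw [cycIdx_eq]
  exact Fin.ext (by simp)

end Prelim

/-! ### The case M ≅ R: a right adjoint of Γ -/

section LeftTrivial

variable {R S : Type u} [Ring R] [Ring S] {M : BiMod R R} {N : BiMod S S}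

/-- The iterated tensor product `(⋯ ((P ⊗ N) ⊗ N) ⋯) ⊗ N`. -/
def tensorRight (N : BiMod S S) (P : BiMod R S) : ℕ → BiMod R S
  | 0 => P
  | k + 1 => tensor (tensorRight N P k) N

theorem tensorRight_fgp (hH : ∀ P : BiMod R S, P.IsFGP → (BiMod.tensor P N).IsFGP)
    {P : BiMod R S} (hP : P.IsFGP) : ∀ k, (tensorRight N P k).IsFGP
  | 0 => hP
  | k + 1 => hH _ (tensorRight_fgp hH hP k)

variable (e : Iso M (unit R))

variable (N) in
/-- The isomorphism `M ⊗ (P_k ⊗ N) ≅ P_k ⊗ N` for `P_k` the iterated tensor product. -/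
def rightStep (P : BiMod R S) (k : ℕ) :
    Iso (tensor M (tensorRight N P (k + 1))) (tensor (tensorRight N P k) N) :=
  lunitOf e (tensorRight N P (k + 1))

variable (N) in
/-- The path of the isomorphisms `rightStep`. -/
def rightPath (P : BiMod R S) (n a b : ℕ) (h : (fun k : ℕ => k + 1)^[n] a = b) :
    TwistedPath M N n (tensorRight N P a) (tensorRight N P b) :=
  TwistedPath.iter (fun k : ℕ => k + 1) (tensorRight N P) (fun k => (rightStep N e P k).hom) n a b h

theorem rightPath_bijective (P : BiMod R S) (n a b : ℕ) (h : (fun k : ℕ => k + 1)^[n] a = b) :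
    Function.Bijective (rightPath N e P n a b h).eval :=
  TwistedPath.iter_bijective _ _ _ (fun k => (rightStep N e P k).bijective) _ _ _ _

variable {n : ℕ}

/-- The map `P → P_n` adjoint to `f : M^{⊗ n} ⊗ P → P ⊗ N^{⊗ n}`. -/
noncomputable def rightAdj {P : BiMod R S} (f : Hom (tensor (pow M n) P) (tensor P (pow N n))) :
    Hom P (tensorRight N P n) :=
  (lunitOf (powUnit e n) (tensorRight N P n)).hom.comp <|
    (Iso.ofBijective _ (rightPath_bijective e P n 0 n ((nat_succ_iterate n 0).trans
      (Nat.zero_add n)))).inv.comp <| f.comp (lunitOf (powUnit e n) P).inv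

/-- The path of canonical maps evaluates to an isomorphism κ, so the equation κ ∘ (1 ⊗ g) = f
determines 1 ⊗ g = κ⁻¹ f. Since M^{⊗ n} ≅ R, every such map is 1 ⊗ g for a unique g. -/
theorem rightAdj_spec {P : BiMod R S} (f : Hom (tensor (pow M n) P) (tensor P (pow N n)))
    (h : (fun k : ℕ => k + 1)^[n] 0 = n) :
    (rightPath N e P n 0 n h).eval.comp (tmap (Hom.id (pow M n)) (rightAdj e f)) = f := by
  let κ := Iso.ofBijective _ (rightPath_bijective (N := N) e P n 0 n h)
  have hκ : rightAdj e f = (lunitOf (powUnit e n) (tensorRight N P n)).hom.comp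
    (κ.inv.comp (f.comp (lunitOf (powUnit e n) P).inv)) := rfl
  have h1 : tmap (Hom.id (pow M n)) (rightAdj e f) = κ.inv.comp f := by
    refine Hom.funext fun z => (lunitOf (powUnit e n) _).bijective.1 ?_
    have h2 := DFunLike.congr_fun (lunitOf_natural (powUnit e n) (rightAdj e f)) z
    rw [Hom.comp_apply] at h2
    rw [h2, hκ]
    exact congrArg (lunitOf (powUnit e n) (tensorRight N P n)).hom (congrArg κ.inv (congrArg f ((lunitOf (powUnit e n) P).hom_inv z)))
  rw [h1]
  exact Hom.funext fun z => κ.inv_hom (f z)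

theorem rightAdj_unique {P : BiMod R S} {f : Hom (tensor (pow M n) P) (tensor P (pow N n))}
    {Q : BiMod R S} {g : Hom Q (tensorRight N P n)} {p : Hom Q P}
    (h : (fun k : ℕ => k + 1)^[n] 0 = n)
    (hg : (rightPath N e P n 0 n h).eval.comp (tmap (Hom.id (pow M n)) g) =
      f.comp (tmap (Hom.id (pow M n)) p)) : g = (rightAdj e f).comp p := by
  refine tmap_left_cancel (powUnit e n) (Hom.funext fun z =>
    (rightPath_bijective e P n 0 n h).1 ?_)
  have h1 := DFunLike.congr_fun hg z
  have h2 := DFunLike.congr_fun (rightAdj_spec e f h) (tmap (Hom.id (pow M n)) p z)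
  rw [Hom.comp_apply] at h1 h2
  rw [tmap_comp_apply, Hom.comp_id] at h2
  exact h1.trans h2.symm

/-- The identity of `P_a` for `a = b`, and the map `P_0 → P_n` adjoint to `f` for `a = 0`,
`b = n`. -/
noncomputable def rightTrans {P : BiMod R S} (f : Hom (tensor (pow M n) P) (tensor P (pow N n)))
    (a b : ℕ) : Hom (tensorRight N P a) (tensorRight N P b) :=
  if h : a = b then (castIso (tensorRight N P) h).hom
  else if h : 0 = a ∧ n = b then
    (castIso (tensorRight N P) h.2).hom.comp
      ((rightAdj e f).comp (castIso (tensorRight N P) h.1).inv)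
  -- Never reached by the tuple: its transitions run from `(j + 1).val` to `j.val + 1`, which are
  -- equal or are 0 and n.
  else 0

theorem rightTrans_self {P : BiMod R S} (f : Hom (tensor (pow M n) P) (tensor P (pow N n)))
    (a : ℕ) : rightTrans e f a a = Hom.id _ := dif_pos rfl

theorem rightTrans_zero [NeZero n] {P : BiMod R S}
    (f : Hom (tensor (pow M n) P) (tensor P (pow N n))) : rightTrans e f 0 n = rightAdj e f :=
  (dif_neg (NeZero.ne n).symm).trans (dif_pos ⟨rfl, rfl⟩)

variable [NeZero n] (hH : ∀ P : BiMod R S, P.IsFGP → (BiMod.tensor P N).IsFGP)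

/-- The cyclic tuple `(1, …, 1, f)` on `P, P ⊗ N, P ⊗ N ⊗ N, …`. -/
noncomputable def rightTuple (X : EndObj (pow M n) (pow N n)) : CycObj M N n where
  c j := ⟨tensorRight N X.P.mod j.val, tensorRight_fgp hH X.P.fgp j.val⟩
  f j := (rightStep N e X.P.mod j.val).hom.comp
    (tmap (Hom.id M) (rightTrans e X.f (j + 1).val (j.val + 1)))

theorem rightTuple_intertwines (X : EndObj (pow M n) (pow N n)) (j : Fin n) :
    Intertwines ((rightTuple e hH X).f j) (rightStep N e X.P.mod j.val).hom
      (rightTrans e X.f (j + 1).val (j.val + 1)) (rightTrans e X.f j.val j.val) := by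
  rw [rightTrans_self]
  exact (congrArg (fun z => Hom.comp z ((rightTuple e hH X).f j)) tmap_id).symm

/-- The cycle is unrolled onto the linear path P_0, …, P_n. Transitions are identities until the
index wraps from n - 1 to 0, so the adjoint of f appears only at the far end. -/
theorem rightTuple_path (X : EndObj (pow M n) (pow N n)) :
    ∀ (k : ℕ) (j : Fin n) (a : ℕ) (h : (fun j : Fin n => j + 1)^[k] j = 0)
      (h' : (fun k : ℕ => k + 1)^[k] a = n), (j.val = a ∨ (j = 0 ∧ a = n)) →
      TwistedPath.Map ((rightTuple e hH X).path k j 0 h) (rightPath N e X.P.mod k a n h')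
        (rightTrans e X.f j.val a) (rightTrans e X.f (0 : Fin n).val n)
  | 0, _, _, rfl, rfl, _ => TwistedPath.Map.nil _
  | k + 1, j, a, h, h', hja => by
    have ha : j.val = a := by
      -- A path of positive length ending at n cannot start at n, which excludes the wrapped case.
      rcases hja with ha | ⟨-, rfl⟩
      · exact ha
      · have := nat_succ_iterate (k + 1) a
        omega
    subst ha
    refine TwistedPath.Map.cons (rightTuple_intertwines e hH X j)
      (rightTuple_path X k (j + 1) (j.val + 1) h h' ?_)
    exact fin_val_add_one n j

/-- The identification of `P` with the first entry of the tuple. -/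
noncomputable def rightTupleIso (X : EndObj (pow M n) (pow N n)) :
    Iso X.P.mod ((rightTuple e hH X).c 0).mod :=
  castIso (tensorRight N X.P.mod) (i := 0) (j := (0 : Fin n).val) rfl

/-- Unrolled, the composite round the cycle is κ ∘ (1 ⊗ g) with g the adjoint of f, and this is f by
the defining property of g. -/
theorem rightTuple_gamma (X : EndObj (pow M n) (pow N n)) :
    Intertwines X.f (rightTuple e hH X).gamma.f (rightTupleIso e hH X).hom
      (rightTupleIso e hH X).hom := by
  have h1 := (rightTuple_path e hH X n 0 0 (succ_iterate n)
    ((nat_succ_iterate n 0).trans (Nat.zero_add n)) (Or.inl rfl)).intertwines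
  have h2 : rightTrans e X.f (0 : Fin n).val n = rightAdj e X.f := rightTrans_zero e X.f
  have h3 : rightTrans e X.f (0 : Fin n).val 0 = Hom.id _ := rightTrans_self e X.f 0
  rw [h2, h3] at h1
  have h4 : (rightPath N e X.P.mod n 0 n _).eval.comp
      (tmap (Hom.id (pow M n)) (rightAdj e X.f)) = (tmap (Hom.id _) (Hom.id _)).comp
        ((rightTuple e hH X).path n 0 0 (succ_iterate n)).eval := h1
  rw [rightAdj_spec, tmap_id, Hom.id_comp] at h4
  have h5 : X.f = (rightTuple e hH X).gamma.f := h4.trans (CycObj.gammaHom_eq _).symm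
  exact (congrArg (rightTuple e hH X).gammaHom.comp tmap_id).trans
    (h5.symm.trans (congrArg (fun z => Hom.comp z X.f) tmap_id).symm)

/-- The components of the map from a cyclic tuple to `rightTuple` adjoint to `p`. -/
noncomputable def rightComp (A : CycObj M N n) {P : BiMod R S} (p : Hom (A.c 0).mod P) :
    ∀ k : ℕ, Hom (A.c (cycIdx n k)).mod (tensorRight N P k)
  | 0 => p
  -- These components are forced: the target maps are the isomorphisms M ⊗ P_{k+1} ≅ P_k ⊗ N, so the
  -- square at k determines the component at k + 1. `cycIdx` satisfies the successor equation by
  -- definition, so no transport is needed.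
  | k + 1 => (tmap (rightComp A p k) (Hom.id N)).comp
      ((A.f (cycIdx n k)).comp (lunitOf e (A.c (cycIdx n (k + 1))).mod).inv)

theorem rightComp_intertwines (A : CycObj M N n) {P : BiMod R S} (p : Hom (A.c 0).mod P) (k : ℕ) :
    Intertwines (A.f (cycIdx n k)) (rightStep N e P k).hom (rightComp e A p (k + 1))
      (rightComp e A p k) := by
  refine (lunitOf_natural e (rightComp e A p (k + 1))).trans (Hom.funext fun z => ?_)
  exact congrArg (fun y => tmap (rightComp e A p k) (Hom.id N) (A.f (cycIdx n k) y))
    ((lunitOf e (A.c (cycIdx n (k + 1))).mod).hom_inv z)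

theorem rightComp_path (A : CycObj M N n) {P : BiMod R S} (p : Hom (A.c 0).mod P) :
    ∀ (k a b : ℕ) (h : (fun k : ℕ => k + 1)^[k] a = b) (j : Fin n) (hj : cycIdx n b = j)
      (h' : (fun j : Fin n => j + 1)^[k] (cycIdx n a) = j),
      TwistedPath.Map (A.path k (cycIdx n a) j h') (rightPath N e P k a b h) (rightComp e A p a)
        ((rightComp e A p b).comp (castIso (fun j => (A.c j).mod) hj).inv)
  | 0, _, _, rfl, _, rfl, _ => TwistedPath.Map.nil _
  | k + 1, a, b, h, j, hj, h' =>
    TwistedPath.Map.cons (rightComp_intertwines e A p a) (rightComp_path A p k (a + 1) b h j hj h')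

/-- This is the condition for the forced components to close up. After one full turn, the n-th
component and the adjoint of f composed with p solve the same equation over κ, because p is
compatible with ΓA and f; the solution is unique. -/
theorem rightComp_eq (A : CycObj M N n) (X : EndObj (pow M n) (pow N n))
    (p : Hom (A.c 0).mod X.P.mod) (hp : Intertwines A.gamma.f X.f p p) :
    (rightComp e A p n).comp (castIso (fun j => (A.c j).mod) (cycIdx_self n)).inv =
      (rightAdj e X.f).comp p := by
  have h := (nat_succ_iterate n 0).trans (Nat.zero_add n)
  have h1 : (rightPath N e X.P.mod n 0 n h).eval.comp (tmap (Hom.id (pow M n))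
      ((rightComp e A p n).comp (castIso (fun j => (A.c j).mod) (cycIdx_self n)).inv)) =
      (tmap p (Hom.id (pow N n))).comp (A.path n 0 0 (succ_iterate n)).eval :=
    (rightComp_path e A p n 0 n h 0 (cycIdx_self n) (succ_iterate n)).intertwines
  have h2 : X.f.comp (tmap (Hom.id (pow M n)) p) =
      (tmap p (Hom.id (pow N n))).comp (A.path n 0 0 (succ_iterate n)).eval := by
    rw [← A.gammaHom_eq]
    exact hp
  exact rightAdj_unique e h (h1.trans h2.symm)

/-- Where the index does not wrap there is nothing to prove; at the wrap from n to 0 it is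
`rightComp_eq`. -/
theorem rightComp_trans (A : CycObj M N n) (X : EndObj (pow M n) (pow N n))
    (p : Hom (A.c 0).mod X.P.mod) (hp : Intertwines A.gamma.f X.f p p) (i : Fin n) (b : ℕ)
    (hb : cycIdx n b = i) (h : i.val = b ∨ (i = 0 ∧ b = n)) :
    (rightTrans e X.f i.val b).comp ((rightComp e A p i.val).comp
        (castIso (fun j => (A.c j).mod) (cycIdx_val n i)).inv) =
      (rightComp e A p b).comp (castIso (fun j => (A.c j).mod) hb).inv := by
  rcases h with rfl | ⟨rfl, rfl⟩
  · rw [rightTrans_self, Hom.id_comp]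
  · rw [rightComp_eq e A X p hp]
    have h2 : rightTrans e X.f (0 : Fin b).val b = rightAdj e X.f := rightTrans_zero e X.f
    rw [h2]
    rfl

/-- `rightTuple` is right adjoint to `Γ`. -/
theorem exists_to_rightTuple (A : CycObj M N n) (X : EndObj (pow M n) (pow N n))
    (p : Hom (A.c 0).mod X.P.mod) (hp : Intertwines A.gamma.f X.f p p) :
    ∃ q : ∀ j, Hom (A.c j).mod ((rightTuple e hH X).c j).mod,
      (∀ j, Intertwines (A.f j) ((rightTuple e hH X).f j) (q (j + 1)) (q j)) ∧
      q 0 = (rightTupleIso e hH X).hom.comp p ∧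
      (Function.Surjective p → (∀ j, j + 1 ≠ 0 → Function.Surjective (A.f j)) →
        ∀ j, Function.Surjective (q j)) := by
  refine ⟨fun j => (rightComp e A p j.val).comp
    (castIso (fun j => (A.c j).mod) (cycIdx_val n j)).inv, fun j => ?_, rfl, fun h1 h2 j => ?_⟩
  · have e1 : cycIdx n (j.val + 1) = j + 1 := congrArg (· + 1) (cycIdx_val n j)
    have h1 := rightComp_trans e A X p hp (j + 1) (j.val + 1) e1 (fin_val_add_one n j)
    have h2 := (A.intertwines_cast (cycIdx_val n j).symm e1.symm).trans
      (rightComp_intertwines e A p j.val)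
    have h3 : (rightTuple e hH X).f j = (rightStep N e X.P.mod j.val).hom.comp
      (tmap (Hom.id M) (rightTrans e X.f (j + 1).val (j.val + 1))) := rfl
    have h4 : ∀ {i j : Fin n} (h : i = j), (castIso (fun j => (A.c j).mod) h).inv =
        (castIso (fun j => (A.c j).mod) h.symm).hom := by
      rintro i _ rfl
      rfl
    have h5 : (rightStep N e X.P.mod j.val).hom.comp ((tmap (Hom.id M)
        (rightTrans e X.f (j + 1).val (j.val + 1))).comp (tmap (Hom.id M)
          ((rightComp e A p (j + 1).val).comp
            (castIso (fun j => (A.c j).mod) (cycIdx_val n (j + 1))).inv))) =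
        (tmap ((rightComp e A p j.val).comp
          (castIso (fun j => (A.c j).mod) (cycIdx_val n j)).inv) (Hom.id N)).comp (A.f j) := by
      rw [tmap_comp, h1, Hom.comp_id, h4, h4]
      exact h2
    exact h5
  -- The components below n use only the maps f_j with j + 1 ≠ 0; the wrapping map is not needed for
  -- surjectivity.
  · have h3 : ∀ k < n, Function.Surjective (rightComp e A p k) := by
      intro k
      induction k with
      | zero => exact fun _ => h1
      | succ k ih =>
        intro hk
        refine (tmap_surjective (ih (Nat.lt_of_succ_lt hk)) Function.surjective_id).comp
          ((h2 _ fun h0 => ?_).comp (lunitOf e _).symm.bijective.2)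
        have h4 : cycIdx n (k + 1) = 0 := h0
        rw [cycIdx_eq] at h4
        have h5 : (k + 1) % n = 0 := by simpa using congrArg Fin.val h4
        rw [Nat.mod_eq_of_lt hk] at h5
        omega
    exact (h3 j.val j.isLt).comp (castIso _ _).symm.bijective.2

/-- The adjunction supplies the criterion's data. Functoriality comes from maps out of the tuple of
X; every map of that tuple except the wrapping one is an isomorphism, so surjections are preserved.
The adjoint of the identity of ΓA gives a map from A to the tuple of ΓA that is an isomorphism at
index 0. -/
theorem gammaMap_bijective_left (e : Iso M (unit R))
    (hH : ∀ P : BiMod R S, P.IsFGP → (BiMod.tensor P N).IsFGP) : Function.Bijective (gammaMap M N n) := by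
  refine gammaMap_bijective_of (rightTuple e hH) (rightTupleIso e hH) (rightTuple_gamma e hH)
    (fun X Y p hp hs => ?_) (fun A => ?_) (fun P => ?_)
  · have h1 : Intertwines (rightTuple e hH X).gamma.f X.f (rightTupleIso e hH X).inv
        (rightTupleIso e hH X).inv :=
      Sq.symm (α := Iso.refl _) (β := Iso.refl _) (rightTuple_gamma e hH X)
    obtain ⟨q, hq, hq0, hqs⟩ := exists_to_rightTuple e hH (rightTuple e hH X) Y
      (p.comp (rightTupleIso e hH X).inv) (h1.trans hp)
    refine ⟨q, hq, hqs (hs.comp (rightTupleIso e hH X).symm.bijective.2) fun j hj => ?_, ?_⟩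
    · have h2 : (j + 1).val = j.val + 1 := (fin_val_add_one n j).resolve_right fun h => hj h.1
      refine (rightStep N e X.P.mod j.val).bijective.2.comp
        (tmap_surjective Function.surjective_id ?_)
      have h3 : ∀ a b, a = b → Function.Surjective (rightTrans e X.f a b) := by
        rintro a _ rfl
        rw [rightTrans_self]
        exact Function.surjective_id
      exact h3 _ _ h2
    · rw [hq0]
      refine Hom.funext fun x => ?_
      exact congrArg (fun y => (rightTupleIso e hH Y).hom (p y))
        ((rightTupleIso e hH X).hom_inv x)
  · obtain ⟨q, hq, hq0, -⟩ := exists_to_rightTuple e hH A A.gamma (Hom.id _)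
      ((Sq.refl A.gamma.f : Intertwines _ _ _ _))
    refine KTildeCyc.cls_eq_of_bijective_at _ _ q hq 0 ?_
    rw [hq0]
    exact (rightTupleIso e hH A.gamma).bijective
  -- The map at the last index n - 1 is the one built from f, so it vanishes for f = 0, and one zero
  -- map kills the class.
  · obtain ⟨j, hj⟩ : ∃ j : Fin n, j + 1 = 0 := ⟨-1, neg_add_cancel 1⟩
    have hjn : j.val + 1 = n := by
      rcases fin_val_add_one n j with h | h
      · rw [hj] at h
        simp at h
      · exact h.2
    refine KTildeCyc.cls_eq_zero _ j ?_
    have h0 : rightAdj e (0 : Hom (tensor (pow M n) P.mod) (tensor P.mod (pow N n))) = 0 := by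
      refine (rightAdj_unique e ((nat_succ_iterate n 0).trans (Nat.zero_add n))
        (p := Hom.id _) ?_).symm
      rw [tmap_zero_right, Hom.comp_zero, Hom.zero_comp]
      rfl
    have h1 : rightTrans e (0 : Hom (tensor (pow M n) P.mod) (tensor P.mod (pow N n)))
        (j + 1).val (j.val + 1) = 0 := by
      rw [hj, hjn]
      exact (rightTrans_zero e _).trans h0
    have h2 : (rightTuple e hH (EndObj.zero (pow M n) (pow N n) P)).f j =
      (rightStep N e P.mod j.val).hom.comp (tmap (Hom.id M) (rightTrans e
        (0 : Hom (tensor (pow M n) P.mod) (tensor P.mod (pow N n))) (j + 1).val (j.val + 1))) := rfl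
    rw [h2, h1, tmap_zero_right, Hom.comp_zero]
    rfl

end LeftTrivial

/-! ### The case N ≅ S: a left adjoint of Γ -/

section RightTrivial

open BiMod

variable {R S : Type u} [Ring R] [Ring S] {M : BiMod R R} {N : BiMod S S}

/-- The iterated tensor product `M ⊗ (M ⊗ ⋯ (M ⊗ P))`. -/
def tensorLeft (M : BiMod R R) (P : BiMod R S) : ℕ → BiMod R S
  | 0 => P
  | k + 1 => tensor M (tensorLeft M P k)

theorem tensorLeft_fgp (hG : ∀ P : BiMod R S, P.IsFGP → (BiMod.tensor M P).IsFGP)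
    {P : BiMod R S} (hP : P.IsFGP) : ∀ k, (tensorLeft M P k).IsFGP
  | 0 => hP
  | k + 1 => hG _ (tensorLeft_fgp hG hP k)

variable (e : Iso N (unit S))

variable (M) in
/-- The isomorphism `M ⊗ P_k ≅ (M ⊗ P_k) ⊗ N` for `P_k` the iterated tensor product. -/
def leftStep (P : BiMod R S) (k : ℕ) :
    Iso (tensor M (tensorLeft M P k)) (tensor (tensorLeft M P (k + 1)) N) :=
  (runitOf e (tensorLeft M P (k + 1))).symm

variable (M) in
/-- The path of the isomorphisms `leftStep`. -/
def leftPath (P : BiMod R S) : ∀ n : ℕ, TwistedPath M N n (tensorLeft M P n) P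
  | 0 => TwistedPath.nil P
  | k + 1 => TwistedPath.cons (leftStep M e P k).hom (leftPath P k)

theorem leftPath_bijective (P : BiMod R S) : ∀ n : ℕ, Function.Bijective (leftPath M e P n).eval
  | 0 => composeNil_bijective P
  | k + 1 => composeStep_bijective (leftStep M e P k).bijective (leftPath_bijective P k)

variable {n : ℕ}

/-- The map `P_n → P` adjoint to `f : M^{⊗ n} ⊗ P → P ⊗ N^{⊗ n}`. -/
noncomputable def leftAdj {P : BiMod R S} (f : Hom (tensor (pow M n) P) (tensor P (pow N n))) :
    Hom (tensorLeft M P n) P :=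
  (runitOf (powUnit e n) P).hom.comp <| f.comp <|
    (Iso.ofBijective _ (leftPath_bijective e P n)).inv.comp
      (runitOf (powUnit e n) (tensorLeft M P n)).inv

/-- The path again evaluates to an isomorphism κ, but the unknown g now sits on the target side: (g
⊗ 1) ∘ κ = f, solved through N^{⊗ n} ≅ S. -/
theorem leftAdj_spec {P : BiMod R S} (f : Hom (tensor (pow M n) P) (tensor P (pow N n))) :
    (tmap (leftAdj e f) (Hom.id (pow N n))).comp (leftPath M e P n).eval = f := by
  let κ := Iso.ofBijective _ (leftPath_bijective (M := M) e P n)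
  have hκ : leftAdj e f = (runitOf (powUnit e n) P).hom.comp
    (f.comp (κ.inv.comp (runitOf (powUnit e n) (tensorLeft M P n)).inv)) := rfl
  refine Hom.funext fun z => (runitOf (powUnit e n) _).bijective.1 ?_
  have h2 := DFunLike.congr_fun (runitOf_natural (powUnit e n) (leftAdj e f)) (κ.hom z)
  rw [Hom.comp_apply] at h2
  refine h2.trans ?_
  rw [hκ]
  refine congrArg (runitOf (powUnit e n) P).hom (congrArg f ?_)
  exact (congrArg κ.inv ((runitOf (powUnit e n) (tensorLeft M P n)).hom_inv (κ.hom z))).trans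
    (κ.hom_inv z)

theorem leftAdj_unique {P : BiMod R S} {f : Hom (tensor (pow M n) P) (tensor P (pow N n))}
    {Q : BiMod R S} {g : Hom (tensorLeft M P n) Q} {p : Hom P Q}
    (hg : (tmap g (Hom.id (pow N n))).comp (leftPath M e P n).eval =
      (tmap p (Hom.id (pow N n))).comp f) : g = p.comp (leftAdj e f) := by
  refine tmap_right_cancel (powUnit e n) (Hom.funext fun z => ?_)
  obtain ⟨z, rfl⟩ := (leftPath_bijective e P n).2 z
  have h1 := DFunLike.congr_fun hg z
  have h2 := congrArg (tmap p (Hom.id (pow N n))) (DFunLike.congr_fun (leftAdj_spec e f) z)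
  rw [Hom.comp_apply, tmap_comp_apply, Hom.comp_id] at h2
  exact h1.trans h2.symm

/-- The identity of `P_a` for `a = b`, and the map `P_n → P_0` adjoint to `f` for `a = n`,
`b = 0`. -/
noncomputable def leftTrans {P : BiMod R S} (f : Hom (tensor (pow M n) P) (tensor P (pow N n)))
    (a b : ℕ) : Hom (tensorLeft M P a) (tensorLeft M P b) :=
  if h : a = b then (castIso (tensorLeft M P) h).hom
  else if h : n = a ∧ 0 = b then
    (castIso (tensorLeft M P) h.2).hom.comp
      ((leftAdj e f).comp (castIso (tensorLeft M P) h.1).inv)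
  else 0

theorem leftTrans_eq {P : BiMod R S} (f : Hom (tensor (pow M n) P) (tensor P (pow N n)))
    {a b : ℕ} (h : a = b) : leftTrans e f a b = (castIso (tensorLeft M P) h).hom := dif_pos h

theorem leftTrans_zero [NeZero n] {P : BiMod R S}
    (f : Hom (tensor (pow M n) P) (tensor P (pow N n))) {b : ℕ} (h : 0 = b) :
    leftTrans e f n b = (castIso (tensorLeft M P) h).hom.comp (leftAdj e f) := by
  subst h
  exact (dif_neg (NeZero.ne n)).trans (dif_pos ⟨rfl, rfl⟩)

/-- The value of -j counts the successor steps from j to 0. It drops by one at each step, except at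
j = 0, where it jumps from 0 to n - 1. This distance indexes the number of factors M in the tuple
below. -/
theorem fin_neg_val (n : ℕ) [NeZero n] (j : Fin n) :
    (-j).val = (-(j + 1)).val + 1 ∨ ((-j).val = 0 ∧ (-(j + 1)).val + 1 = n) := by
  have h : -(j + 1) + 1 = -j := by rw [neg_add, neg_add_cancel_right]
  have h1 := fin_val_add_one n (-(j + 1))
  rw [h] at h1
  rcases h1 with h1 | ⟨h1, h2⟩
  · exact Or.inl h1
  · rw [h1]
    exact Or.inr ⟨rfl, h2⟩

theorem fin_neg_zero_val (n : ℕ) [NeZero n] : 0 = (-(0 : Fin n)).val := by simp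

theorem fin_neg_iterate (n : ℕ) [NeZero n] (j : Fin n) :
    (fun j : Fin n => j + 1)^[(-j).val] j = 0 := by
  have h : Fin.ofNat n (-j).val = -j := Fin.ext (Nat.mod_eq_of_lt (-j).isLt)
  rw [fin_succ_iterate, h, add_neg_cancel]

variable [NeZero n] (hG : ∀ P : BiMod R S, P.IsFGP → (BiMod.tensor M P).IsFGP)

/-- The cyclic tuple `(f, 1, …, 1)` on `P, …, M ⊗ M ⊗ P, M ⊗ P`. -/
noncomputable def leftTuple (X : EndObj (pow M n) (pow N n)) : CycObj M N n where
  c j := ⟨tensorLeft M X.P.mod (-j).val, tensorLeft_fgp hG X.P.fgp (-j).val⟩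
  f j := (tmap (leftTrans e X.f ((-(j + 1)).val + 1) (-j).val) (Hom.id N)).comp
    (leftStep M e X.P.mod (-(j + 1)).val).hom

theorem leftTuple_intertwines (X : EndObj (pow M n) (pow N n)) (j : Fin n) :
    Intertwines (leftStep M e X.P.mod (-(j + 1)).val).hom ((leftTuple e hG X).f j)
      (leftTrans e X.f (-(j + 1)).val (-(j + 1)).val)
      (leftTrans e X.f ((-(j + 1)).val + 1) (-j).val) := by
  rw [leftTrans_eq e X.f (rfl : (-(j + 1)).val = (-(j + 1)).val)]
  exact congrArg ((leftTuple e hG X).f j).comp tmap_id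

/-- The unrolling now takes place at the start of the path: the map built from f sits at index 0,
and all later transitions are identities up to transport. -/
theorem leftTuple_path (X : EndObj (pow M n) (pow N n)) :
    ∀ (k : ℕ) (j : Fin n) (h : (fun j : Fin n => j + 1)^[k] j = 0),
      ((-j).val = k ∨ ((-j).val = 0 ∧ k = n)) →
      TwistedPath.Map (leftPath M e X.P.mod k) ((leftTuple e hG X).path k j 0 h)
        (leftTrans e X.f k (-j).val) (leftTrans e X.f 0 (-(0 : Fin n)).val)
  | 0, _, rfl, _ => TwistedPath.Map.nil _
  | k + 1, j, h, hja => by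
    have ha : (-(j + 1)).val = k := by
      have := fin_neg_val n j
      have := (-j).isLt
      omega
    subst ha
    exact TwistedPath.Map.cons (leftTuple_intertwines e hG X j)
      (leftTuple_path X _ (j + 1) h (Or.inl rfl))

/-- The identification of `P` with the first entry of the tuple. -/
noncomputable def leftTupleIso (X : EndObj (pow M n) (pow N n)) :
    Iso X.P.mod ((leftTuple e hG X).c 0).mod :=
  castIso (tensorLeft M X.P.mod) (i := 0) (j := (-(0 : Fin n)).val) (fin_neg_zero_val n)

/-- The first transition of the unrolled path contributes the adjoint g, and the remaining canonical
maps contribute κ. Their composite (g ⊗ 1) ∘ κ is f. -/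
theorem leftTuple_gamma (X : EndObj (pow M n) (pow N n)) :
    Intertwines X.f (leftTuple e hG X).gamma.f (leftTupleIso e hG X).hom
      (leftTupleIso e hG X).hom := by
  have h1 := (leftTuple_path e hG X n 0 (succ_iterate n)
    (Or.inr ⟨(fin_neg_zero_val n).symm, rfl⟩)).intertwines
  have h2 : leftTrans e X.f n (-(0 : Fin n)).val =
    (leftTupleIso e hG X).hom.comp (leftAdj e X.f) := leftTrans_zero e X.f (fin_neg_zero_val n)
  have h3 : leftTrans e X.f 0 (-(0 : Fin n)).val = (leftTupleIso e hG X).hom :=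
    leftTrans_eq e X.f (fin_neg_zero_val n)
  rw [h2, h3] at h1
  have h4 : ((leftTuple e hG X).path n 0 0 (succ_iterate n)).eval.comp
      (tmap (Hom.id (pow M n)) (leftTupleIso e hG X).hom) =
        (tmap ((leftTupleIso e hG X).hom.comp (leftAdj e X.f))
          ((Hom.id (pow N n)).comp (Hom.id (pow N n)))).comp (leftPath M e X.P.mod n).eval := h1
  rw [← tmap_comp, Hom.comp_assoc, leftAdj_spec, ← CycObj.gammaHom_eq] at h4
  exact h4

/-- The components of the map from `leftTuple` to a cyclic tuple adjoint to `p`. -/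
noncomputable def leftComp (A : CycObj M N n) {P : BiMod R S} (p : Hom P (A.c 0).mod) :
    ∀ (k : ℕ) (j : Fin n), (fun j : Fin n => j + 1)^[k] j = 0 →
      Hom (tensorLeft M P k) (A.c j).mod
  | 0, _, h => (castIso (fun j => (A.c j).mod) h).inv.comp p
  -- The isomorphism c_j ⊗ N ≅ c_j makes the component on M ⊗ P_k forced by the one on P_k. The
  -- recursion is on the distance k from j to 0, so it descends along successors of j.
  | k + 1, j, h => (runitOf e (A.c j).mod).hom.comp
      ((A.f j).comp (tmap (Hom.id M) (leftComp A p k (j + 1) h)))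

theorem leftComp_intertwines (A : CycObj M N n) {P : BiMod R S} (p : Hom P (A.c 0).mod) (k : ℕ)
    (j : Fin n) (h : (fun j : Fin n => j + 1)^[k + 1] j = 0) :
    Intertwines (leftStep M e P k).hom (A.f j) (leftComp e A p k (j + 1) h)
      (leftComp e A p (k + 1) j h) := by
  refine Hom.funext fun z => (runitOf e (A.c j).mod).bijective.1 ?_
  have h1 := DFunLike.congr_fun (runitOf_natural e (leftComp e A p (k + 1) j h))
    ((leftStep M e P k).hom z)
  rw [Hom.comp_apply] at h1
  refine Eq.trans ?_ h1.symm
  exact (congrArg (leftComp e A p (k + 1) j h)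
    ((runitOf e (tensorLeft M P (k + 1))).inv_hom z)).symm

theorem leftComp_path (A : CycObj M N n) {P : BiMod R S} (p : Hom P (A.c 0).mod) :
    ∀ (k : ℕ) (j : Fin n) (h : (fun j : Fin n => j + 1)^[k] j = 0),
      TwistedPath.Map (leftPath M e P k) (A.path k j 0 h) (leftComp e A p k j h) p
  | 0, _, rfl => TwistedPath.Map.nil _
  | k + 1, j, h =>
    TwistedPath.Map.cons (leftComp_intertwines e A p k j h) (leftComp_path A p k (j + 1) h)

/-- The closing condition: after a full turn the forced component and p composed with the adjoint of
f agree, by uniqueness of the solution of (g ⊗ 1) ∘ κ = (p ⊗ 1) ∘ f. -/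
theorem leftComp_eq (A : CycObj M N n) (X : EndObj (pow M n) (pow N n))
    (p : Hom X.P.mod (A.c 0).mod) (hp : Intertwines X.f A.gamma.f p p) :
    leftComp e A p n 0 (succ_iterate n) = p.comp (leftAdj e X.f) := by
  have h1 : (A.path n 0 0 (succ_iterate n)).eval.comp (tmap (Hom.id (pow M n)) p) =
      (tmap (leftComp e A p n 0 (succ_iterate n)) (Hom.id (pow N n))).comp
        (leftPath M e X.P.mod n).eval :=
    (leftComp_path e A p n 0 (succ_iterate n)).intertwines
  have h2 : (A.path n 0 0 (succ_iterate n)).eval.comp (tmap (Hom.id (pow M n)) p) =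
      (tmap p (Hom.id (pow N n))).comp X.f := by
    rw [← A.gammaHom_eq]
    exact hp
  exact leftAdj_unique e (h1.symm.trans h2)

theorem leftComp_trans (A : CycObj M N n) (X : EndObj (pow M n) (pow N n))
    (p : Hom X.P.mod (A.c 0).mod) (hp : Intertwines X.f A.gamma.f p p) (a b : ℕ) (j : Fin n)
    (ha : (fun j : Fin n => j + 1)^[a] j = 0) (hb : (fun j : Fin n => j + 1)^[b] j = 0)
    (h : a = b ∨ (b = 0 ∧ a = n)) :
    (leftComp e A p b j hb).comp (leftTrans e X.f a b) = leftComp e A p a j ha := by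
  rcases h with rfl | ⟨rfl, rfl⟩
  · rw [leftTrans_eq e X.f rfl]
    rfl
  · obtain rfl : j = 0 := hb
    rw [leftTrans_zero e X.f rfl]
    exact (leftComp_eq e A X p hp).symm

theorem leftComp_zero (A : CycObj M N n) {P : BiMod R S} (p : Hom P (A.c 0).mod) (b : ℕ)
    (h : 0 = b) (hb : (fun j : Fin n => j + 1)^[b] 0 = (0 : Fin n)) :
    (leftComp e A p b 0 hb).comp (castIso (tensorLeft M P) h).hom = p := by
  subst h
  rfl

/-- `leftTuple` is left adjoint to `Γ`. -/
theorem exists_from_leftTuple (A : CycObj M N n) (X : EndObj (pow M n) (pow N n))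
    (p : Hom X.P.mod (A.c 0).mod) (hp : Intertwines X.f A.gamma.f p p) :
    ∃ q : ∀ j, Hom ((leftTuple e hG X).c j).mod (A.c j).mod,
      (∀ j, Intertwines ((leftTuple e hG X).f j) (A.f j) (q (j + 1)) (q j)) ∧
      (q 0).comp (leftTupleIso e hG X).hom = p ∧
      (Function.Surjective p → (∀ j, j ≠ 0 → Function.Surjective (A.f j)) →
        ∀ j, Function.Surjective (q j)) := by
  refine ⟨fun j => leftComp e A p (-j).val j (fin_neg_iterate n j), fun j => ?_,
    leftComp_zero e A p _ (fin_neg_zero_val n) _, fun h1 h2 j => ?_⟩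
  · have h0 : (fun j : Fin n => j + 1)^[(-(j + 1)).val + 1] j = 0 := fin_neg_iterate n (j + 1)
    have h1 := leftComp_intertwines e A p (-(j + 1)).val j h0
    rw [← leftComp_trans e A X p hp ((-(j + 1)).val + 1) (-j).val j h0 (fin_neg_iterate n j)
      ((fin_neg_val n j).imp Eq.symm id)] at h1
    have h3 : (A.f j).comp (tmap (Hom.id M)
          (leftComp e A p (-(j + 1)).val (j + 1) (fin_neg_iterate n (j + 1)))) =
        (tmap ((leftComp e A p (-j).val j (fin_neg_iterate n j)).comp
          (leftTrans e X.f ((-(j + 1)).val + 1) (-j).val)) ((Hom.id N).comp (Hom.id N))).comp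
            (leftStep M e X.P.mod (-(j + 1)).val).hom := h1
    rw [← tmap_comp, Hom.comp_assoc] at h3
    exact h3
  -- A path of length less than n ending at 0 meets index 0 only at its end, so the map f_0 is never
  -- used and need not be surjective.
  · have h3 : ∀ k < n, ∀ (j : Fin n) (h : (fun j : Fin n => j + 1)^[k] j = 0),
        Function.Surjective (leftComp e A p k j h) := by
      intro k
      induction k with
      | zero => exact fun _ j h => (castIso _ h).symm.bijective.2.comp h1
      | succ k ih =>
        intro hk j h
        refine (runitOf e _).bijective.2.comp ((h2 j fun h0 => ?_).comp
          (tmap_surjective Function.surjective_id (ih (Nat.lt_of_succ_lt hk) (j + 1) h)))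
        rw [fin_succ_iterate, h0, zero_add] at h
        have h5 : (k + 1) % n = 0 := by simpa using congrArg Fin.val h
        rw [Nat.mod_eq_of_lt hk] at h5
        omega
    exact h3 _ (-j).isLt _ _

/-- The mirror image, with maps from the tuple of ΓA to A. The tuple of X uses M ⊗ -, which
preserves surjections but in general not injections; this is why the criterion asks only for
surjections. -/
theorem gammaMap_bijective_right (e : Iso N (unit S))
    (hG : ∀ P : BiMod R S, P.IsFGP → (BiMod.tensor M P).IsFGP) :
    Function.Bijective (gammaMap M N n) := by
  refine gammaMap_bijective_of (leftTuple e hG) (leftTupleIso e hG) (leftTuple_gamma e hG)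
    (fun X Y p hp hs => ?_) (fun A => ?_) (fun P => ?_)
  · obtain ⟨q, hq, hq0, hqs⟩ := exists_from_leftTuple e hG (leftTuple e hG Y) X
      ((leftTupleIso e hG Y).hom.comp p) (hp.trans (leftTuple_gamma e hG Y))
    refine ⟨q, hq, hqs ((leftTupleIso e hG Y).bijective.2.comp hs) fun j hj => ?_, hq0⟩
    have h2 : (-(j + 1)).val + 1 = (-j).val := by
      refine ((fin_neg_val n j).resolve_right fun h => hj ?_).symm
      exact neg_eq_zero.1 (Fin.ext h.1)
    have h3 : ∀ a b, a = b → Function.Surjective (leftTrans e Y.f a b) := by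
      rintro a b h
      rw [leftTrans_eq e Y.f h]
      exact (castIso _ h).bijective.2
    exact (tmap_surjective (h3 _ _ h2) Function.surjective_id).comp
      (leftStep M e Y.P.mod (-(j + 1)).val).bijective.2
  · obtain ⟨q, hq, hq0, -⟩ := exists_from_leftTuple e hG A A.gamma (Hom.id _)
      ((Sq.refl A.gamma.f : Intertwines _ _ _ _))
    refine (KTildeCyc.cls_eq_of_bijective_at _ _ q hq 0 ?_).symm
    have h1 : q 0 = (leftTupleIso e hG A.gamma).inv := by
      refine Hom.funext fun x => ?_
      have h2 := DFunLike.congr_fun hq0 ((leftTupleIso e hG A.gamma).inv x)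
      rw [Hom.comp_apply, (leftTupleIso e hG A.gamma).inv_hom] at h2
      exact h2
    rw [h1]
    exact (leftTupleIso e hG A.gamma).symm.bijective
  -- Index 1 has distance n - 1 to 0, also for n = 1, where it is 0 itself. Hence the map at index 0
  -- is the one built from f, and it vanishes for f = 0.
  · have hn : (-((0 : Fin n) + 1)).val + 1 = n := by
      rcases fin_neg_val n 0 with h | h
      · have := fin_neg_zero_val n
        omega
      · exact h.2
    refine KTildeCyc.cls_eq_zero _ 0 ?_
    have h0 : leftAdj e (0 : Hom (tensor (pow M n) P.mod) (tensor P.mod (pow N n))) = 0 := by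
      have h := leftAdj_unique e
        (f := (0 : Hom (tensor (pow M n) P.mod) (tensor P.mod (pow N n))))
        (g := (0 : Hom (tensorLeft M P.mod n) P.mod)) (p := Hom.id P.mod) (by
          rw [tmap_zero_left, Hom.zero_comp, Hom.comp_zero])
      rw [Hom.id_comp] at h
      exact h.symm
    have h1 : leftTrans e (0 : Hom (tensor (pow M n) P.mod) (tensor P.mod (pow N n)))
        ((-((0 : Fin n) + 1)).val + 1) (-(0 : Fin n)).val = 0 := by
      rw [hn, leftTrans_zero e _ (fin_neg_zero_val n)]
      exact (congrArg (castIso (tensorLeft M P.mod) (fin_neg_zero_val n)).hom.comp h0).trans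
        (Hom.comp_zero _)
    have h2 : (leftTuple e hG (EndObj.zero (pow M n) (pow N n) P)).f 0 =
      (tmap (leftTrans e (0 : Hom (tensor (pow M n) P.mod) (tensor P.mod (pow N n)))
        ((-((0 : Fin n) + 1)).val + 1) (-(0 : Fin n)).val) (Hom.id N)).comp
          (leftStep M e P.mod (-((0 : Fin n) + 1)).val).hom := rfl
    rw [h2, h1, tmap_zero_left, Hom.zero_comp]
    rfl

end RightTrivial

/-! ### Tensor powers as coefficients, and change of coefficients -/

section Transfer

open BiMod

variable {R S : Type u} [Ring R] [Ring S] {M : BiMod R R} {N : BiMod S S}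

theorem BiMod.pow_tensor_fgp (hG : ∀ P : BiMod R S, P.IsFGP → (BiMod.tensor M P).IsFGP) :
    ∀ (n : ℕ) (P : BiMod R S), P.IsFGP → (tensor (pow M n) P).IsFGP
  | 0, P, hP => hP.of_iso (lunit P).symm
  | n + 1, P, hP => (hG _ (pow_tensor_fgp hG n P hP)).of_iso (assoc M (pow M n) P).symm

theorem BiMod.tensor_pow_fgp (hH : ∀ P : BiMod R S, P.IsFGP → (BiMod.tensor P N).IsFGP) :
    ∀ (n : ℕ) (P : BiMod R S), P.IsFGP → (tensor P (pow N n)).IsFGP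
  | 0, P, hP => hP.of_iso (runit P).symm
  | n + 1, P, hP => (tensor_pow_fgp hH n _ (hH P hP)).of_iso (assoc P N (pow N n))

theorem gammaMap_bijective (hG : ∀ P : BiMod R S, P.IsFGP → (BiMod.tensor M P).IsFGP)
    (hH : ∀ P : BiMod R S, P.IsFGP → (BiMod.tensor P N).IsFGP)
    (hMN : Nonempty (Iso M (unit R)) ∨ Nonempty (Iso N (unit S))) (n : ℕ) [NeZero n] :
    Function.Bijective (gammaMap M N n) := by
  rcases hMN with ⟨⟨e⟩⟩ | ⟨⟨e⟩⟩
  · exact gammaMap_bijective_left e hH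
  · exact gammaMap_bijective_right e hG

/-- All hypotheses pass to tensor powers: preservation of finitely generated projectives by
iteration, and M^{⊗ n} ≅ R from M ≅ R. -/
theorem gammaMap_pow_bijective (hG : ∀ P : BiMod R S, P.IsFGP → (BiMod.tensor M P).IsFGP)
    (hH : ∀ P : BiMod R S, P.IsFGP → (BiMod.tensor P N).IsFGP)
    (hMN : Nonempty (Iso M (unit R)) ∨ Nonempty (Iso N (unit S))) (n m : ℕ) [NeZero m] :
    Function.Bijective (gammaMap (pow M n) (pow N n) m) :=
  gammaMap_bijective (pow_tensor_fgp hG n) (tensor_pow_fgp hH n)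
    (hMN.imp (fun ⟨e⟩ => ⟨powUnit e n⟩) fun ⟨e⟩ => ⟨powUnit e n⟩) m

theorem coeffMap_cls_eq {M' : BiMod R R} {N' : BiMod S S} (e : Iso M M') (e' : Iso N N')
    (A : EndObj M N) (B : EndObj M' N') (h : Iso A.P.mod B.P.mod)
    (H : Sq e.hom e'.hom h.hom h.hom A.f B.f) :
    coeffMap e e' (KTilde.cls A) = KTilde.cls B := by
  refine KTilde.cls_eq_of_bijective
    (A := ⟨A.P, (tmap (Hom.id A.P.mod) e'.hom).comp (A.f.comp (tmap e.inv (Hom.id A.P.mod)))⟩)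
    h.hom (hom_ext fun x p => ?_) h.bijective
  have h1 := H.apply (pure (e.inv x) p)
  rw [tmap_pure, e.inv_hom] at h1
  refine h1.trans ?_
  exact (tmap_comp_apply (Hom.id A.P.mod) e'.hom h.hom (Hom.id N') _).symm

theorem coeffMap_injective {M' : BiMod R R} {N' : BiMod S S} (e : Iso M M') (e' : Iso N N') :
    Function.Injective (coeffMap e e' : KTilde M N → KTilde M' N') := by
  have h : ∀ x : KTilde M N, coeffMap e.symm e'.symm (coeffMap e e' x) = x := fun x => by
    induction x using K0Red.induction with
    | h0 => rw [map_zero, map_zero]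
    | hcls A =>
      refine coeffMap_cls_eq e.symm e'.symm
        ⟨A.P, (tmap (Hom.id A.P.mod) e'.hom).comp (A.f.comp (tmap e.inv (Hom.id A.P.mod)))⟩ A
        (Iso.refl _) (hom_ext fun x p => ?_)
      exact ((tmap_comp_apply (Hom.id A.P.mod) e'.hom (Hom.id A.P.mod) e'.inv _).trans (by
        rw [e'.inv_comp_hom, Hom.comp_id, tmap_id_apply]; rfl)).symm
    | hneg x hx => rw [map_neg, map_neg, hx]
    | hadd x y hx hy => rw [map_add, map_add, hx, hy]
  exact Function.LeftInverse.injective h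

end Transfer

/-! ### Direct sums -/

section Sums

variable {R S : Type u} [Ring R] [Ring S]

namespace BiMod

variable {I : Type}

/-- The direct sum of a finite family indexed by an arbitrary finite type. -/
def piMod (c : I → BiMod R S) : BiMod R S := ⟨∀ i, c i⟩

theorem piMod_fgp [Fintype I] (c : I → BiMod R S) (h : ∀ i, (c i).IsFGP) : (piMod c).IsFGP where
  finite := by
    have := fun i => (h i).finite
    exact (inferInstance : Module.Finite Sᵐᵒᵖ (∀ i, c i))
  projective := by
    classical
    have := fun i => (h i).projective
    exact Module.Projective.of_equiv (DFinsupp.linearEquivFunOnFintype (R := Sᵐᵒᵖ)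
      (M := fun i => (c i).carrier))

/-- The projection `⨁_i c_i → c_i`. -/
def piProj (c : I → BiMod R S) (i : I) : Hom (piMod c) (c i) where
  toFun := Pi.evalAddMonoidHom (fun i => (c i).carrier) i
  map_left _ _ := rfl
  map_right _ _ := rfl

theorem Hom.sum_comp_eq [Fintype I] {X Y Z : BiMod R S} (F : I → Hom Y Z) (g : Hom X Y) (i : I)
    (h : ∀ k, k ≠ i → (F k).comp g = 0) : (Hom.sum F).comp g = (F i).comp g := by
  refine Hom.funext fun x => ?_
  rw [Hom.comp_apply, Hom.sum_apply]
  exact Finset.sum_eq_single_of_mem i (Finset.mem_univ i) fun k _ hk => DFunLike.congr_fun (h k hk) x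

variable [DecidableEq I]

/-- The inclusion `c_i → ⨁_i c_i`. -/
def piIncl (c : I → BiMod R S) (i : I) : Hom (c i) (piMod c) where
  toFun := AddMonoidHom.single (fun i => (c i).carrier) i
  map_left r x := Pi.single_smul (f := fun i => (c i).carrier) i r x
  map_right s x := Pi.single_smul (f := fun i => (c i).carrier) i (op s) x

theorem piProj_piIncl_self (c : I → BiMod R S) (i : I) :
    (piProj c i).comp (piIncl c i) = Hom.id (c i) :=
  Hom.funext fun x => Pi.single_eq_same (M := fun i => (c i).carrier) i x

theorem piProj_piIncl_of_ne (c : I → BiMod R S) {i j : I} (h : i ≠ j) :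
    (piProj c i).comp (piIncl c j) = 0 :=
  Hom.funext fun x => Pi.single_eq_of_ne (M := fun i => (c i).carrier) h x

theorem sum_piIncl_piProj [Fintype I] (c : I → BiMod R S) (x : piMod c) :
    ∑ i, piIncl c i (piProj c i x) = x :=
  Finset.univ_sum_single (M := fun i => (c i).carrier) x

theorem tensor_piMod_hom_ext [Fintype I] {X : BiMod R R} {Y : BiMod R S} {c : I → BiMod R S}
    {f g : Hom (tensor X (piMod c)) Y}
    (h : ∀ i, f.comp (tmap (Hom.id X) (piIncl c i)) = g.comp (tmap (Hom.id X) (piIncl c i))) :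
    f = g := by
  refine hom_ext fun x p => ?_
  rw [← sum_piIncl_piProj c p, ← pureHom_apply, map_sum, map_sum, map_sum]
  exact Finset.sum_congr rfl fun i _ => DFunLike.congr_fun (h i) (pure x (piProj c i p))

end BiMod

variable {M : BiMod R R} {N : BiMod S S}

/-- On the summand c_{j+1} only the j-th term of the sum survives. Thus the inclusions carry paths
in A to iterates of the single map on the direct sum, which drives both the composition law and the
trace formula. -/
theorem CycObj.sigmaHom_incl {n : ℕ} [NeZero n] (A : CycObj M N n) (j : Fin n) :
    Intertwines (A.f j) A.sigmaHom (incl (fun j => (A.c j).mod) (j + 1))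
      (incl (fun j => (A.c j).mod) j) := by
  refine (Hom.sum_comp_eq _ _ j fun k hk => ?_).trans ?_
  · rw [Hom.comp_assoc, Hom.comp_assoc, tmap_comp]
    have h : (proj (fun j => (A.c j).mod) (k + 1)).comp (incl (fun j => (A.c j).mod) (j + 1)) = 0 :=
      piProj_piIncl_of_ne (fun j => (A.c j).mod) fun h => hk (add_right_cancel h)
    rw [h, tmap_zero_right, Hom.comp_zero, Hom.comp_zero]
  · rw [Hom.comp_assoc, Hom.comp_assoc, tmap_comp]
    have h : (proj (fun j => (A.c j).mod) (j + 1)).comp (incl (fun j => (A.c j).mod) (j + 1)) =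
        Hom.id _ := piProj_piIncl_self (fun j => (A.c j).mod) (j + 1)
    rw [h, Hom.comp_id, tmap_id, Hom.comp_id]

end Sums

/-! ### Partial cyclic sums -/

section Fold

variable {R S : Type u} [Ring R] [Ring S] {M : BiMod R R} {N : BiMod S S} {l n : ℕ} [NeZero l]
  [NeZero n]

/-- The cyclic tuple of the sums of the entries of `A` over the fibres of `r`. -/
def CycObj.fold (A : CycObj M N l) (r : Fin l → Fin n) (hr : ∀ i, r (i + 1) = r i + 1) :
    CycObj M N n where
  c b := ⟨piMod fun i : {i // r i = b} => (A.c i.1).mod, piMod_fgp _ fun i => (A.c i.1).fgp⟩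
  f b := Hom.sum fun i : {i // r i = b} =>
    (tmap (piIncl (fun i : {i // r i = b} => (A.c i.1).mod) i) (Hom.id N)).comp ((A.f i.1).comp
      (tmap (Hom.id M) (piProj (fun i : {i // r i = b + 1} => (A.c i.1).mod)
        ⟨i.1 + 1, (hr i.1).trans (congrArg (· + 1) i.2)⟩)))

variable (A : CycObj M N l) (r : Fin l → Fin n) (hr : ∀ i, r (i + 1) = r i + 1)

/-- The inclusion of an entry of `A` in an entry of `A.fold`. -/
def CycObj.foldIncl (i : Fin l) (b : Fin n) (h : r i = b) :
    Hom (A.c i).mod ((A.fold r hr).c b).mod :=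
  piIncl (fun i : {i // r i = b} => (A.c i.1).mod) ⟨i, h⟩

theorem CycObj.fold_intertwines (i : Fin l) (b : Fin n) (h : r i = b) (h' : r (i + 1) = b + 1) :
    Intertwines (A.f i) ((A.fold r hr).f b) (A.foldIncl r hr (i + 1) (b + 1) h')
      (A.foldIncl r hr i b h) := by
  let c : ∀ b, {i // r i = b} → BiMod R S := fun b i => (A.c i.1).mod
  let s : {i // r i = b} → {i // r i = b + 1} :=
    fun i => ⟨i.1 + 1, (hr i.1).trans (congrArg (· + 1) i.2)⟩
  have key : ∀ k : {i // r i = b}, ((tmap (piIncl (c b) k) (Hom.id N)).comp ((A.f k.1).comp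
      (tmap (Hom.id M) (piProj (c (b + 1)) (s k))))).comp
        (tmap (Hom.id M) (piIncl (c (b + 1)) ⟨i + 1, h'⟩)) =
      (tmap (piIncl (c b) k) (Hom.id N)).comp ((A.f k.1).comp
        (tmap (Hom.id M) ((piProj (c (b + 1)) (s k)).comp (piIncl (c (b + 1)) ⟨i + 1, h'⟩)))) := by
    intro k
    rw [Hom.comp_assoc, Hom.comp_assoc, tmap_comp, Hom.comp_id]
  refine (Hom.sum_comp_eq (fun k : {i // r i = b} => (tmap (piIncl (c b) k) (Hom.id N)).comp
    ((A.f k.1).comp (tmap (Hom.id M) (piProj (c (b + 1)) (s k)))))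
    (tmap (Hom.id M) (piIncl (c (b + 1)) ⟨i + 1, h'⟩)) ⟨i, h⟩ fun k hk => ?_).trans ?_
  · have h1 : s k ≠ ⟨i + 1, h'⟩ := fun h1 =>
      hk (Subtype.ext (add_right_cancel (congrArg Subtype.val h1)))
    rw [key, piProj_piIncl_of_ne _ h1, tmap_zero_right, Hom.comp_zero, Hom.comp_zero]
  · have h1 := piProj_piIncl_self (c (b + 1)) ⟨i + 1, h'⟩
    refine (key ⟨i, h⟩).trans (congrArg (Hom.comp _) ?_)
    exact (congrArg (fun g => (A.f i).comp (tmap (Hom.id M) g)) h1).trans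
      (congrArg (A.f i).comp tmap_id)

/-- Each entry of A keeps its own path inside the partial sums, because r commutes with the
successor. -/
theorem CycObj.fold_path : ∀ (k : ℕ) (i j : Fin l) (b d : Fin n)
    (h : (fun j : Fin l => j + 1)^[k] i = j) (h' : (fun j : Fin n => j + 1)^[k] b = d)
    (hb : r i = b) (hd : r j = d),
    TwistedPath.Map (A.path k i j h) ((A.fold r hr).path k b d h') (A.foldIncl r hr i b hb)
      (A.foldIncl r hr j d hd)
  | 0, _, _, _, _, rfl, rfl, _, _ => TwistedPath.Map.nil _
  | k + 1, i, j, b, d, h, h', hb, hd =>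
    have hb' : r (i + 1) = b + 1 := (hr i).trans (congrArg (· + 1) hb)
    TwistedPath.Map.cons (A.fold_intertwines r hr i b hb hb')
      (CycObj.fold_path k (i + 1) j (b + 1) d h h' hb' hd)

/-- The regrouping of a direct sum. -/
def CycObj.foldHom : Hom A.sigma.P.mod (A.fold r hr).sigma.P.mod where
  toFun := AddMonoidHom.mk' (fun (x : ∀ i, (A.c i).mod) (b : Fin n) (i : {i // r i = b}) => x i.1)
    fun _ _ => rfl
  map_left _ _ := rfl
  map_right _ _ := rfl

theorem CycObj.foldHom_bijective : Function.Bijective (A.foldHom r hr) := by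
  refine ⟨fun x y h => funext fun i => congrFun (congrFun h (r i)) ⟨i, rfl⟩, fun y =>
    ⟨fun i => y (r i) ⟨i, rfl⟩, ?_⟩⟩
  refine funext fun b => funext fun ⟨i, hi⟩ => ?_
  subst hi
  rfl

theorem CycObj.foldHom_incl (i : Fin l) (b : Fin n) (h : r i = b) :
    (A.foldHom r hr).comp (incl (fun i => (A.c i).mod) i) =
      (incl (fun b => ((A.fold r hr).c b).mod) b).comp (A.foldIncl r hr i b h) := by
  subst h
  refine Hom.funext fun x => funext fun d => funext fun ⟨k, hk⟩ => ?_
  subst hk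
  change Pi.single (M := fun i => (A.c i).mod.carrier) i x k =
    Pi.single (M := fun b => ∀ k : {k // r k = b}, (A.c k.1).mod.carrier) (r i)
      (Pi.single (M := fun k : {k // r k = r i} => (A.c k.1).mod.carrier) ⟨i, rfl⟩ x) (r k) ⟨k, rfl⟩
  -- Both sides are x at k = i and 0 elsewhere. The fibre indices are made variables so that the
  -- equations between them can be substituted, first within one fibre and then across fibres.
  have h1 : ∀ (b : Fin n) (hb : r k = b) (hi : r i = b),
      Pi.single (M := fun i => (A.c i).mod.carrier) i x k =
        Pi.single (M := fun k : {k // r k = b} => (A.c k.1).mod.carrier) ⟨i, hi⟩ x ⟨k, hb⟩ := by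
    intro b hb hi
    by_cases hki : k = i
    · subst hki
      rw [Pi.single_eq_same, Pi.single_eq_same]
    · rw [Pi.single_eq_of_ne hki, Pi.single_eq_of_ne fun h => hki (congrArg Subtype.val h)]
  have h2 : ∀ (d : Fin n) (hd : r k = d), Pi.single (M := fun i => (A.c i).mod.carrier) i x k =
      Pi.single (M := fun b => ∀ k : {k // r k = b}, (A.c k.1).mod.carrier) (r i)
        (Pi.single (M := fun k : {k // r k = r i} => (A.c k.1).mod.carrier) ⟨i, rfl⟩ x) d
          ⟨k, hd⟩ := by
    intro d hd
    by_cases hdi : d = r i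
    · subst hdi
      rw [Pi.single_eq_same]
      exact h1 _ hd rfl
    · rw [Pi.single_eq_of_ne hdi, Pi.single_eq_of_ne fun h => hdi (hd.symm.trans (congrArg r h))]
      rfl
  exact h2 _ rfl

/-- Summing over each fibre and then over the fibres is the same as summing over all indices, and
the regrouping isomorphism respects the cyclic maps on every summand. -/
theorem CycObj.cls_sigma_fold : KTilde.cls A.sigma = KTilde.cls (A.fold r hr).sigma := by
  refine KTilde.cls_eq_of_bijective (A.foldHom r hr) ?_ (A.foldHom_bijective r hr)
  refine tensor_piMod_hom_ext (c := fun i => (A.c i).mod) fun i => ?_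
  obtain ⟨i, rfl⟩ : ∃ k, i = k + 1 := ⟨i - 1, (sub_add_cancel i 1).symm⟩
  have h1 := A.sigmaHom_incl i
  have h2 := (A.fold_intertwines r hr i (r i) rfl (hr i)).trans ((A.fold r hr).sigmaHom_incl (r i))
  rw [← A.foldHom_incl r hr, ← A.foldHom_incl r hr] at h2
  refine hom_ext fun m x => ?_
  have h3 := DFunLike.congr_fun h1 (pure m x)
  have h4 := DFunLike.congr_fun h2 (pure m x)
  refine h4.trans ?_
  refine Eq.trans ?_ (congrArg (tmap (A.foldHom r hr) (Hom.id N)) h3.symm)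
  exact (tmap_comp_apply (incl (fun i => (A.c i).mod) i) (Hom.id N) (A.foldHom r hr) (Hom.id N)
    (A.f i (pure m x))).symm

end Fold

/-! ### Blocks of a cyclic tuple -/

section Blocks

open BiMod

variable {R S : Type u} [Ring R] [Ring S] {M : BiMod R R} {N : BiMod S S}

theorem CycObj.eval_path_zero {l : ℕ} [NeZero l] (A : CycObj M N l) (k : ℕ) (i : Fin l) (hi : i = 0)
    (h : (fun j : Fin l => j + 1)^[k] i = i) (h' : (fun j : Fin l => j + 1)^[k] 0 = (0 : Fin l)) :
    Sq (Hom.id _) (Hom.id _) (castIso (fun j => (A.c j).mod) hi).hom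
      (castIso (fun j => (A.c j).mod) hi).hom (A.path k i i h).eval (A.path k 0 0 h').eval := by
  subst hi
  exact Sq.refl _

variable {l n m : ℕ} [NeZero l] [NeZero n] [NeZero m]

/-- The cyclic tuple over `M^{⊗ n}`, `N^{⊗ n}` of the composites of the blocks of length `n` of `A`
that start at the indices `ι j`. -/
def CycObj.blocks (A : CycObj M N l) (ι : Fin m → Fin l)
    (hι : ∀ j, (fun i : Fin l => i + 1)^[n] (ι j) = ι (j + 1)) :
    CycObj (pow M n) (pow N n) m where
  c j := A.c (ι j)
  f j := (A.path n (ι j) (ι (j + 1)) (hι j)).eval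

section

variable (A : CycObj M N l) (ι : Fin m → Fin l)
    (hι : ∀ j, (fun i : Fin l => i + 1)^[n] (ι j) = ι (j + 1))

section

variable {r : Fin l → Fin n} (hr : ∀ i, r (i + 1) = r i + 1) (hr0 : ∀ j, r (ι j) = 0)

/-- The comparison of an entry of `A.fold` with the direct sum of the entries of the blocks. -/
def CycObj.blocksHom : Hom ((A.fold r hr).c 0).mod (A.blocks ι hι).sigma.P.mod where
  toFun := AddMonoidHom.mk' (fun (x : ∀ i : {i // r i = 0}, (A.c i.1).mod) (j : Fin m) =>
    x ⟨ι j, hr0 j⟩) fun _ _ => rfl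
  map_left _ _ := rfl
  map_right _ _ := rfl

theorem CycObj.blocksHom_incl (hinj : Function.Injective ι) (j : Fin m) :
    (A.blocksHom ι hι hr hr0).comp (A.foldIncl r hr (ι j) 0 (hr0 j)) =
      incl (fun j => (A.c (ι j)).mod) j := by
  refine Hom.funext fun x => funext fun k => ?_
  change Pi.single (M := fun k : {k // r k = 0} => (A.c k.1).mod.carrier) ⟨ι j, hr0 j⟩ x
    ⟨ι k, hr0 k⟩ = Pi.single (M := fun k => (A.c (ι k)).mod.carrier) j x k
  by_cases hk : k = j
  · subst hk
    rw [Pi.single_eq_same, Pi.single_eq_same]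
  · rw [Pi.single_eq_of_ne hk, Pi.single_eq_of_ne fun h => hk (hinj (congrArg Subtype.val h))]

theorem CycObj.blocksHom_bijective (hinj : Function.Injective ι)
    (hsurj : ∀ i, r i = 0 → ∃ j, ι j = i) : Function.Bijective (A.blocksHom ι hι hr hr0) := by
  constructor
  · intro x y h
    refine funext fun ⟨i, hi⟩ => ?_
    obtain ⟨j, rfl⟩ := hsurj i hi
    exact congrFun h j
  · intro y
    choose g hg using hsurj
    refine ⟨fun i => (castIso (fun i => (A.c i).mod) (hg i.1 i.2)).hom (y (g i.1 i.2)),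
      funext fun j => ?_⟩
    have h : ∀ (k : Fin m) (hk : ι k = ι j),
        (castIso (fun i => (A.c i).mod) hk).hom (y k) = y j := by
      intro k hk
      obtain rfl := hinj hk
      rfl
    exact h _ _

/-- Γ of the folded tuple acts on the sum over the fibre of 0. Following one summand for n steps
yields the composite of one block and ends in the summand where that block starts. When ι enumerates
the fibre, this is the cyclic sum of the blocks. -/
theorem CycObj.cls_gamma_fold (hr0 : ∀ j, r (ι j) = 0) (hinj : Function.Injective ι)
    (hsurj : ∀ i, r i = 0 → ∃ j, ι j = i) :
    KTilde.cls (A.fold r hr).gamma = KTilde.cls (A.blocks ι hι).sigma := by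
  refine KTilde.cls_eq_of_bijective (A.blocksHom ι hι hr hr0) ?_
    (A.blocksHom_bijective ι hι hr hr0 hinj hsurj)
  refine tensor_piMod_hom_ext (c := fun i : {i // r i = 0} => (A.c i.1).mod) fun ⟨i, hi⟩ => ?_
  obtain ⟨j, rfl⟩ := hsurj i hi
  obtain ⟨j, rfl⟩ : ∃ k, j = k + 1 := ⟨j - 1, (sub_add_cancel j 1).symm⟩
  have h1 := (A.blocks ι hι).sigmaHom_incl j
  have h2 : Intertwines (A.path n (ι j) (ι (j + 1)) (hι j)).eval (A.fold r hr).gammaHom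
      (A.foldIncl r hr (ι (j + 1)) 0 hi) (A.foldIncl r hr (ι j) 0 (hr0 j)) := by
    rw [CycObj.gammaHom_eq]
    exact (A.fold_path r hr n (ι j) (ι (j + 1)) 0 0 (hι j) (succ_iterate n) (hr0 j) hi).intertwines
  have h3 := A.blocksHom_incl ι hι hr hr0 hinj
  refine hom_ext fun x p => ?_
  have h4 := DFunLike.congr_fun h1 (pure x p)
  have h5 := DFunLike.congr_fun h2 (pure x p)
  refine (congrArg (fun q => (A.blocks ι hι).sigmaHom (pure x q))
    (DFunLike.congr_fun (h3 (j + 1)) p)).trans (h4.trans ?_)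
  refine Eq.trans ?_ (congrArg (tmap (A.blocksHom ι hι hr hr0) (Hom.id (pow N n))) h5.symm)
  refine Eq.trans ?_ (tmap_comp_apply (A.foldIncl r hr (ι j) 0 (hr0 j)) (Hom.id (pow N n))
    (A.blocksHom ι hι hr hr0) (Hom.id (pow N n)) ((A.blocks ι hι).f j (pure x p))).symm
  exact congrArg (fun g => tmap g (Hom.id (pow N n)) ((A.blocks ι hι).f j (pure x p))) (h3 j).symm

end

/-- Composing the composites of the blocks is composing all n m maps, up to the canonical
identification of iterated tensor powers. -/
theorem CycObj.coeffMap_gamma_blocks {n m : ℕ} [NeZero m] [NeZero (n * m)] (A : CycObj M N (n * m))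
    (ι : Fin m → Fin (n * m)) (hι : ∀ j, (fun i : Fin (n * m) => i + 1)^[n] (ι j) = ι (j + 1))
    (h0 : ι 0 = 0) :
    coeffMap (powMul M n m) (powMul N n m) (KTilde.cls (A.blocks ι hι).gamma) =
      KTilde.cls A.gamma := by
  have e : (fun i : Fin (n * m) => i + 1)^[n * m] (ι 0) = ι 0 := by
    rw [h0]
    exact succ_iterate (n * m)
  refine coeffMap_cls_eq _ _ _ _ (castIso (fun j => (A.c j).mod) h0) ?_
  have h1 := TwistedPath.eval_iter_mul (fun i : Fin (n * m) => i + 1) (fun j => (A.c j).mod) A.f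
    (fun j : Fin m => j + 1) ι n hι m 0 0 (succ_iterate m) e
  have h2 := A.eval_path_zero (n * m) (ι 0) h0 e (succ_iterate (n * m))
  have h3 := h1.trans h2
  rw [Hom.comp_id, Hom.id_comp, Hom.id_comp, ← CycObj.gammaHom_eq] at h3
  have h4 : (A.blocks ι hι).gamma.f = _ := (A.blocks ι hι).gammaHom_eq
  rw [h4]
  exact h3

end

/-- The index at which the `j`-th block of length `n` starts. -/
def blockIdx (n m : ℕ) [NeZero n] [NeZero m] (j : Fin m) : Fin (n * m) :=
  ⟨n * j.val, Nat.mul_lt_mul_of_pos_left j.isLt (Nat.pos_of_neZero n)⟩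

theorem blockIdx_iterate [NeZero (n * m)] (j : Fin m) :
    (fun i : Fin (n * m) => i + 1)^[n] (blockIdx n m j) = blockIdx n m (j + 1) := by
  rw [fin_succ_iterate]
  refine Fin.ext ?_
  have h : (j + 1).val = (j.val + 1) % m := by
    rw [Fin.val_add]
    simp
  rw [Fin.val_add]
  -- For m = 1 the inner residue is 0 rather than n, so it is absorbed into the outer one instead of
  -- being simplified.
  change (n * j.val + n % (n * m)) % (n * m) = n * (j + 1).val
  rw [h, ← Nat.mul_mod_mul_left, Nat.add_mod_mod, Nat.mul_succ]

theorem ofNat_val_add_one {n m : ℕ} [NeZero n] [NeZero (n * m)] (i : Fin (n * m)) :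
    Fin.ofNat n (i + 1).val = Fin.ofNat n i.val + 1 := by
  refine Fin.ext ?_
  have h : (Fin.ofNat n i.val + 1).val = (i.val + 1) % n := by
    rw [Fin.val_add]
    simp
  rw [h]
  change (i + 1).val % n = _
  rcases fin_val_add_one (n * m) i with h1 | ⟨h1, h2⟩
  · rw [h1]
  · rw [h1, h2, Nat.mul_mod_right]
    exact Nat.zero_mod n

/-- For a tuple A of length nm, z consists of the blocks starting at the multiples of n, and w of
the sums over residue classes modulo n. Those multiples are exactly the fibre over residue 0, so w
composes to the cyclic sum of z. -/
theorem exists_iterated_blocks [NeZero (n * m)] (y : KTildeCyc M N (n * m)) :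
    ∃ (z : KTildeCyc (pow M n) (pow N n) m) (w : KTildeCyc M N n),
      coeffMap (powMul M n m) (powMul N n m) (gammaMap _ _ m z) = gammaMap M N (n * m) y ∧
      gammaMap M N n w = sigmaMap _ _ m z ∧ sigmaMap M N n w = sigmaMap M N (n * m) y := by
  induction y using K0Red.induction with
  | h0 => exact ⟨0, 0, by simp only [map_zero], by simp only [map_zero], by simp only [map_zero]⟩
  | hcls A =>
    have hι : ∀ j, (fun i : Fin (n * m) => i + 1)^[n] (blockIdx n m j) = blockIdx n m (j + 1) :=
      blockIdx_iterate
    let r : Fin (n * m) → Fin n := fun i => Fin.ofNat n i.val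
    have hr : ∀ i, r (i + 1) = r i + 1 := ofNat_val_add_one
    refine ⟨KTildeCyc.cls (A.blocks (blockIdx n m) hι),
      KTildeCyc.cls (A.fold r hr),
      A.coeffMap_gamma_blocks (blockIdx n m) hι rfl,
      A.cls_gamma_fold (blockIdx n m) hι hr (fun j => ?_) (fun i j h => ?_)
        (fun i hi => ?_),
      (A.cls_sigma_fold r hr).symm⟩
    · exact Fin.ext ((Nat.mul_mod_right n j.val).trans (Nat.zero_mod n).symm)
    · exact Fin.ext (Nat.eq_of_mul_eq_mul_left (Nat.pos_of_neZero n) (congrArg Fin.val h))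
    · have h1 : i.val % n = 0 := (congrArg Fin.val hi).trans (Nat.zero_mod n)
      obtain ⟨k, hk⟩ := Nat.dvd_of_mod_eq_zero h1
      have h2 : k < m := Nat.lt_of_mul_lt_mul_left (hk ▸ i.isLt)
      exact ⟨⟨k, h2⟩, Fin.ext hk.symm⟩
  | hneg y hy =>
    obtain ⟨z, w, h1, h2, h3⟩ := hy
    exact ⟨-z, -w, by simp only [map_neg, h1], by simp only [map_neg, h2], by simp only [map_neg, h3]⟩
  | hadd y y' hy hy' =>
    obtain ⟨z, w, h1, h2, h3⟩ := hy
    obtain ⟨z', w', h1', h2', h3'⟩ := hy'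
    exact ⟨z + z', w + w', by simp only [map_add, h1, h1'], by simp only [map_add, h2, h2'],
      by simp only [map_add, h3, h3']⟩

theorem verschiebungMap_gammaMap (h : Function.Bijective (gammaMap M N n)) (y : KTildeCyc M N n) :
    verschiebungMap M N n h (gammaMap M N n y) = sigmaMap M N n y :=
  congrArg (sigmaMap M N n) ((AddEquiv.ofBijective (gammaMap M N n) h).symm_apply_apply y)

/-- With x the composite of z under Γ, both sides become σw: on the left V^m x = σz = Γw, on the
right σ of the long tuple equals σw. Injectivity of the change of coefficients identifies x with Γz.
-/
theorem verschiebungMap_verschiebungMap [NeZero (n * m)] (h : Function.Bijective (gammaMap M N n))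
    (h' : Function.Bijective (gammaMap (pow M n) (pow N n) m))
    (h'' : Function.Bijective (gammaMap M N (n * m)))
    (x : KTilde (pow (pow M n) m) (pow (pow N n) m)) :
    verschiebungMap M N n h (verschiebungMap (pow M n) (pow N n) m h' x) =
      verschiebungMap M N (n * m) h'' (coeffMap (powMul M n m) (powMul N n m) x) := by
  obtain ⟨y, hy⟩ := h''.2 (coeffMap (powMul M n m) (powMul N n m) x)
  obtain ⟨z, w, h1, h2, h3⟩ := exists_iterated_blocks y
  obtain rfl : gammaMap _ _ m z = x := coeffMap_injective _ _ (h1.trans hy)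
  rw [h1, verschiebungMap_gammaMap, verschiebungMap_gammaMap, ← h2, verschiebungMap_gammaMap, h3]

end Blocks

/-! ### Properties of the trace -/

section TraceProperties

open BiMod

variable {R S : Type u} [Ring R] [Ring S]

theorem DualBasis.expand_tensor {P : BiMod R S} {Y : BiMod S S} (b : DualBasis P) (z : tensor P Y) :
    ∑ k, pure (b.e k) (contract Y (b.φ k) z) = z := by
  induction z using pure_induction with
  | zero => simp
  | mk p y =>
    simp only [contract_pure, ← pure_balanced]
    conv_rhs => rw [← b.expand p, ← pureHom_apply, map_sum, AddMonoidHom.finsetSum_apply]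
    rfl
  | add z w hz hw =>
    conv_rhs => rw [← hz, ← hw]
    simp only [map_add, pure_add_right, Finset.sum_add_distrib]

theorem contract_assocAux {P : BiMod R S} {Y Y' : BiMod S S} (φ : P →ₗ[Sᵐᵒᵖ] S) (w : tensor P Y)
    (y : Y') : contract (tensor Y Y') φ (assocAux P Y Y' w y) = pure (contract Y φ w) y := by
  induction w using pure_induction with
  | zero => simp
  | mk p y' => rfl
  | add a b ha hb => simp only [map_add, AddMonoidHom.add_apply, ha, hb, pure_add_left]

theorem contract_tmap_right {P : BiMod R S} {Y Y' : BiMod S S} (φ : P →ₗ[Sᵐᵒᵖ] S) (β : Hom Y Y')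
    (z : tensor P Y) : contract Y' φ (tmap (Hom.id P) β z) = β (contract Y φ z) := by
  induction z using pure_induction with
  | zero => simp
  | mk p y => exact (β.smul_left _ _).symm
  | add a b ha hb => simp only [map_add, ha, hb]

variable {X X' : BiMod R R} {Y Y' : BiMod S S} {P P' : BiMod R S}

/-- Expanding the intermediate value in a dual basis of P' turns the trace into a double sum.
Exchanging f and g only swaps the two tensor factors and the order of summation, from which
cyclicity is read off. -/
theorem traceWith_composeStep (b : DualBasis P) (b' : DualBasis P')
    (f : Hom (tensor X P') (tensor P Y)) (g : Hom (tensor X' P) (tensor P' Y')) (x : X) (x' : X') :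
    traceWith b (composeStep f g) (toShadow _ (pure x x')) =
      ∑ i, ∑ k, toShadow (tensor Y Y') (pure (contract Y (b.φ i) (f (pure x (b'.e k))))
        (contract Y' (b'.φ k) (g (pure x' (b.e i))))) := by
  rw [traceWith_apply]
  refine Finset.sum_congr rfl fun i _ => ?_
  rw [← map_sum]
  refine congrArg _ ?_
  have h : partialApp (composeStep f g) (pure x x') (b.e i) =
      stepMap f Y' x (g (pure x' (b.e i))) := rfl
  rw [h]
  conv_lhs => rw [← b'.expand_tensor (g (pure x' (b.e i))), map_sum, map_sum]
  exact Finset.sum_congr rfl fun k _ => contract_assocAux _ _ _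

/-- The trace is cyclic. -/
theorem theta_traceWith_composeStep (b : DualBasis P) (b' : DualBasis P')
    (f : Hom (tensor X P') (tensor P Y)) (g : Hom (tensor X' P) (tensor P' Y'))
    (s : Shadow (tensor X X')) :
    theta Y Y' (traceWith b (composeStep f g) s) =
      traceWith b' (composeStep g f) (theta X X' s) := by
  have h : ((thetaHom Y Y').comp (traceWith b (composeStep f g))).comp (toShadow (tensor X X')) =
      ((traceWith b' (composeStep g f)).comp (thetaHom X X')).comp (toShadow (tensor X X')) := by
    refine addHom_ext fun x x' => ?_
    change thetaHom Y Y' (traceWith b (composeStep f g) (toShadow _ (pure x x'))) =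
      traceWith b' (composeStep g f) (toShadow _ (pure x' x))
    rw [traceWith_composeStep b b', traceWith_composeStep b' b, map_sum, Finset.sum_comm]
    refine Finset.sum_congr rfl fun i _ => ?_
    simp only [map_sum, thetaHom_pure]
  obtain ⟨z, rfl⟩ := toShadow_surjective _ s
  exact DFunLike.congr_fun h z

theorem traceWith_natural (b : DualBasis P) {α : Hom X X'} {β : Hom Y Y'}
    {f : Hom (tensor X P) (tensor P Y)} {g : Hom (tensor X' P) (tensor P Y')}
    (H : Sq α β (Hom.id P) (Hom.id P) f g) (s : Shadow X) :
    traceWith b g (shadowMap α s) = shadowMap β (traceWith b f s) := by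
  obtain ⟨x, rfl⟩ := toShadow_surjective _ s
  rw [shadowMap_toShadow, traceWith_apply, traceWith_apply, map_sum]
  refine Finset.sum_congr rfl fun i _ => ?_
  rw [shadowMap_toShadow]
  refine congrArg _ ((congrArg _ (H.apply (pure x (b.e i)))).trans ?_)
  exact contract_tmap_right _ _ _

variable {M : BiMod R R} {N : BiMod S S}

/-- Rotation is the cyclicity isomorphism followed by `powSnoc`. The first moves f from the front of
the loop to its end; the second identifies the result with the composite of the extended path. -/
theorem rot_traceWith_cons (b : DualBasis P) (b' : DualBasis P') {k : ℕ}
    (f : Hom (tensor M P') (tensor P N)) (p : TwistedPath M N k P' P) (s : Shadow (pow M (k + 1))) :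
    rot N (k + 1) (traceWith b (TwistedPath.cons f p).eval s) =
      traceWith b' (p.snoc f).eval (rot M (k + 1) s) := by
  have h1 := theta_traceWith_composeStep b b' f p.eval s
  have h2 := traceWith_natural b' (p.eval_snoc f) (theta M (pow M k) s)
  rw [← h1] at h2
  exact h2.symm

/-- Moving the first map of a closed path to its end gives the same loop based at the next index. -/
theorem rotGen_traceWith {I : Type} (s : I → I) (c : I → BiMod R S)
    (f : ∀ i, Hom (tensor M (c (s i))) (tensor (c i) N)) (b : ∀ i, DualBasis (c i)) (n : ℕ)
    [NeZero n] (i : I) (h : s^[n] i = i) (h' : s^[n] (s i) = s i) :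
    rotGen M N n (traceWith (b i) (TwistedPath.iter s c f n i i h).eval) =
      traceWith (b (s i)) (TwistedPath.iter s c f n (s i) (s i) h').eval := by
  obtain ⟨k, rfl⟩ := Nat.exists_eq_succ_of_ne_zero (NeZero.ne n)
  have h1 : s^[k] (s i) = i := h
  refine AddMonoidHom.ext fun x => ?_
  have h2 := rot_traceWith_cons (b i) (b (s i)) (f i) (TwistedPath.iter s c f k (s i) i h1)
    ((rot M (k + 1)).symm x)
  rw [AddEquiv.apply_symm_apply, TwistedPath.iter_snoc] at h2
  exact h2

/-- The trace of an endomorphism of a direct sum is the sum of the traces of its diagonal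
entries. -/
theorem traceWith_piMod {I : Type} [Fintype I] [DecidableEq I] (c : I → BiMod R S)
    (b : DualBasis (piMod c)) (b' : ∀ i, DualBasis (c i))
    (G : Hom (tensor X (piMod c)) (tensor (piMod c) Y)) (x : X) :
    traceWith b G (toShadow X x) = ∑ i, ∑ k, toShadow Y (contract Y ((b' i).φ k)
      (tmap (piProj c i) (Hom.id Y) (G (pure x (piIncl c i ((b' i).e k)))))) := by
  -- The identity of the sum is ∑ incl ∘ proj. For each i, cyclicity moves the projection to the
  -- other side and replaces the dual basis of the sum by that of the i-th summand.
  have h : ∀ i, ∑ t, toShadow Y (contract Y (b.φ t) (G (pure x (piIncl c i (piProj c i (b.e t)))))) =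
      ∑ k, toShadow Y (contract Y ((b' i).φ k)
        (tmap (piProj c i) (Hom.id Y) (G (pure x (piIncl c i ((b' i).e k)))))) := by
    intro i
    refine (trace_cyclic b (b' i) (piProj c i).right
      ((partialApp G x).comp (piIncl c i).right)).trans ?_
    refine Finset.sum_congr rfl fun k _ => ?_
    rw [contract_tmap]
    rfl
  rw [traceWith_apply, ← Finset.sum_congr rfl fun i _ => h i, Finset.sum_comm]
  refine Finset.sum_congr rfl fun t _ => ?_
  rw [← map_sum, ← map_sum]
  refine congrArg _ (congrArg _ ?_)
  change G (pure x (b.e t)) = _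
  conv_lhs => rw [← sum_piIncl_piProj c (b.e t), ← pureHom_apply, map_sum, map_sum]
  rfl

/-- The `n`-fold composite of `f : M ⊗ P → P ⊗ N` as a path. -/
def TwistedPath.const (f : Hom (tensor M P) (tensor P N)) (n : ℕ) : TwistedPath M N n P P :=
  TwistedPath.iter (fun u : Unit => u) (fun _ => P) (fun _ => f) n () () rfl

theorem EndObj.diag_path (A : EndObj M N) {n : ℕ} [NeZero n] :
    ∀ (k : ℕ) (i j : Fin n) (h : (fun j : Fin n => j + 1)^[k] i = j),
      (A.diag n).path k i j h = TwistedPath.const A.f k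
  | 0, _, _, rfl => rfl
  | k + 1, i, j, h => congrArg (TwistedPath.cons A.f) (A.diag_path k (i + 1) j h)

theorem traceMap_cls (A : EndObj M N) : traceMap M N (KTilde.cls A) = A.trace :=
  K0Red.lift_cls _ _ _ _ A

theorem iterTrace_cls (A : EndObj M N) (b : DualBasis A.P.mod) (n : ℕ) [NeZero n] :
    iterTrace M N n (KTilde.cls A) = traceWith b (TwistedPath.const A.f n).eval := by
  have h : (A.diag n).gammaHom = (TwistedPath.const A.f n).eval := by
    rw [CycObj.gammaHom_eq, EndObj.diag_path]
    rfl
  have h' : iterTrace M N n (KTilde.cls A) = (A.diag n).gamma.trace :=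
    traceMap_cls (A.diag n).gamma
  rw [← h, h']
  exact (A.diag n).gamma.trace_eq b

theorem rotGen_add (j : ℕ) (f g : Shadow (pow M j) →+ Shadow (pow N j)) :
    rotGen M N j (f + g) = rotGen M N j f + rotGen M N j g :=
  AddMonoidHom.ext fun _ => map_add (rot N j) _ _

/-- The generator of the `ℤ/j`-action as a homomorphism. -/
def rotGenHom (M : BiMod R R) (N : BiMod S S) (j : ℕ) :
    (Shadow (pow M j) →+ Shadow (pow N j)) →+ (Shadow (pow M j) →+ Shadow (pow N j)) :=
  AddMonoidHom.mk' (rotGen M N j) (rotGen_add j)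

/-- On generators the loop is constant, so starting it one step later changes nothing. -/
theorem rotGen_iterTrace (j : ℕ) [NeZero j] (x : KTilde M N) :
    rotGen M N j (iterTrace M N j x) = iterTrace M N j x := by
  change rotGenHom M N j (iterTrace M N j x) = _
  induction x using K0Red.induction with
  | h0 => rw [map_zero, map_zero]
  | hcls A =>
    obtain ⟨b⟩ := DualBasis.nonempty A.P.fgp
    refine (congrArg (rotGen M N j) (iterTrace_cls A b j)).trans
      (Eq.trans ?_ (iterTrace_cls A b j).symm)
    exact rotGen_traceWith (fun u : Unit => u) (fun _ => A.P.mod) (fun _ => A.f) (fun _ => b) j ()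
      rfl rfl
  | hneg x hx => rw [map_neg, map_neg, hx]
  | hadd x y hx hy => rw [map_add, map_add, hx, hy]

/-! ### Iterated traces of cyclic sums -/

theorem CycObj.sigma_path {n : ℕ} [NeZero n] (A : CycObj M N n) :
    ∀ (k : ℕ) (i j : Fin n) (h : (fun j : Fin n => j + 1)^[k] i = j),
      TwistedPath.Map (A.path k i j h) (TwistedPath.const A.sigma.f k)
        (incl (fun j => (A.c j).mod) i) (incl (fun j => (A.c j).mod) j)
  | 0, _, _, rfl => TwistedPath.Map.nil _
  | k + 1, i, j, h => TwistedPath.Map.cons (A.sigmaHom_incl i) (CycObj.sigma_path A k (i + 1) j h)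

/-- The j-th iterate on the direct sum moves each summand along its own path of length j. A diagonal
entry can therefore be nonzero only where that path is closed, and there it is the composite along
the path. -/
theorem iterTrace_sigma {n : ℕ} [NeZero n] (A : CycObj M N n) (b : ∀ i, DualBasis (A.c i).mod)
    (j : ℕ) [NeZero j] : iterTrace M N j (KTilde.cls A.sigma) =
      ∑ i, if h : (fun j : Fin n => j + 1)^[j] i = i then
        traceWith (b i) (A.path j i i h).eval else 0 := by
  obtain ⟨b'⟩ := DualBasis.nonempty A.sigma.P.fgp
  rw [iterTrace_cls A.sigma b']
  refine shadow_hom_ext fun x => ?_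
  refine (traceWith_piMod (fun i => (A.c i).mod) b' b _ x).trans ?_
  rw [AddMonoidHom.finsetSum_apply]
  refine Finset.sum_congr rfl fun i _ => ?_
  -- The summand i is sent to the summand t from which i is reached in j steps; it is diagonal
  -- exactly when t = i.
  obtain ⟨t, ht⟩ : ∃ t : Fin n, (fun j : Fin n => j + 1)^[j] t = i := by
    refine ⟨i - Fin.ofNat n j, ?_⟩
    rw [fin_succ_iterate, sub_add_cancel]
  have h1 : ∀ y, (TwistedPath.const A.sigma.f j).eval (pure x (piIncl (fun i => (A.c i).mod) i y)) =
      tmap (piIncl (fun i => (A.c i).mod) t) (Hom.id (pow N j)) ((A.path j t i ht).eval (pure x y)) :=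
    fun y => DFunLike.congr_fun (A.sigma_path j t i ht).intertwines (pure x y)
  refine (Finset.sum_congr rfl fun s _ => congrArg (toShadow (pow N j)) (congrArg
    (contract (pow N j) ((b i).φ s)) ((congrArg (tmap (piProj (fun i => (A.c i).mod) i)
      (Hom.id (pow N j))) (h1 ((b i).e s))).trans (tmap_comp_apply _ _ _ _ _)))).trans ?_
  rw [Hom.comp_id]
  split_ifs with h
  · obtain rfl : t = i := by
      rw [fin_succ_iterate] at ht h
      exact add_right_cancel (ht.trans h.symm)
    rw [traceWith_apply, piProj_piIncl_self]
    simp only [tmap_id_apply]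
    rfl
  · have h2 : i ≠ t := by
      rintro rfl
      exact h ht
    rw [piProj_piIncl_of_ne _ h2, tmap_zero_left]
    simp

theorem fin_iterate_eq_iff {n : ℕ} [NeZero n] (j : ℕ) (i : Fin n) :
    (fun j : Fin n => j + 1)^[j] i = i ↔ n ∣ j := by
  rw [fin_succ_iterate, add_eq_left, Nat.dvd_iff_mod_eq_zero, Fin.ext_iff]
  simp

theorem iterTrace_sigmaMap_of_not_dvd {n j : ℕ} [NeZero n] [NeZero j] (h : ¬ n ∣ j)
    (y : KTildeCyc M N n) : iterTrace M N j (sigmaMap M N n y) = 0 := by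
  induction y using K0Red.induction with
  | h0 => rw [map_zero, map_zero]
  | hcls A =>
    refine (iterTrace_sigma A (fun i => Classical.choice (DualBasis.nonempty (A.c i).fgp)) j).trans ?_
    exact Finset.sum_eq_zero fun i _ => dif_neg fun hi => h ((fin_iterate_eq_iff j i).1 hi)
  | hneg x hx => rw [map_neg, map_neg, hx, neg_zero]
  | hadd x y hx hy => rw [map_add, map_add, hx, hy, add_zero]

theorem rotGen_iterate_add (j i : ℕ) (f g : Shadow (pow M j) →+ Shadow (pow N j)) :
    (rotGen M N j)^[i] (f + g) = (rotGen M N j)^[i] f + (rotGen M N j)^[i] g := by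
  induction i generalizing f g with
  | zero => rfl
  | succ i ih => rw [Function.iterate_succ_apply, rotGen_add, ih]; rfl

/-- The transfer as a homomorphism. -/
def transferHom (M : BiMod R R) (N : BiMod S S) (n k : ℕ) :
    (Shadow (pow (pow M n) k) →+ Shadow (pow (pow N n) k)) →+
      (Shadow (pow M (n * k)) →+ Shadow (pow N (n * k))) :=
  AddMonoidHom.mk' (transferMap M N n k) fun f g => by
    have h : ((shadowIso (powMul N n k)).toAddMonoidHom.comp (f + g)).comp
        (shadowIso (powMul M n k)).symm.toAddMonoidHom =
        ((shadowIso (powMul N n k)).toAddMonoidHom.comp f).comp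
          (shadowIso (powMul M n k)).symm.toAddMonoidHom +
        ((shadowIso (powMul N n k)).toAddMonoidHom.comp g).comp
          (shadowIso (powMul M n k)).symm.toAddMonoidHom :=
      AddMonoidHom.ext fun _ => map_add (shadowIso (powMul N n k)) _ _
    simp only [transferMap, h, rotGen_iterate_add, Finset.sum_add_distrib]

/-- Every index carries a closed path of length nk. The corresponding n traces form one orbit of the
rotation, and summing over it is the transfer. -/
theorem iterTrace_sigma_mul {n k : ℕ} [NeZero n] [NeZero k] [NeZero (n * k)] (A : CycObj M N n) :
    iterTrace M N (n * k) (KTilde.cls A.sigma) =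
      transferMap M N n k (iterTrace (pow M n) (pow N n) k (KTilde.cls A.gamma)) := by
  let b : ∀ i, DualBasis (A.c i).mod := fun i => Classical.choice (DualBasis.nonempty (A.c i).fgp)
  have hi : ∀ i : Fin n, (fun j : Fin n => j + 1)^[n * k] i = i := fun i =>
    (fin_iterate_eq_iff (n * k) i).2 (Nat.dvd_mul_right n k)
  let T : Fin n → (Shadow (pow M (n * k)) →+ Shadow (pow N (n * k))) :=
    fun i => traceWith (b i) (A.path (n * k) i i (hi i)).eval
  have h1 : iterTrace M N (n * k) (KTilde.cls A.sigma) = ∑ i, T i :=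
    (iterTrace_sigma A b (n * k)).trans (Finset.sum_congr rfl fun i _ => dif_pos (hi i))
  have h2 : ∀ i, rotGen M N (n * k) (T i) = T (i + 1) := fun i =>
    rotGen_traceWith (fun j : Fin n => j + 1) (fun j => (A.c j).mod) A.f b (n * k) i (hi i)
      (hi (i + 1))
  have h3 : ∀ t, T (cycIdx n t) = (rotGen M N (n * k))^[t] (T 0) := by
    intro t
    induction t with
    | zero => rfl
    | succ t ih => rw [Function.iterate_succ_apply', ← ih, h2]; rfl
  -- The loop at index 0 is the k-fold iterate of the single block ΓA, after identifying the
  -- iterated tensor powers; the trace is natural in the coefficients.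
  have h4 : ((shadowIso (powMul N n k)).toAddMonoidHom.comp
      (iterTrace (pow M n) (pow N n) k (KTilde.cls A.gamma))).comp
        (shadowIso (powMul M n k)).symm.toAddMonoidHom = T 0 := by
    have h5 : iterTrace (pow M n) (pow N n) k (KTilde.cls A.gamma) =
      traceWith (b 0) (TwistedPath.const A.gammaHom k).eval := iterTrace_cls A.gamma (b 0) k
    rw [h5, CycObj.gammaHom_eq]
    have h6 := TwistedPath.eval_iter_mul (fun j : Fin n => j + 1) (fun j => (A.c j).mod) A.f
      (fun u : Unit => u) (fun _ => 0) n (fun _ => succ_iterate n) k () () rfl (hi 0)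
    refine AddMonoidHom.ext fun x => ?_
    refine (traceWith_natural (b 0) h6 ((shadowIso (powMul M n k)).symm x)).symm.trans ?_
    exact congrArg (T 0) ((shadowIso (powMul M n k)).apply_symm_apply x)
  rw [h1, transferMap, h4, Finset.sum_range]
  refine Finset.sum_congr rfl fun i _ => ?_
  rw [← h3, cycIdx_val]

theorem iterTrace_sigmaMap_mul {n k : ℕ} [NeZero n] [NeZero k] [NeZero (n * k)]
    (y : KTildeCyc M N n) : iterTrace M N (n * k) (sigmaMap M N n y) =
      transferMap M N n k (iterTrace (pow M n) (pow N n) k (gammaMap M N n y)) := by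
  change _ = transferHom M N n k (iterTrace (pow M n) (pow N n) k (gammaMap M N n y))
  induction y using K0Red.induction with
  | h0 => simp only [map_zero]
  | hcls A => exact iterTrace_sigma_mul A
  | hneg x hx => simp only [map_neg, hx]
  | hadd x y hx hy => simp only [map_add, hx, hy]

end TraceProperties

/-! ### Assembly of the theorem -/

theorem mainTheorem2 {R S : Type u} [Ring R] [Ring S] (M : BiMod R R) (N : BiMod S S)
    (hG : ∀ P : BiMod R S, P.IsFGP → (BiMod.tensor M P).IsFGP)
    (hH : ∀ P : BiMod R S, P.IsFGP → (BiMod.tensor P N).IsFGP)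
    (hMN : Nonempty (BiMod.Iso M (BiMod.unit R)) ∨ Nonempty (BiMod.Iso N (BiMod.unit S))) :
    ∃ (hΓ : ∀ (n : ℕ) [NeZero n], Function.Bijective (gammaMap M N n))
      (hΓ' : ∀ (n m : ℕ) [NeZero n] [NeZero m],
        Function.Bijective (gammaMap (BiMod.pow M n) (BiMod.pow N n) m)),
      (∀ (n m : ℕ) [NeZero n] [NeZero m]
        (x : KTilde (BiMod.pow (BiMod.pow M n) m) (BiMod.pow (BiMod.pow N n) m)),
        verschiebungMap M N n (hΓ n)
            (verschiebungMap (BiMod.pow M n) (BiMod.pow N n) m (hΓ' n m) x) =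
          verschiebungMap M N (n * m) (hΓ (n * m))
            (coeffMap (BiMod.powMul M n m) (BiMod.powMul N n m) x)) ∧
      (∀ (j : ℕ) [NeZero j] (x : KTilde M N),
        rotGen M N j (iterTrace M N j x) = iterTrace M N j x) ∧
      (∀ (n k : ℕ) [NeZero n] [NeZero k] (x : KTilde (BiMod.pow M n) (BiMod.pow N n)),
        iterTrace M N (n * k) (verschiebungMap M N n (hΓ n) x) =
          transferMap M N n k (iterTrace (BiMod.pow M n) (BiMod.pow N n) k x)) ∧
      (∀ (n j : ℕ) [NeZero n] [NeZero j], ¬ n ∣ j →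
        ∀ x : KTilde (BiMod.pow M n) (BiMod.pow N n),
          iterTrace M N j (verschiebungMap M N n (hΓ n) x) = 0) := by
  have hΓ : ∀ (n : ℕ) [NeZero n], Function.Bijective (gammaMap M N n) := fun n _ =>
    gammaMap_bijective hG hH hMN n
  have hΓ' : ∀ (n m : ℕ) [NeZero n] [NeZero m],
      Function.Bijective (gammaMap (BiMod.pow M n) (BiMod.pow N n) m) := fun n m _ _ =>
    gammaMap_pow_bijective hG hH hMN n m
  refine ⟨hΓ, hΓ', fun n m _ _ x => verschiebungMap_verschiebungMap _ _ _ x,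
    fun j _ x => rotGen_iterTrace j x, fun n k _ _ x => ?_, fun n j _ _ h x => ?_⟩
  -- Γ is onto, so x may be taken to be Γy; then V^n x is σy and the formulas for cyclic sums apply.
  · obtain ⟨y, rfl⟩ := (hΓ n).2 x
    rw [verschiebungMap_gammaMap]
    exact iterTrace_sigmaMap_mul y
  · obtain ⟨y, rfl⟩ := (hΓ n).2 x
    rw [verschiebungMap_gammaMap]
    exact iterTrace_sigmaMap_of_not_dvd h y
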